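/- **Setting.** Norms are 2-norms, $\mathcal B_q(z)$ is the open ball, $\widehat Q=Q+Q^\top$, $\mathcal X\subseteq\mathbb R^{n}$ is open, $\mathcal U\subseteq\mathbb R^{m}$. The true system is $\dot x=h(x,u)$; the learned model is $g(x,u)=f(x)+B(x)u$ with $f,B$ of class $C^1$ on $\mathcal X$; $M$ is a smooth Riemannian metric on $\mathcal X$ (symmetric positive definite matrices) and $W=M^{-1}$. $\mathrm{dist}(p,q)$ is the infimum of $\int_0^1\sqrt{c_s^\top M(c)c_s}\,ds$ over continuously differentiable curves $c$ in $\mathcal X$ from $p$ to $q$, and $\mathcal E=\mathrm{dist}^2$. Given data $(x_i,u_i)$, $1\le i\le N$, with errors $e_i=\|h(x_i,u_i)-g(x_i,u_i)\|$, the trusted domain is $D=\bigcup_i\mathcal B_r(x_i,u_i)$, assumed to lie in $\mathcal X\times\mathcal U$; $\mathrm{proj}_xD$ is its projection to $\mathcal X$, and $D_q=\{z:\mathcal B_q(z)\subseteq D\}$. $\lambda\in\mathbb R$ is the contraction rate. $\partial_yQ=\sum_i y^i\,\partial Q/\partial x^i$. **Estimates.** $L$, $\bar\Lambda$ and $\underline\Lambda>0$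 are estimates of $L_{h-g}$ (the smallest Lipschitz constant of $h-g$ on $D$), of $\bar\lambda_D(M)=\sup_{\mathrm{proj}_xD}\bar\lambda(M(x))$ and of $\underline\lambda_D(M)=\inf_{\mathrm{proj}_xD}\underline\lambda(M(x))$. The planner's feedback bound is $\bar u_{\rm fb}(t)=\delta_u\bar\epsilon(t)$ with a constant $\delta_u\ge0$ in the strong case, and a given continuous function $\bar u_{\rm fb}(t)\ge0$ of time in the weak case. **Planner (LMTCD-RRT).** Inputs: $x_I,x_G\in\mathbb R^n$, goal tolerance $\mu$, initial energy bound $\mathcal E_0$, unsafe set. It grows a tree of nodes (state, tube radius, time), with root $(x_I,\sqrt{\mathcal E_0/\underline\Lambda},0)$. In each iteration it picks a tree node $(x_{\rm n},\bar\epsilon_{\rm n},t_{\rm n})$, a constant control $u_{\rm c}\in\mathcal U$ and a dwell time $t_{\rm c}>0$ (arbitrarily). On $[t_{\rm n},t_{\rm n}+t_{\rm c}]$ it integrates $\dot x^*=g(x^*,u^*)$, $u^*\equiv u_{\rm c}$, $x^*(t_{\rm n})=x_{\rm n}$, and sets $\bar\epsilon(t)=\sqrt{\bar{\mathcal E}(t)/\underline\Lambda}$,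 where $\bar{\mathcal E}(t_{\rm n})=\underline\Lambda\,\bar\epsilon_{\rm n}^2$ and $$\dot{\bar{\mathcal E}}=-2\Big(\lambda-L\sqrt{\bar\Lambda/\underline\Lambda}\Big)\bar{\mathcal E}+2\sqrt{\bar{\mathcal E}\,\bar\Lambda}\Big(\min_{i}\big\{L\|(x^*,u^*)-(x_i,u_i)\|+e_i\big\}+L\,\bar u_{\rm fb}(t)\Big).$$ The extension is accepted, and the node $(x^*(t_{\rm n}+t_{\rm c}),\bar\epsilon(t_{\rm n}+t_{\rm c}),t_{\rm n}+t_{\rm c})$ added, iff for all $t\in[t_{\rm n},t_{\rm n}+t_{\rm c})$: $(x^*(t),u^*(t))\in D_{\bar\epsilon(t)+\bar u_{\rm fb}(t)}$; in the weak case $\bar\epsilon(t)\le\epsilon_{\max}$; and $\mathcal B_{\bar\epsilon(t)}(x^*(t))$ contains no unsafe state. When an accepted extension visits $\mathcal B_\mu(x_G)$, the planner returns the concatenated path $(x^*,u^*)$, $\bar\epsilon$ from the root, on $[0,T]$. **Execution.** On $[0,\tau]$ with $0\le\tau\le T$: a continuous $x$ with right derivative $\dot x(t)=h(x(t),u(t))$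 on $[0,\tau)$ and $\mathcal E(x_I,x(0))<\mathcal E_0$, with $u(t)$ given by the controller for all $t\in[0,\tau]$. Write $\tilde x=x-x^*$. **Theorem.** Assume $L\ge L_{h-g}$, $\bar\Lambda\ge\bar\lambda_D(M)$, $0<\underline\Lambda\le\underline\lambda_D(M)$, and that in execution $\|u(t)-u^*(t)\|\le\bar u_{\rm fb}(t)$ at all $t\in[0,\tau]$ at which $\|\tilde x(t)\|\le\bar\epsilon(t)$. 1. (Strong conditions.) Let $B_\perp(x)\in\mathbb R^{n\times k}$ have as columns a basis of the null space of $B(x)^\top$ for each $x\in\mathrm{proj}_xD$. Assume that with some $\lambda_{\rm CCM}<0$, for all $x\in \mathrm{proj}_xD$, $$\bar\lambda\Big(B_\perp^\top\big(-\partial_fW+\widehat{\tfrac{\partial f}{\partial x}W}+2\lambda W\big)B_\perp\Big)\le\lambda_{\rm CCM},\qquad B_\perp^\top\big(\partial_{B^j}W-\widehat{\tfrac{\partial B^j}{\partial x}W}\big)B_\perp=0\quad(1\le j\le m).$$ Let $u(t)$ be computed by the optimization-based controller: for a constant-speed minimizing geodesic $\gamma$ from $x^*(t)$ to $x(t)$,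 $u(t)$ minimizes $\|v-u^*(t)\|$ over all $v$ with $$2\gamma_s(1)^\top M(x)\,g(x,v)-2\gamma_s(0)^\top M(x^*)\,g(x^*,u^*)\le-2\lambda\,\mathcal E(x^*,x)$$ (nothing is required of $u(t)$ should no such $v$ exist). Then $(x^*(t),u^*(t))\in D$ and $(x(t),u(t))\in D$ for all $t\in[0,\tau]$, for every path returned by the planner and every execution. 2. (Weak condition.) Let $\kappa(\tilde x,x^*,u^*)\in\mathbb R^m$ be a feedback law such that, for all $(x^*,u^*)\in D$, $\kappa(0,x^*,u^*)=u^*$ and $\kappa(\cdot,x^*,u^*)$ is $C^1$ on $\{\tilde x\in\mathcal B_{\epsilon_{\max}}(0):x^*+\tilde x\in\mathcal X\}$. Assume that with some $\lambda_{\rm CCM}<0$, $$\bar\lambda\Big(\dot M+\widehat{M(A+BK)}+2\lambda M\Big)\le\lambda_{\rm CCM}$$ for all $(\tilde x,x^*,u^*)\in\mathcal B_{\epsilon_{\max}}(0)\times D$ with $x=x^*+\tilde x\in\mathcal X$, where everything is evaluated at $x$ and $u=\kappa(\tilde x,x^*,u^*)$, $\dot M=\partial_{g(x,u)}M$, $A=\frac{\partial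 f}{\partial x}+\sum_ju^j\frac{\partial B^j}{\partial x}$ and $K=\partial\kappa/\partial\tilde x$. Let $u(t)=\kappa(\tilde x(t),x^*(t),u^*(t))$. Then $(\tilde x(t),x^*(t),u^*(t))\in\mathcal B_{\epsilon_{\max}}(0)\times D$, and also $(x(t),u(t))\in D$, for all $t\in[0,\tau]$, for every path returned by the planner and every execution. -/

import Mathlib

open Set
open scoped NNReal ENNReal Matrix ContDiff

namespace LMTCD

noncomputable section

/-- `ℝⁿ` with the 2-norm. -/
abbrev E (n : ℕ) : Type := EuclideanSpace ℝ (Fin n)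

/-- State-control pairs `(x, u)`, with the 2-norm of the stacked vector. -/
abbrev SC (n m : ℕ) : Type := WithLp 2 (E n × E m)

/-- The stacked vector `(x, u)`. -/
abbrev pair {n m : ℕ} (x : E n) (u : E m) : SC n m := WithLp.toLp 2 (x, u)

/-! ### Linear algebra and calculus of matrix-valued functions -/

/-- Symmetrization `Q + Qᵀ`. -/
def symmetrize {n : ℕ} (Q : Matrix (Fin n) (Fin n) ℝ) : Matrix (Fin n) (Fin n) ℝ := Q + Qᵀ

/-- Jacobian matrix of `F` at `x`. -/
def jac {a b : ℕ} (F : E a → E b) (x : E a) : Matrix (Fin b) (Fin a) ℝ :=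
  Matrix.of fun i j => fderiv ℝ F x (EuclideanSpace.single j 1) i

/-- Lie derivative `∑ᵢ yⁱ ∂Q/∂xⁱ` at `x` of a matrix-valued function `Q` along the vector `y`. -/
def lieDeriv {n : ℕ} {ι κ : Type*} (Q : E n → Matrix ι κ ℝ) (y x : E n) : Matrix ι κ ℝ :=
  Matrix.of fun i j => ∑ l, y l * fderiv ℝ (fun z => Q z i j) x (EuclideanSpace.single l 1)

/-- Column `j` of a matrix, as a vector of `ℝⁿ`. -/
def col {n m : ℕ} (B : Matrix (Fin n) (Fin m) ℝ) (j : Fin m) : E n :=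
  WithLp.toLp 2 fun i => B i j

/-- `vᵀ A w`. -/
def bilin {n : ℕ} (A : Matrix (Fin n) (Fin n) ℝ) (v w : E n) : ℝ :=
  v.ofLp ⬝ᵥ (A *ᵥ w.ofLp)

/-- Supremum over `z ∈ Z` of the largest eigenvalue of the symmetric matrix `Q z`. -/
def supEig {α ι : Type*} [Fintype ι] [DecidableEq ι] (Z : Set α) (Q : α → Matrix ι ι ℝ) : EReal :=
  ⨆ z ∈ Z, ⨆ a ∈ spectrum ℝ (Q z), (a : EReal)

/-- Infimum over `z ∈ Z` of the smallest eigenvalue of the symmetric matrix `Q z`. -/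
def infEig {α ι : Type*} [Fintype ι] [DecidableEq ι] (Z : Set α) (Q : α → Matrix ι ι ℝ) : EReal :=
  ⨅ z ∈ Z, ⨅ a ∈ spectrum ℝ (Q z), (a : EReal)

/-- The smallest Lipschitz constant of `F` on `Z` (`⊤` if `F` is not Lipschitz on `Z`). -/
def lipConst {α β : Type*} [PseudoEMetricSpace α] [PseudoEMetricSpace β]
    (F : α → β) (Z : Set α) : EReal :=
  ⨅ K : ℝ≥0, ⨅ _ : LipschitzOnWith K F Z, ((K : ℝ) : EReal)

/-- The Minkowski difference `Z ⊖ B_q(0)`. -/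
def erode {α : Type*} [PseudoMetricSpace α] (Z : Set α) (q : ℝ) : Set α :=
  {z | Metric.ball z q ⊆ Z}

/-- The columns of `P` form a basis of the null space of `Bᵀ`. -/
def IsAnnihilatorBasis {n m k : ℕ} (B : Matrix (Fin n) (Fin m) ℝ)
    (P : Matrix (Fin n) (Fin k) ℝ) : Prop :=
  LinearIndependent ℝ P.col ∧ Submodule.span ℝ (Set.range P.col) = LinearMap.ker Bᵀ.mulVecLin

/-! ### Riemannian geometry of the metric `x ↦ M x` on the state space `X` -/

/-- `c : [0, 1] → X` is a continuously differentiable curve from `p` to `q`. -/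
structure IsCurve {n : ℕ} (X : Set (E n)) (p q : E n) (c : ℝ → E n) : Prop where
  contDiff : ContDiffOn ℝ 1 c (Icc 0 1)
  mem : ∀ s ∈ Icc (0 : ℝ) 1, c s ∈ X
  source : c 0 = p
  target : c 1 = q

/-- The velocity `∂c(s)/∂s` of a curve on `[0, 1]`. -/
def velocity {n : ℕ} (c : ℝ → E n) (s : ℝ) : E n := derivWithin c (Icc 0 1) s

/-- The local length `√(c_sᵀ M(c) c_s)`. -/
def speed {n : ℕ} (M : E n → Matrix (Fin n) (Fin n) ℝ) (c : ℝ → E n) (s : ℝ) : ℝ :=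
  √(bilin (M (c s)) (velocity c s) (velocity c s))

/-- The length of a curve. -/
def length {n : ℕ} (M : E n → Matrix (Fin n) (Fin n) ℝ) (c : ℝ → E n) : ℝ :=
  ∫ s in (0 : ℝ)..1, speed M c s

/-- The Riemann distance of `p` and `q` in `X` (`⊤` if no curve in `X` joins them). -/
def riemDist {n : ℕ} (X : Set (E n)) (M : E n → Matrix (Fin n) (Fin n) ℝ) (p q : E n) : ℝ≥0∞ :=
  ⨅ (c : ℝ → E n) (_ : IsCurve X p q c), ENNReal.ofReal (length M c)

/-- The Riemann energy, the squared Riemann distance. -/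
def energy {n : ℕ} (X : Set (E n)) (M : E n → Matrix (Fin n) (Fin n) ℝ) (p q : E n) : ℝ≥0∞ :=
  riemDist X M p q ^ 2

/-- `γ` is a minimizing geodesic from `p` to `q`, parametrized with constant speed. -/
structure IsMinGeodesic {n : ℕ} (X : Set (E n)) (M : E n → Matrix (Fin n) (Fin n) ℝ)
    (p q : E n) (γ : ℝ → E n) : Prop where
  curve : IsCurve X p q γ
  constSpeed : ∀ s ∈ Icc (0 : ℝ) 1, speed M γ s = length M γ
  minimal : ENNReal.ofReal (length M γ) = riemDist X M p q

/-! ### True system, learned model, data, trusted domain -/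

/-- The objects at hand before planning: state space `X`, control space `U`, true dynamics `h`,
learned control-affine model `(f, B)`, metric `M`, the state-control pairs `data i` of the training
set, the radius `r` of the trusted balls, and the contraction rate `rate`.  The functions are total;
only their values on `X` and `X × U` are meant. -/
structure Setup (n m N : ℕ) where
  X : Set (E n)
  U : Set (E m)
  h : SC n m → E n
  f : E n → E n
  B : E n → Matrix (Fin n) (Fin m) ℝ
  M : E n → Matrix (Fin n) (Fin n) ℝ
  data : Fin N → SC n m
  r : ℝ
  rate : ℝ

namespace Setup

variable {n m N : ℕ} (S : Setup n m N)

/-- The learned model `g(x, u) = f(x) + B(x) u`. -/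
def g (z : SC n m) : E n := S.f z.fst + WithLp.toLp 2 (S.B z.fst *ᵥ z.snd.ofLp)

/-- The model error `h - g`. -/
def modelError (z : SC n m) : E n := S.h z - S.g z

/-- The training error `e_i`. -/
def e (i : Fin N) : ℝ := ‖S.modelError (S.data i)‖

/-- The trusted domain, the union of the `r`-balls around the training data. -/
def D : Set (SC n m) := ⋃ i, Metric.ball (S.data i) S.r

/-- The projection of the trusted domain to the state space. -/
def projD : Set (E n) := (fun z : SC n m => z.fst) '' S.D

/-- The dual metric `W(x) = M(x)⁻¹`. -/
def W (x : E n) : Matrix (Fin n) (Fin n) ℝ := (S.M x)⁻¹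

/-- Regularity: the state space is open, contains the states of the trusted domain, the controls
of the trusted domain are admissible, the model is `C¹` and the metric is a smooth Riemannian metric
tensor. -/
structure Regular : Prop where
  isOpen : IsOpen S.X
  domain : ∀ z ∈ S.D, z.fst ∈ S.X ∧ z.snd ∈ S.U
  smooth_f : ContDiffOn ℝ 1 S.f S.X
  smooth_B : ∀ i j, ContDiffOn ℝ 1 (fun x => S.B x i j) S.X
  smooth_M : ∀ i j, ContDiffOn ℝ ∞ (fun x => S.M x i j) S.X
  posDef_M : ∀ x ∈ S.X, (S.M x).PosDef

/-! ### The strong contraction conditions and the optimization-based controller -/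

/-- `F(x) = -∂_f W + sym(∂f/∂x W) + 2 λ W`. -/
def F (x : E n) : Matrix (Fin n) (Fin n) ℝ :=
  -lieDeriv S.W (S.f x) x + symmetrize (jac S.f x * S.W x) + (2 * S.rate) • S.W x

/-- `C^s(x) = B_⊥(x)ᵀ F(x) B_⊥(x)`. -/
def Cs {k : ℕ} (Bperp : E n → Matrix (Fin n) (Fin k) ℝ) (x : E n) : Matrix (Fin k) (Fin k) ℝ :=
  (Bperp x)ᵀ * S.F x * Bperp x

/-- The orthogonality condition at `x`. -/
def StrongOrth {k : ℕ} (Bperp : E n → Matrix (Fin n) (Fin k) ℝ) (x : E n) : Prop :=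
  ∀ j : Fin m,
    (Bperp x)ᵀ * (lieDeriv S.W (col (S.B x) j) x - symmetrize (jac (fun y => col (S.B y) j) x * S.W x))
      * Bperp x = 0

/-- The control `v` at the state `x`, tracking `(xs, us)`, makes the energy of the geodesic `γ` from
`xs` to `x` decrease with rate `λ` under the learned model (first variation of the energy). -/
def Contracts (xs : E n) (us : E m) (x : E n) (γ : ℝ → E n) (v : E m) : Prop :=
  2 * bilin (S.M x) (velocity γ 1) (S.g (pair x v))
      - 2 * bilin (S.M xs) (velocity γ 0) (S.g (pair xs us))
    ≤ -2 * S.rate * length S.M γ ^ 2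

/-- `v` is a value of the optimization-based tracking controller at the state `x` when tracking
`(xs, us)`: a minimizing geodesic `γ` is computed and `v` minimizes the feedback effort `‖v - us‖`
among the contracting controls.  When that optimization problem is infeasible, nothing is
required of `v`. -/
def IsStrongControl (xs : E n) (us : E m) (x : E n) (v : E m) : Prop :=
  ∃ γ : ℝ → E n, IsMinGeodesic S.X S.M xs x γ ∧
    ((∃ v', S.Contracts xs us x γ v') →
      S.Contracts xs us x γ v ∧ ∀ v', S.Contracts xs us x γ v' → ‖v - us‖ ≤ ‖v' - us‖)

/-! ### The weak contraction condition for a feedback law `κ(x̃, x*, u*)` -/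

/-- `A(x, u) = ∂f/∂x + ∑ⱼ uʲ ∂Bʲ/∂x`. -/
def A (x : E n) (u : E m) : Matrix (Fin n) (Fin n) ℝ :=
  jac S.f x + ∑ j, u j • jac (fun y => col (S.B y) j) x

/-- `C^w(x̃, x*, u*) = Ṁ + sym(M (A + B K)) + 2 λ M` at `x = x* + x̃` and `u = κ(x̃, x*, u*)`, with
`K = ∂κ/∂x` and `Ṁ` the derivative of `M` along the learned closed loop. -/
def Cw (κ : E n → E n → E m → E m) (q : E n × SC n m) : Matrix (Fin n) (Fin n) ℝ :=
  let x := q.2.fst + q.1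
  let u := κ q.1 q.2.fst q.2.snd
  lieDeriv S.M (S.g (pair x u)) x
    + symmetrize (S.M x * (S.A x u + S.B x * jac (fun y => κ y q.2.fst q.2.snd) q.1))
    + (2 * S.rate) • S.M x

/-- The set `B_ε(0) × D` on which the weak condition is verified (only those deviations matter
for which the state `x* + x̃` exists). -/
def weakDomain (ε : ℝ) : Set (E n × SC n m) :=
  {q | q.1 ∈ Metric.ball 0 ε ∧ q.2 ∈ S.D ∧ q.2.fst + q.1 ∈ S.X}

end Setup

/-! ### The planner -/

/-- Estimates used by the planner: of the Lipschitz constant of `h - g`, of `λ̄_D(M)` and of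
`λ̲_D(M)`. -/
structure Estimates where
  L : ℝ
  lamUp : ℝ
  lamLo : ℝ

/-- The kind of controller, with the planner's estimate of the feedback bound `ū_fb(t)`:
`δᵤ ε̄(t)` for the optimization-based controller, a given function of time for a learned
controller, which comes with the largest allowed tube radius `ε_max`. -/
inductive Mode where
  | strong (δu : ℝ)
  | weak (ufb : ℝ → ℝ) (εmax : ℝ)

/-- The estimated feedback bound `ū_fb` at time `t` if the tube radius is `ε`. -/
def Mode.ubar : Mode → ℝ → ℝ → ℝ
  | .strong δu, _, ε => ε * δu
  | .weak ufb _, t, _ => ufb t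

/-- The additional check on the tube radius for a learned controller. -/
def Mode.Check : Mode → ℝ → Prop
  | .strong _, _ => True
  | .weak _ εmax, ε => ε ≤ εmax

/-- The remaining planner inputs: start, goal, goal tolerance, initial energy bound `𝓔₀`, unsafe
states. -/
structure Query (n : ℕ) where
  xI : E n
  xG : E n
  μ : ℝ
  E0 : ℝ
  unsafeStates : Set (E n)

/-- A vertex of the search tree.  A non-root vertex records its parent, the control `uc`, the dwell
time `tc`, and the edge: the candidate state trajectory `xc` and tube radius `εc`, as functions
of absolute time. -/
inductive Vertex (n m : ℕ) where
  | root (x : E n) (ε : ℝ)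
  | child (parent : Vertex n m) (uc : E m) (tc : ℝ) (xc : ℝ → E n) (εc : ℝ → ℝ)

namespace Vertex

variable {n m : ℕ}

/-- The time at which the vertex is reached. -/
def time : Vertex n m → ℝ
  | root _ _ => 0
  | child p _ tc _ _ => p.time + tc

/-- The state of the vertex. -/
def state : Vertex n m → E n
  | root x _ => x
  | child p _ tc xc _ => xc (p.time + tc)

/-- The tube radius at the vertex. -/
def err : Vertex n m → ℝ
  | root _ ε => ε
  | child p _ tc _ εc => εc (p.time + tc)

/-- The nominal state trajectory `x*(t)` from the root to the vertex. -/
def xs : Vertex n m → ℝ → E n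
  | root x _, _ => x
  | child p _ _ xc _, t => if t < p.time then p.xs t else xc t

/-- The nominal control trajectory `u*(t)` from the root to the vertex. -/
def us : Vertex n m → ℝ → E m
  | root _ _, _ => 0
  | child p uc _ _ _, t => if t < p.time then p.us t else uc

/-- The tube radius `ε̄(t)` along the path from the root to the vertex. -/
def tube : Vertex n m → ℝ → ℝ
  | root _ ε, _ => ε
  | child p _ _ _ εc, t => if t < p.time then p.tube t else εc t

end Vertex

section Planner

variable {n m N : ℕ} (S : Setup n m N) (est : Estimates) (mode : Mode) (Q : Query n)

/-- Right-hand side of the differential (in)equality for the tracking energy at time `t`, nominal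
state `x`, nominal control `u` and energy `en`. -/
def energyRHS (t : ℝ) (x : E n) (u : E m) (en : ℝ) : ℝ :=
  -2 * (S.rate - est.L * √(est.lamUp / est.lamLo)) * en
    + 2 * √(en * est.lamUp)
      * ((⨅ i, (est.L * ‖pair x u - S.data i‖ + S.e i)) + est.L * mode.ubar t √(en / est.lamLo))

/-- `xc` is the learned model integrated from the vertex `v` with constant control `uc` for the dwell
time `tc`. -/
structure IsNominalEdge (v : Vertex n m) (uc : E m) (tc : ℝ) (xc : ℝ → E n) : Prop where
  dwell_pos : 0 < tc
  admissible : uc ∈ S.U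
  start : xc v.time = v.state
  ode : ∀ t ∈ Icc v.time (v.time + tc),
    HasDerivWithinAt xc (S.g (pair (xc t) uc)) (Icc v.time (v.time + tc)) t

/-- `εc` is the tracking error bound `√(Ē / λ̲)` along the edge, where `Ē` solves the tracking energy
equation with the initial value given by the tube radius at `v`. -/
def IsTube (v : Vertex n m) (uc : E m) (tc : ℝ) (xc : ℝ → E n) (εc : ℝ → ℝ) : Prop :=
  ∃ en : ℝ → ℝ, en v.time = est.lamLo * v.err ^ 2 ∧
    ∀ t ∈ Icc v.time (v.time + tc),
      HasDerivWithinAt en (energyRHS S est mode t (xc t) uc (en t)) (Icc v.time (v.time + tc)) t ∧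
      εc t = √(en t / est.lamLo)

/-- A candidate extension of `v` that passes all checks: the tube and feedback bound fit in the
trusted domain, the tube is not too wide (learned controller only), and it is collision-free. -/
structure Accepted (v : Vertex n m) (uc : E m) (tc : ℝ) (xc : ℝ → E n) (εc : ℝ → ℝ) : Prop where
  edge : IsNominalEdge S v uc tc xc
  isTube : IsTube S est mode v uc tc xc εc
  check₁ : ∀ t ∈ Ico v.time (v.time + tc),
    pair (xc t) uc ∈ erode S.D (εc t + mode.ubar t (εc t))
  check₂ : ∀ t ∈ Ico v.time (v.time + tc), mode.Check (εc t)
  collisionFree : ∀ t ∈ Ico v.time (v.time + tc),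
    Disjoint (Metric.ball (xc t) (εc t)) Q.unsafeStates

/-- The edge `xc` visits the goal region. -/
def ReachesGoal (v : Vertex n m) (tc : ℝ) (xc : ℝ → E n) : Prop :=
  ∃ t ∈ Icc v.time (v.time + tc), xc t ∈ Metric.ball Q.xG Q.μ

/-- `T` is a search tree that the planner can have built after finitely many iterations, for some
outcomes of its sampling calls.  Rejected extensions leave the tree as it is. -/
inductive IsTree : Set (Vertex n m) → Prop
  | start : IsTree {Vertex.root Q.xI √(Q.E0 / est.lamLo)}
  | grow {T : Set (Vertex n m)} {v : Vertex n m} {uc : E m} {tc : ℝ} {xc : ℝ → E n} {εc : ℝ → ℝ} :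
      IsTree T → v ∈ T → Accepted S est mode Q v uc tc xc εc → ¬ ReachesGoal Q v tc xc →
      IsTree (insert (Vertex.child v uc tc xc εc) T)

/-- The planner returns the path that leads from the root to the vertex `w`: `w` is an accepted
extension of a vertex of the current tree and its edge reaches the goal region. -/
inductive Returns : Vertex n m → Prop
  | intro {T : Set (Vertex n m)} {v : Vertex n m} {uc : E m} {tc : ℝ} {xc : ℝ → E n} {εc : ℝ → ℝ} :
      IsTree S est mode Q T → v ∈ T → Accepted S est mode Q v uc tc xc εc →
      ReachesGoal Q v tc xc → Returns (Vertex.child v uc tc xc εc)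

/-- An execution on the true system on `[0, τ]` of the state `x` and control `u`: `x` is continuous and
`ẋ = h(x, u)`, with right derivatives since the nominal control jumps between edges, and the
initial energy with respect to the plan's start is below `𝓔₀`. -/
structure IsExecution (τ : ℝ) (x : ℝ → E n) (u : ℝ → E m) : Prop where
  cont : ContinuousOn x (Icc 0 τ)
  ode : ∀ t ∈ Ico 0 τ, HasDerivWithinAt x (S.h (pair (x t) (u t))) (Ici t) t
  initial : energy S.X S.M Q.xI (x 0) < ENNReal.ofReal Q.E0

/-- The estimates of `L_{h-g}` and `λ̄_D(M)` are over-approximations of their true values and the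
(positive) estimate of `λ̲_D(M)` is an under-approximation. -/
structure ValidEstimates : Prop where
  lip : lipConst S.modelError S.D ≤ (est.L : EReal)
  lamUp : supEig S.projD S.M ≤ (est.lamUp : EReal)
  lamLo : (est.lamLo : EReal) ≤ infEig S.projD S.M
  lamLo_pos : 0 < est.lamLo

/-- The estimate of `ū_fb(t)` over-approximates the feedback control applied in execution while the
tracking error is within the tube of the plan `w`. -/
def ValidFeedbackBound (w : Vertex n m) (τ : ℝ) (x : ℝ → E n) (u : ℝ → E m) : Prop :=
  ∀ t ∈ Icc 0 τ, ‖x t - w.xs t‖ ≤ w.tube t → ‖u t - w.us t‖ ≤ mode.ubar t (w.tube t)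

end Planner

end

end LMTCD

namespace LMTCD

/-! ### Bilinear forms of matrices -/

/-! Write d(t) for the Riemann distance from x*(t) to x(t) and y = √Ē for the root of the planner's
energy. Dividing the energy equation by 2√Ē gives the linear equation y' = -(λ - L√(Λ̄/Λ̲)) y + √Λ̄
(min_i{…} + L ū), and the tube radius is ε̄ = y/√Λ̲. The claim behind both cases is d < y at all
times. The argument looks circular: the growth bound for d needs (x, u) ∈ D, which in turn needs d <
y. It closes as a barrier argument. As long as d < y, the acceptance check puts the ball of radius
ε̄ around x* inside proj D, where M ≥ Λ̲. Curves shorter than y that start at x* cannot leave this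
ball, so ‖x̃‖ ≤ d/√Λ̲ < ε̄. Then the feedback bound applies, (x, u) lies in D, and the Lipschitz
estimate bounds ‖h - g‖ by L(d/√Λ̲ + ū) + min_i{…}. Hence d grows at rate at most -λ d + √Λ̄ ‖h -
g‖, which is the right-hand side of the equation for y with d in place of y, and d cannot catch up
with y.

No differentiability or a priori finiteness of d is used. Growth is expressed by forward steps:
`IsMetric.eventually_riemDist_step` compares the true motion with an Euler step of the learned model
through the triangle inequality, and `IsMetric.riemDist_lt_barrier` turns such steps into a
comparison principle by a continuous induction on the time interval. What remains is that the
learned closed loop contracts with rate λ to first order (`StepContracts`).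

In the weak case, freezing (x*, u*) makes the closed loop a C¹ vector field with Jacobian A + BK. An
Euler step shrinks tangent vectors uniformly on a compact ball, so it shrinks almost shortest curves
(`IsMetric.riemDist_euler_le`); no minimizing geodesic is needed.

In the strong case the controller supplies a minimizing geodesic γ, and the first variation formula
`IsMinGeodesic.eventually_riemDist_le` converts its inequality into decay of the distance. That the
controller's problem is feasible is `Setup.Regular.exists_contracts`. If the final momentum M γ_s(1)
is not annihilated by Bᵀ, the inequality can be met by scaling one control. Otherwise the
orthogonality condition makes Bᵀ M γ_s satisfy a linear differential inequality along γ, so it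
vanishes identically by Gronwall (`Setup.Regular.momentum_ker`); the condition on the null space of
Bᵀ then gives decay with zero control. The Gronwall constant comes from `exists_abs_form_le`, which
uses only that the null space has constant dimension, since B_⊥ need not be continuous.

Finally, tube invariance along one accepted edge (`Accepted.inTube`) is propagated from the root by
induction over the path (`IsPath.inPathTube`). -/

theorem tendsto_clm_apply {F G α : Type*} [NormedAddCommGroup F] [NormedSpace ℝ F]
    [NormedAddCommGroup G] [NormedSpace ℝ G] {l : Filter α} {A : α → F →L[ℝ] G} {v : α → F}
    {A₀ : F →L[ℝ] G} {v₀ : F} (hA : Filter.Tendsto A l (nhds A₀))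
    (hv : Filter.Tendsto v l (nhds v₀)) :
    Filter.Tendsto (fun r => A r (v r)) l (nhds (A₀ v₀)) :=
  ((isBoundedBilinearMap_apply (𝕜 := ℝ) (E := F) (F := G)).continuous.tendsto (A₀, v₀)).comp
    (hA.prodMk_nhds hv)

section Bilin

variable {n : ℕ}

theorem bilin_eq_sum (A : Matrix (Fin n) (Fin n) ℝ) (v w : E n) :
    bilin A v w = ∑ i, ∑ j, v i * A i j * w j := by
  simp only [bilin, dotProduct, Matrix.mulVec, Finset.mul_sum, mul_assoc]

theorem bilin_add_left (A : Matrix (Fin n) (Fin n) ℝ) (v v' w : E n) :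
    bilin A (v + v') w = bilin A v w + bilin A v' w := by
  simp [bilin, add_dotProduct]

theorem bilin_add_right (A : Matrix (Fin n) (Fin n) ℝ) (v w w' : E n) :
    bilin A v (w + w') = bilin A v w + bilin A v w' := by
  simp [bilin, Matrix.mulVec_add, dotProduct_add]

theorem bilin_smul_left (A : Matrix (Fin n) (Fin n) ℝ) (a : ℝ) (v w : E n) :
    bilin A (a • v) w = a * bilin A v w := by
  simp [bilin, smul_dotProduct]

theorem bilin_smul_right (A : Matrix (Fin n) (Fin n) ℝ) (a : ℝ) (v w : E n) :
    bilin A v (a • w) = a * bilin A v w := by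
  simp [bilin, Matrix.mulVec_smul, dotProduct_smul]

@[simp] theorem bilin_zero_left (A : Matrix (Fin n) (Fin n) ℝ) (w : E n) : bilin A 0 w = 0 := by
  simp [bilin]

@[simp] theorem bilin_zero_right (A : Matrix (Fin n) (Fin n) ℝ) (w : E n) : bilin A w 0 = 0 := by
  simp [bilin]

theorem bilin_add_matrix (A A' : Matrix (Fin n) (Fin n) ℝ) (v w : E n) :
    bilin (A + A') v w = bilin A v w + bilin A' v w := by
  simp [bilin, Matrix.add_mulVec, dotProduct_add]

theorem bilin_sub_matrix (A A' : Matrix (Fin n) (Fin n) ℝ) (v w : E n) :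
    bilin (A - A') v w = bilin A v w - bilin A' v w := by
  simp [bilin, Matrix.sub_mulVec, dotProduct_sub]

theorem bilin_neg_matrix (A : Matrix (Fin n) (Fin n) ℝ) (v w : E n) :
    bilin (-A) v w = -bilin A v w := by
  simp [bilin, Matrix.neg_mulVec]

theorem bilin_smul_matrix (a : ℝ) (A : Matrix (Fin n) (Fin n) ℝ) (v w : E n) :
    bilin (a • A) v w = a * bilin A v w := by
  simp [bilin, Matrix.smul_mulVec]

theorem bilin_one (v : E n) : bilin (1 : Matrix (Fin n) (Fin n) ℝ) v v = ‖v‖ ^ 2 := by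
  rw [EuclideanSpace.norm_sq_eq]
  simp [bilin, dotProduct, sq]

theorem bilin_mul (A C : Matrix (Fin n) (Fin n) ℝ) (v w : E n) :
    bilin (A * C) v w = bilin A v (WithLp.toLp 2 (C *ᵥ w.ofLp)) := by
  simp [bilin, Matrix.mulVec_mulVec]

theorem bilin_transpose (A : Matrix (Fin n) (Fin n) ℝ) (v w : E n) :
    bilin Aᵀ v w = bilin A w v := by
  rw [bilin, bilin, Matrix.dotProduct_mulVec, Matrix.vecMul_transpose, dotProduct_comm]

theorem bilin_comm {A : Matrix (Fin n) (Fin n) ℝ} (hA : Aᵀ = A) (v w : E n) :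
    bilin A v w = bilin A w v := by
  conv_lhs => rw [← hA, bilin_transpose]

theorem bilin_symmetrize (A : Matrix (Fin n) (Fin n) ℝ) (v : E n) :
    bilin (symmetrize A) v v = 2 * bilin A v v := by
  rw [symmetrize, bilin_add_matrix, bilin_transpose, two_mul]

/-- A crude entrywise bound; it serves only for continuity and for the existence of some constant,
so its size is irrelevant. -/
theorem abs_bilin_le (A : Matrix (Fin n) (Fin n) ℝ) (v w : E n) :
    |bilin A v w| ≤ (∑ i, ∑ j, |A i j|) * ‖v‖ * ‖w‖ := by
  rw [bilin_eq_sum, Finset.sum_mul, Finset.sum_mul]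
  refine (Finset.abs_sum_le_sum_abs _ _).trans (Finset.sum_le_sum fun i _ => ?_)
  rw [Finset.sum_mul, Finset.sum_mul]
  refine (Finset.abs_sum_le_sum_abs _ _).trans (Finset.sum_le_sum fun j _ => ?_)
  rw [abs_mul, abs_mul]
  have h1 : |v i| ≤ ‖v‖ := PiLp.norm_apply_le v i
  have h2 : |w j| ≤ ‖w‖ := PiLp.norm_apply_le w j
  calc |v i| * |A i j| * |w j| ≤ ‖v‖ * |A i j| * ‖w‖ := by gcongr
    _ = _ := by ring

theorem bilin_nonneg_of_posDef {A : Matrix (Fin n) (Fin n) ℝ} (hA : A.PosDef) (v : E n) :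
    0 ≤ bilin A v v := by
  simpa [bilin] using hA.posSemidef.dotProduct_mulVec_nonneg v.ofLp

theorem bilin_pos_of_posDef {A : Matrix (Fin n) (Fin n) ℝ} (hA : A.PosDef) {v : E n}
    (hv : v ≠ 0) : 0 < bilin A v v := by
  have : v.ofLp ≠ 0 := fun h => hv (by ext i; simp [h])
  simpa [bilin] using hA.dotProduct_mulVec_pos this

theorem posDef_transpose {A : Matrix (Fin n) (Fin n) ℝ} (hA : A.PosDef) : Aᵀ = A := by
  simpa using hA.isHermitian.eq

/-- The spectrum of a·1 - A is a minus the spectrum of A, so a·1 - A is positive semidefinite. -/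
theorem dotProduct_mulVec_le_of_spectrum {ι : Type*} [Fintype ι] [DecidableEq ι]
    {A : Matrix ι ι ℝ} (hA : Aᵀ = A) {a : ℝ} (h : ∀ b ∈ spectrum ℝ A, b ≤ a) (v : ι → ℝ) :
    v ⬝ᵥ (A *ᵥ v) ≤ a * (v ⬝ᵥ v) := by
  have hpos : (algebraMap ℝ (Matrix ι ι ℝ) a - A).PosSemidef := by
    rw [Matrix.posSemidef_iff_isHermitian_and_spectrum_nonneg]
    refine ⟨?_, ?_⟩
    · refine Matrix.IsHermitian.sub ?_ (by simpa [Matrix.IsHermitian] using hA)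
      rw [Matrix.algebraMap_eq_diagonal]; exact Matrix.isHermitian_diagonal _
    · intro b hb
      rw [← spectrum.singleton_sub_eq] at hb
      obtain ⟨c, hc, d, hd, rfl⟩ := hb
      rw [mem_singleton_iff] at hc
      subst hc
      simpa using h d hd
  have := hpos.dotProduct_mulVec_nonneg v
  rw [Matrix.sub_mulVec, dotProduct_sub, Algebra.algebraMap_eq_smul_one, Matrix.smul_mulVec] at this
  simp at this
  linarith

theorem le_dotProduct_mulVec_of_spectrum {ι : Type*} [Fintype ι] [DecidableEq ι]
    {A : Matrix ι ι ℝ} (hA : Aᵀ = A) {a : ℝ} (h : ∀ b ∈ spectrum ℝ A, a ≤ b) (v : ι → ℝ) :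
    a * (v ⬝ᵥ v) ≤ v ⬝ᵥ (A *ᵥ v) := by
  have := dotProduct_mulVec_le_of_spectrum (A := -A) (by simp [hA]) (a := -a)
    (fun b hb => by
      rw [← spectrum.neg_eq] at hb
      have := h _ hb
      linarith) v
  simp [Matrix.neg_mulVec] at this
  linarith

theorem dotProduct_mulVec_le_of_supEig {α ι : Type*} [Fintype ι] [DecidableEq ι] {Z : Set α}
    {A : α → Matrix ι ι ℝ} {a : ℝ} (h : supEig Z A ≤ (a : EReal)) {z : α} (hz : z ∈ Z)
    (hA : (A z)ᵀ = A z) (v : ι → ℝ) : v ⬝ᵥ (A z *ᵥ v) ≤ a * (v ⬝ᵥ v) := by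
  refine dotProduct_mulVec_le_of_spectrum hA (fun b hb => ?_) v
  rw [← EReal.coe_le_coe_iff]
  exact (le_iSup₂_of_le (f := fun z _ => ⨆ a ∈ spectrum ℝ (A z), (a : EReal)) z hz
    (le_iSup₂ (f := fun (b : ℝ) _ => (b : EReal)) b hb)).trans h

theorem bilin_le_of_supEig {α : Type*} {Z : Set α} {A : α → Matrix (Fin n) (Fin n) ℝ} {a : ℝ}
    (h : supEig Z A ≤ (a : EReal)) {z : α} (hz : z ∈ Z) (hA : (A z)ᵀ = A z) (v : E n) :
    bilin (A z) v v ≤ a * ‖v‖ ^ 2 := by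
  have := dotProduct_mulVec_le_of_supEig h hz hA v.ofLp
  rwa [← bilin_one v, bilin, bilin, Matrix.one_mulVec]

theorem le_bilin_of_infEig {α : Type*} {Z : Set α} {A : α → Matrix (Fin n) (Fin n) ℝ} {a : ℝ}
    (h : (a : EReal) ≤ infEig Z A) {z : α} (hz : z ∈ Z) (hA : (A z)ᵀ = A z) (v : E n) :
    a * ‖v‖ ^ 2 ≤ bilin (A z) v v := by
  have := le_dotProduct_mulVec_of_spectrum hA (a := a) (fun b hb => by
    rw [← EReal.coe_le_coe_iff]
    exact h.trans (iInf₂_le_of_le (f := fun z _ => ⨅ a ∈ spectrum ℝ (A z), (a : EReal)) z hz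
      (iInf₂_le (f := fun (b : ℝ) _ => (b : EReal)) b hb))) v.ofLp
  rwa [← bilin_one v, bilin, bilin, Matrix.one_mulVec]

theorem hasDerivWithinAt_bilin {A : ℝ → Matrix (Fin n) (Fin n) ℝ} {v w : ℝ → E n}
    {A' : Matrix (Fin n) (Fin n) ℝ} {v' w' : E n} {s : Set ℝ} {t : ℝ}
    (hA : ∀ i j, HasDerivWithinAt (fun r => A r i j) (A' i j) s t)
    (hv : HasDerivWithinAt v v' s t) (hw : HasDerivWithinAt w w' s t) :
    HasDerivWithinAt (fun r => bilin (A r) (v r) (w r))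
      (bilin A' (v t) (w t) + bilin (A t) v' (w t) + bilin (A t) (v t) w') s t := by
  have hv' : ∀ i, HasDerivWithinAt (fun r => v r i) (v' i) s t := fun i =>
    (EuclideanSpace.proj (𝕜 := ℝ) i).hasFDerivAt.comp_hasDerivWithinAt t hv
  have hw' : ∀ i, HasDerivWithinAt (fun r => w r i) (w' i) s t := fun i =>
    (EuclideanSpace.proj (𝕜 := ℝ) i).hasFDerivAt.comp_hasDerivWithinAt t hw
  simp only [bilin_eq_sum]
  refine (HasDerivWithinAt.fun_sum fun i _ => HasDerivWithinAt.fun_sum fun j _ =>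
    ((hv' i).mul (hA i j)).mul (hw' j)).congr_deriv ?_
  simp only [← Finset.sum_add_distrib]
  refine Finset.sum_congr rfl fun i _ => Finset.sum_congr rfl fun j _ => ?_
  simp only [Pi.mul_apply]
  ring

theorem tendsto_bilin {α : Type*} {l : Filter α} {A : α → Matrix (Fin n) (Fin n) ℝ}
    {v w : α → E n} {A₀ : Matrix (Fin n) (Fin n) ℝ} {v₀ w₀ : E n}
    (hA : ∀ i j, Filter.Tendsto (fun r => A r i j) l (nhds (A₀ i j)))
    (hv : Filter.Tendsto v l (nhds v₀)) (hw : Filter.Tendsto w l (nhds w₀)) :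
    Filter.Tendsto (fun r => bilin (A r) (v r) (w r)) l (nhds (bilin A₀ v₀ w₀)) := by
  have hv' : ∀ i, Filter.Tendsto (fun r => v r i) l (nhds (v₀ i)) := fun i =>
    ((EuclideanSpace.proj (𝕜 := ℝ) i).continuous.tendsto _).comp hv
  have hw' : ∀ i, Filter.Tendsto (fun r => w r i) l (nhds (w₀ i)) := fun i =>
    ((EuclideanSpace.proj (𝕜 := ℝ) i).continuous.tendsto _).comp hw
  simp only [bilin_eq_sum]
  exact tendsto_finsetSum _ fun i _ => tendsto_finsetSum _ fun j _ =>
    ((hv' i).mul (hA i j)).mul (hw' j)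

theorem continuousOn_bilin {α : Type*} [TopologicalSpace α] {s : Set α}
    {A : α → Matrix (Fin n) (Fin n) ℝ} {v w : α → E n}
    (hA : ∀ i j, ContinuousOn (fun r => A r i j) s) (hv : ContinuousOn v s)
    (hw : ContinuousOn w s) : ContinuousOn (fun r => bilin (A r) (v r) (w r)) s :=
  fun x hx => tendsto_bilin (fun i j => hA i j x hx) (hv x hx) (hw x hx)

theorem euclidean_sum_single (v : E n) : ∑ l, v l • EuclideanSpace.single l (1 : ℝ) = v := by
  ext i
  simp [Pi.single_apply]

theorem lieDeriv_apply {ι κ : Type*} (Q : E n → Matrix ι κ ℝ) (y x : E n) (i : ι) (j : κ) :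
    lieDeriv Q y x i j = fderiv ℝ (fun z => Q z i j) x y := by
  conv_rhs => rw [← euclidean_sum_single y]
  simp [lieDeriv]

theorem jac_mulVec {m : ℕ} (F : E n → E m) (x v : E n) :
    WithLp.toLp 2 (jac F x *ᵥ v.ofLp) = fderiv ℝ F x v := by
  conv_rhs => rw [← euclidean_sum_single v]
  ext i
  simp [jac, Matrix.mulVec, dotProduct, mul_comm]

/-- Symmetry is needed near x, not just at x, since derivatives of entries are compared. It makes
the matrices in the contraction conditions symmetric, so that eigenvalue bounds become bounds of
quadratic forms. -/
theorem lieDeriv_transpose {Q : E n → Matrix (Fin n) (Fin n) ℝ} {x : E n}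
    (hQ : ∀ᶠ z in nhds x, (Q z)ᵀ = Q z) (y : E n) : (lieDeriv Q y x)ᵀ = lieDeriv Q y x := by
  ext i j
  rw [Matrix.transpose_apply, lieDeriv_apply, lieDeriv_apply]
  congr 1
  refine Filter.EventuallyEq.fderiv_eq ?_
  filter_upwards [hQ] with z hz
  exact congrFun (congrFun hz i) j

theorem symmetrize_transpose (Q : Matrix (Fin n) (Fin n) ℝ) :
    (symmetrize Q)ᵀ = symmetrize Q := by
  simp [symmetrize, add_comm]

end Bilin

/-! ### Lengths of curves and the Riemann distance -/

/-- `M` is a continuously differentiable Riemannian metric on the open set `X`. -/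
structure IsMetric {n : ℕ} (X : Set (E n)) (M : E n → Matrix (Fin n) (Fin n) ℝ) : Prop where
  isOpen : IsOpen X
  contDiffOn : ∀ i j, ContDiffOn ℝ 1 (fun x => M x i j) X
  posDef : ∀ x ∈ X, (M x).PosDef

section Riemann

variable {n : ℕ} {X : Set (E n)} {M : E n → Matrix (Fin n) (Fin n) ℝ}

theorem hasDerivWithinAt_velocity {c : ℝ → E n} (hc : ContDiffOn ℝ 1 c (Icc 0 1)) {s : ℝ}
    (hs : s ∈ Icc (0 : ℝ) 1) : HasDerivWithinAt c (velocity c s) (Icc 0 1) s :=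
  ((hc.differentiableOn one_ne_zero) s hs).hasDerivWithinAt

theorem continuousOn_velocity {c : ℝ → E n} (hc : ContDiffOn ℝ 1 c (Icc 0 1)) :
    ContinuousOn (velocity c) (Icc 0 1) :=
  hc.continuousOn_derivWithin (uniqueDiffOn_Icc zero_lt_one) le_rfl

theorem velocity_eq {c : ℝ → E n} {s : ℝ} (hs : s ∈ Icc (0 : ℝ) 1) {v : E n}
    (h : HasDerivWithinAt c v (Icc 0 1) s) : velocity c s = v :=
  h.derivWithin (uniqueDiffOn_Icc zero_lt_one s hs)

theorem IsMetric.continuousOn (hM : IsMetric X M) (i j : Fin n) :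
    ContinuousOn (fun x => M x i j) X := (hM.contDiffOn i j).continuousOn

theorem IsMetric.comp_continuousOn (hM : IsMetric X M) {c : ℝ → E n} {t : Set ℝ}
    (hc : ContinuousOn c t) (hX : ∀ s ∈ t, c s ∈ X) (i j : Fin n) :
    ContinuousOn (fun s => M (c s) i j) t := (hM.continuousOn i j).comp hc hX

theorem IsMetric.continuousOn_speed (hM : IsMetric X M) {c : ℝ → E n}
    (hc : ContDiffOn ℝ 1 c (Icc 0 1)) (hX : ∀ s ∈ Icc (0 : ℝ) 1, c s ∈ X) :
    ContinuousOn (speed M c) (Icc 0 1) :=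
  (continuousOn_bilin (hM.comp_continuousOn hc.continuousOn hX) (continuousOn_velocity hc)
    (continuousOn_velocity hc)).sqrt

theorem IsMetric.intervalIntegrable_speed (hM : IsMetric X M) {c : ℝ → E n}
    (hc : ContDiffOn ℝ 1 c (Icc 0 1)) (hX : ∀ s ∈ Icc (0 : ℝ) 1, c s ∈ X) :
    IntervalIntegrable (speed M c) MeasureTheory.volume 0 1 :=
  ContinuousOn.intervalIntegrable (by
    rw [uIcc_of_le zero_le_one]; exact hM.continuousOn_speed hc hX)

theorem speed_nonneg (c : ℝ → E n) (s : ℝ) : 0 ≤ speed M c s := Real.sqrt_nonneg _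

theorem length_nonneg (c : ℝ → E n) : 0 ≤ length M c :=
  intervalIntegral.integral_nonneg zero_le_one fun s _ => speed_nonneg c s

theorem riemDist_le_length {p q : E n} {c : ℝ → E n} (hc : IsCurve X p q c) :
    riemDist X M p q ≤ ENNReal.ofReal (length M c) := iInf₂_le c hc

theorem speed_sq (hM : IsMetric X M) {c : ℝ → E n} {s : ℝ} (hX : c s ∈ X) :
    speed M c s ^ 2 = bilin (M (c s)) (velocity c s) (velocity c s) :=
  Real.sq_sqrt (bilin_nonneg_of_posDef (hM.posDef _ hX) _)

theorem exists_curve_of_riemDist_lt {p q : E n} {r : ℝ}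
    (h : riemDist X M p q < ENNReal.ofReal r) : ∃ c, IsCurve X p q c ∧ length M c < r := by
  simp only [riemDist, iInf_lt_iff] at h
  obtain ⟨c, hc, h⟩ := h
  exact ⟨c, hc, (ENNReal.ofReal_lt_ofReal_iff_of_nonneg (length_nonneg c)).1 h⟩

/-- A `C¹` map that stretches tangent vectors by at most `k` stretches lengths by at most `k`. -/
theorem IsMetric.riemDist_map_le (hM : IsMetric X M) {p q : E n} {c : ℝ → E n}
    (hc : IsCurve X p q c) {Ψ : E n → E n} {O : Set (E n)} (hO : IsOpen O)
    (hΨ : ContDiffOn ℝ 1 Ψ O) (hcO : ∀ s ∈ Icc (0 : ℝ) 1, c s ∈ O)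
    (hX : ∀ s ∈ Icc (0 : ℝ) 1, Ψ (c s) ∈ X) {k : ℝ} (hk : 0 ≤ k)
    (h : ∀ s ∈ Icc (0 : ℝ) 1, ∀ v, bilin (M (Ψ (c s))) (fderiv ℝ Ψ (c s) v) (fderiv ℝ Ψ (c s) v)
      ≤ k ^ 2 * bilin (M (c s)) v v) :
    riemDist X M (Ψ p) (Ψ q) ≤ ENNReal.ofReal (k * length M c) := by
  have hcurve : IsCurve X (Ψ p) (Ψ q) (Ψ ∘ c) :=
    ⟨hΨ.comp hc.contDiff hcO, hX, by simp [hc.source], by simp [hc.target]⟩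
  refine (riemDist_le_length hcurve).trans (ENNReal.ofReal_le_ofReal ?_)
  rw [length, length, ← intervalIntegral.integral_const_mul]
  refine intervalIntegral.integral_mono_on zero_le_one
    (hM.intervalIntegrable_speed hcurve.contDiff hX)
    ((hM.intervalIntegrable_speed hc.contDiff hc.mem).const_mul k) fun s hs => ?_
  have hvel : velocity (Ψ ∘ c) s = fderiv ℝ Ψ (c s) (velocity c s) :=
    velocity_eq hs (((hΨ.contDiffAt (hO.mem_nhds (hcO s hs))).differentiableAt
      one_ne_zero).hasFDerivAt.comp_hasDerivWithinAt s (hasDerivWithinAt_velocity hc.contDiff hs))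
  rw [speed, hvel, speed, ← Real.sqrt_sq hk, ← Real.sqrt_mul (sq_nonneg k)]
  exact Real.sqrt_le_sqrt (h s hs _)

/-- Substitution s ↦ φ(s). Velocities of `C` are taken as data because `C` is a piece of a
concatenation: it agrees with c ∘ φ only on [a, b], while `velocity` differentiates within [0, 1].
-/
theorem integral_speed_reparam (hM : IsMetric X M) {c : ℝ → E n}
    (hc : ContDiffOn ℝ 1 c (Icc 0 1)) (hX : ∀ s ∈ Icc (0 : ℝ) 1, c s ∈ X) {φ φ' : ℝ → ℝ} {a b : ℝ}
    (hab : a ≤ b) (hφ : ∀ s, HasDerivAt φ (φ' s) s) (hφ' : Continuous φ')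
    (hmem : ∀ s, φ s ∈ Icc (0 : ℝ) 1) (hφ'0 : ∀ s, 0 ≤ φ' s) (ha : φ a = 0) (hb : φ b = 1)
    {C : ℝ → E n} (hC : ∀ s ∈ Icc a b, C s = c (φ s))
    (hV : ∀ s ∈ Icc a b, velocity C s = φ' s • velocity c (φ s)) :
    ∫ s in a..b, speed M C s = length M c := by
  have h1 : ∫ s in a..b, speed M C s = ∫ s in a..b, (speed M c ∘ φ) s * φ' s := by
    refine intervalIntegral.integral_congr fun s hs => ?_
    rw [uIcc_of_le hab] at hs
    simp only [speed, Function.comp_apply]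
    rw [hC s hs, hV s hs, bilin_smul_left, bilin_smul_right, ← mul_assoc,
      Real.sqrt_mul (mul_self_nonneg _), Real.sqrt_mul_self (hφ'0 s), mul_comm]
  rw [h1, intervalIntegral.integral_comp_mul_deriv''' (f := φ) (f' := φ') (g := speed M c),
    ha, hb, length]
  · exact (continuous_iff_continuousAt.2 fun s => (hφ s).continuousAt).continuousOn
  · exact fun s _ => (hφ s).hasDerivWithinAt
  · refine (hM.continuousOn_speed hc hX).mono ?_
    rintro _ ⟨s, _, rfl⟩; exact hmem s
  · refine ((hM.continuousOn_speed hc hX).integrableOn_Icc).mono_set ?_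
    rintro _ ⟨s, _, rfl⟩; exact hmem s
  · rw [uIcc_of_le hab]
    refine (ContinuousOn.mul ?_ hφ'.continuousOn).integrableOn_Icc
    exact (hM.continuousOn_speed hc hX).comp
      (continuous_iff_continuousAt.2 fun s => (hφ s).continuousAt).continuousOn fun s _ => hmem s

end Riemann

/-! ### Concatenation, triangle inequality, and comparison of the Riemann distance with the 2-norm
-/

section Riemann

variable {n : ℕ} {X : Set (E n)} {M : E n → Matrix (Fin n) (Fin n) ℝ}

theorem smoothTransition_mem (s : ℝ) : Real.smoothTransition s ∈ Icc (0 : ℝ) 1 :=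
  ⟨Real.smoothTransition.nonneg s, Real.smoothTransition.le_one s⟩

theorem differentiable_smoothTransition : Differentiable ℝ Real.smoothTransition :=
  (Real.smoothTransition.contDiff (n := 1)).differentiable one_ne_zero

theorem deriv_smoothTransition_of_nonpos {s : ℝ} (hs : s ≤ 0) :
    deriv Real.smoothTransition s = 0 := by
  refine IsLocalMin.deriv_eq_zero (Filter.Eventually.of_forall fun t => ?_)
  rw [Real.smoothTransition.zero_of_nonpos hs]
  exact Real.smoothTransition.nonneg t

theorem deriv_smoothTransition_of_one_le {s : ℝ} (hs : 1 ≤ s) :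
    deriv Real.smoothTransition s = 0 := by
  refine IsLocalMax.deriv_eq_zero (Filter.Eventually.of_forall fun t => ?_)
  rw [Real.smoothTransition.one_of_one_le hs]
  exact Real.smoothTransition.le_one t

theorem contDiffOn_comp_reparam {c : ℝ → E n} (hc : ContDiffOn ℝ 1 c (Icc 0 1)) (a : ℝ) :
    ContDiff ℝ 1 fun s => c (Real.smoothTransition (2 * s - a)) := by
  rw [← contDiffOn_univ]
  refine hc.comp (t := Icc 0 1) (g := c) (f := fun s => Real.smoothTransition (2 * s - a))
    (s := univ) ?_ fun s _ => smoothTransition_mem _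
  exact ((Real.smoothTransition.contDiff (n := 1)).comp (by fun_prop)).contDiffOn

theorem hasDerivAt_reparam (a s : ℝ) :
    HasDerivAt (fun s => Real.smoothTransition (2 * s - a))
      (2 * deriv Real.smoothTransition (2 * s - a)) s := by
  have h1 : HasDerivAt (fun s : ℝ => 2 * s - a) 2 s := by
    simpa using ((hasDerivAt_id s).const_mul 2).sub_const a
  have := (differentiable_smoothTransition (2 * s - a)).hasDerivAt.comp s h1
  rw [mul_comm]
  exact this

theorem hasDerivAt_comp_reparam {c : ℝ → E n} (hc : ContDiffOn ℝ 1 c (Icc 0 1)) (a s : ℝ) :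
    HasDerivAt (fun s => c (Real.smoothTransition (2 * s - a)))
      ((2 * deriv Real.smoothTransition (2 * s - a)) •
        velocity c (Real.smoothTransition (2 * s - a))) s := by
  rw [← hasDerivWithinAt_univ]
  exact HasDerivWithinAt.scomp (h := fun s => Real.smoothTransition (2 * s - a)) s
    (hasDerivWithinAt_velocity hc (smoothTransition_mem _)) (hasDerivAt_reparam a s).hasDerivWithinAt
    fun s _ => smoothTransition_mem _

/-- Admissible curves are C¹, not piecewise C¹, so the corner at q has to be removed: both pieces
are traversed with a smooth step function and come to rest at q. -/
theorem IsMetric.exists_concat (hM : IsMetric X M) {p q r : E n} {c₁ c₂ : ℝ → E n}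
    (h₁ : IsCurve X p q c₁) (h₂ : IsCurve X q r c₂) :
    ∃ c, IsCurve X p r c ∧ length M c = length M c₁ + length M c₂ := by
  -- On each half of [0, 1] one of the two summands is constantly q, so this sum is the other piece
  -- there; globally it is visibly C¹.
  set c : ℝ → E n := fun s => c₁ (Real.smoothTransition (2 * s - 0)) +
    c₂ (Real.smoothTransition (2 * s - 1)) - q with hc
  have hcd : ContDiff ℝ 1 c := ((contDiffOn_comp_reparam h₁.contDiff 0).add
    (contDiffOn_comp_reparam h₂.contDiff 1)).sub contDiff_const
  have hleft : ∀ s ≤ (1 / 2 : ℝ), c s = c₁ (Real.smoothTransition (2 * s - 0)) := by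
    intro s hs
    simp only [hc]
    rw [Real.smoothTransition.zero_of_nonpos (x := 2 * s - 1) (by linarith), h₂.source]
    abel
  have hright : ∀ s, (1 / 2 : ℝ) ≤ s → c s = c₂ (Real.smoothTransition (2 * s - 1)) := by
    intro s hs
    simp only [hc]
    rw [Real.smoothTransition.one_of_one_le (x := 2 * s - 0) (by linarith), h₁.target]
    abel
  have hder := fun s => ((hasDerivAt_comp_reparam h₁.contDiff 0 s).add
    (hasDerivAt_comp_reparam h₂.contDiff 1 s)).sub_const q
  have hX : ∀ s ∈ Icc (0 : ℝ) 1, c s ∈ X := by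
    intro s _
    rcases le_total s (1 / 2) with hs | hs
    · rw [hleft s hs]; exact h₁.mem _ (smoothTransition_mem _)
    · rw [hright s hs]; exact h₂.mem _ (smoothTransition_mem _)
  refine ⟨c, ⟨hcd.contDiffOn, hX, ?_, ?_⟩, ?_⟩
  · rw [hleft 0 (by norm_num), Real.smoothTransition.zero_of_nonpos (by norm_num), h₁.source]
  · rw [hright 1 (by norm_num), Real.smoothTransition.one_of_one_le (by norm_num), h₂.target]
  · have hint := hM.intervalIntegrable_speed hcd.contDiffOn hX
    have hmid : (1 / 2 : ℝ) ∈ uIcc (0 : ℝ) 1 := by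
      rw [uIcc_of_le zero_le_one]; constructor <;> norm_num
    rw [length, ← intervalIntegral.integral_add_adjacent_intervals
      (hint.mono_set (uIcc_subset_uIcc_left hmid)) (hint.mono_set (uIcc_subset_uIcc_right hmid))]
    have hcont : ∀ a : ℝ, Continuous fun s => 2 * deriv Real.smoothTransition (2 * s - a) :=
      fun a => continuous_const.mul
        (((Real.smoothTransition.contDiff (n := 1)).continuous_deriv le_rfl).comp (by fun_prop))
    have hnn : ∀ a s : ℝ, 0 ≤ 2 * deriv Real.smoothTransition (2 * s - a) := fun a s =>
      mul_nonneg zero_le_two (Real.smoothTransition.monotone.deriv_nonneg)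
    congr 1
    · refine integral_speed_reparam hM h₁.contDiff h₁.mem (by norm_num) (hasDerivAt_reparam 0)
        (hcont 0) (fun s => smoothTransition_mem _) (hnn 0)
        (Real.smoothTransition.zero_of_nonpos (by norm_num))
        (Real.smoothTransition.one_of_one_le (by norm_num)) (fun s hs => hleft s hs.2)
        fun s hs => ?_
      refine velocity_eq ⟨hs.1, hs.2.trans (by norm_num)⟩
        ((hder s).hasDerivWithinAt.congr_deriv ?_)
      rw [deriv_smoothTransition_of_nonpos (s := 2 * s - 1) (by linarith [hs.2])]
      simp
    · refine integral_speed_reparam hM h₂.contDiff h₂.mem (by norm_num) (hasDerivAt_reparam 1)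
        (hcont 1) (fun s => smoothTransition_mem _) (hnn 1)
        (Real.smoothTransition.zero_of_nonpos (by norm_num))
        (Real.smoothTransition.one_of_one_le (by norm_num)) (fun s hs => hright s hs.1)
        fun s hs => ?_
      refine velocity_eq ⟨le_trans (by norm_num) hs.1, hs.2⟩
        ((hder s).hasDerivWithinAt.congr_deriv ?_)
      rw [deriv_smoothTransition_of_one_le (s := 2 * s - 0) (by linarith [hs.1])]
      simp

theorem IsMetric.riemDist_triangle (hM : IsMetric X M) (p q r : E n) :
    riemDist X M p r ≤ riemDist X M p q + riemDist X M q r := by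
  have h : ∀ c₁, IsCurve X p q c₁ → ∀ c₂, IsCurve X q r c₂ →
      riemDist X M p r ≤ ENNReal.ofReal (length M c₁) + ENNReal.ofReal (length M c₂) := by
    intro c₁ h₁ c₂ h₂
    obtain ⟨c, hc, hl⟩ := hM.exists_concat h₁ h₂
    rw [← ENNReal.ofReal_add (length_nonneg _) (length_nonneg _), ← hl]
    exact riemDist_le_length hc
  conv_rhs => rw [riemDist, riemDist]
  simp only [ENNReal.iInf_add, ENNReal.add_iInf]
  exact le_iInf₂ fun c₂ h₂ => le_iInf₂ fun c₁ h₁ => h c₁ h₁ c₂ h₂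

theorem riemDist_self {p : E n} (hp : p ∈ X) : riemDist X M p p = 0 := by
  have hc : IsCurve X p p fun _ => p := ⟨contDiffOn_const, fun _ _ => hp, rfl, rfl⟩
  refine le_antisymm ((riemDist_le_length hc).trans ?_) zero_le
  have : ∀ s, velocity (fun _ : ℝ => p) s = 0 := fun s => by simp [velocity]
  simp [length, speed, this]

/-- While a curve stays in a region with `lo ≤ M`, it gets no further than `length / √lo`. -/
theorem IsMetric.norm_sub_le_length (hM : IsMetric X M) {p q : E n} {c : ℝ → E n}
    (hc : IsCurve X p q c) {Z : Set (E n)} {lo : ℝ}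
    (hlo : ∀ y ∈ Z, ∀ v, lo * ‖v‖ ^ 2 ≤ bilin (M y) v v) {s₁ : ℝ} (hs₁ : s₁ ∈ Icc (0 : ℝ) 1)
    (hZ : ∀ s ∈ Ioo 0 s₁, c s ∈ Z) : √lo * ‖c s₁ - p‖ ≤ length M c := by
  have hint := hM.intervalIntegrable_speed hc.contDiff hc.mem
  have hmem : s₁ ∈ uIcc (0 : ℝ) 1 := by rwa [uIcc_of_le zero_le_one]
  have hsub : Icc 0 s₁ ⊆ Icc (0 : ℝ) 1 := Icc_subset_Icc_right hs₁.2
  have hvint : IntervalIntegrable (velocity c) MeasureTheory.volume 0 s₁ := by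
    refine ContinuousOn.intervalIntegrable ?_
    rw [uIcc_of_le hs₁.1]
    exact (continuousOn_velocity hc.contDiff).mono hsub
  have hftc : ∫ s in (0 : ℝ)..s₁, velocity c s = c s₁ - c 0 := by
    refine intervalIntegral.integral_eq_sub_of_hasDerivAt_of_le hs₁.1
      (hc.contDiff.continuousOn.mono hsub) (fun s hs => ?_) hvint
    exact (hasDerivWithinAt_velocity hc.contDiff (hsub (Ioo_subset_Icc_self hs))).hasDerivAt
      (Icc_mem_nhds hs.1 (hs.2.trans_le hs₁.2))
  calc √lo * ‖c s₁ - p‖ ≤ √lo * ∫ s in (0 : ℝ)..s₁, ‖velocity c s‖ := by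
        rw [← hc.source, ← hftc]
        gcongr
        exact intervalIntegral.norm_integral_le_integral_norm hs₁.1
    _ = ∫ s in (0 : ℝ)..s₁, √lo * ‖velocity c s‖ := by
        rw [intervalIntegral.integral_const_mul]
    _ ≤ ∫ s in (0 : ℝ)..s₁, speed M c s := by
        refine intervalIntegral.integral_mono_on_of_le_Ioo hs₁.1 (hvint.norm.const_mul _)
          (hint.mono_set (uIcc_subset_uIcc_left hmem)) fun s hs => ?_
        rw [speed, ← Real.sqrt_sq (norm_nonneg (velocity c s)), ← Real.sqrt_mul' _ (sq_nonneg _)]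
        exact Real.sqrt_le_sqrt (hlo _ (hZ s hs) _)
    _ ≤ length M c := by
        rw [length, ← intervalIntegral.integral_add_adjacent_intervals
          (hint.mono_set (uIcc_subset_uIcc_left hmem))
          (hint.mono_set (uIcc_subset_uIcc_right hmem))]
        exact le_add_of_nonneg_right
          (intervalIntegral.integral_nonneg hs₁.2 fun s _ => speed_nonneg c s)

/-- A curve from `p` that is too short to leave a ball around `p` stays in it. -/
theorem IsMetric.curve_mem_ball (hM : IsMetric X M) {p q : E n} {c : ℝ → E n}
    (hc : IsCurve X p q c) {lo ε : ℝ}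
    (hlo : ∀ y ∈ Metric.ball p ε, ∀ v, lo * ‖v‖ ^ 2 ≤ bilin (M y) v v)
    (hlen : length M c < √lo * ε) {s : ℝ} (hs : s ∈ Icc (0 : ℝ) 1) : c s ∈ Metric.ball p ε := by
  by_contra hcon
  set A : Set ℝ := {s ∈ Icc (0 : ℝ) 1 | c s ∈ (Metric.ball p ε)ᶜ}
  have hA : IsCompact A := isCompact_Icc.of_isClosed_subset
    (hc.contDiff.continuousOn.preimage_isClosed_of_isClosed isClosed_Icc
      Metric.isOpen_ball.isClosed_compl) fun s hs => hs.1
  -- First exit time: before it the lower bound on M is available, and at it the displacement is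
  -- already at least ε.
  obtain ⟨s₁, hs₁, hmin⟩ := hA.exists_isLeast ⟨s, hs, hcon⟩
  have h1 := hM.norm_sub_le_length hc hlo hs₁.1 fun r hr => by
    by_contra hr'
    exact absurd (hmin ⟨⟨hr.1.le, hr.2.le.trans hs₁.1.2⟩, hr'⟩) (not_le.2 hr.2)
  have h2 : ε ≤ ‖c s₁ - p‖ := by
    have := hs₁.2
    rwa [mem_compl_iff, mem_ball_iff_norm, not_lt] at this
  have := mul_le_mul_of_nonneg_left h2 (Real.sqrt_nonneg lo)
  linarith

/-- Curves of length below √lo ε stay in the ball, so a lower bound on M there suffices although the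
infimum runs over all curves in `X`. The infimum need not be attained, whence the approximation by
lengths d'' > d. -/
theorem IsMetric.norm_sub_le_of_riemDist (hM : IsMetric X M) {p q : E n} {lo ε : ℝ}
    (hlo : ∀ y ∈ Metric.ball p ε, ∀ v, lo * ‖v‖ ^ 2 ≤ bilin (M y) v v) {d : ℝ} (hd : 0 ≤ d)
    (hdε : d < √lo * ε) (h : riemDist X M p q ≤ ENNReal.ofReal d) : √lo * ‖q - p‖ ≤ d := by
  refine le_of_forall_gt_imp_ge_of_dense fun d' hd' => ?_
  obtain ⟨d'', h1, h2⟩ := exists_between (lt_min hd' hdε)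
  have hd'' := lt_min_iff.1 h2
  obtain ⟨c, hc, hl⟩ := exists_curve_of_riemDist_lt (h.trans_lt
    ((ENNReal.ofReal_lt_ofReal_iff (hd.trans_lt h1)).2 h1))
  have := hM.norm_sub_le_length hc hlo (right_mem_Icc.2 zero_le_one) fun s hs =>
    hM.curve_mem_ball hc hlo (hl.trans hd''.2) (Ioo_subset_Icc_self hs)
  rw [hc.target] at this
  linarith [hd''.1]

theorem IsMetric.eventually_bilin_le (hM : IsMetric X M) {p : E n} (hp : p ∈ X) {K : ℝ}
    (hK : ∀ v, bilin (M p) v v ≤ K * ‖v‖ ^ 2) {K' : ℝ} (hKK' : K < K') :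
    ∀ᶠ y in nhds p, ∀ v, bilin (M y) v v ≤ K' * ‖v‖ ^ 2 := by
  have hcont : Filter.Tendsto (fun y => ∑ i, ∑ j, |(M y - M p) i j|) (nhds p) (nhds 0) := by
    have : (0 : ℝ) = ∑ i : Fin n, ∑ j : Fin n, |M p i j - M p i j| := by simp
    rw [this]
    refine tendsto_finsetSum _ fun i _ => tendsto_finsetSum _ fun j _ => ?_
    exact (((hM.continuousOn i j).continuousAt (hM.isOpen.mem_nhds hp)).tendsto.sub_const _).abs
  filter_upwards [hcont.eventually_lt_const (sub_pos.2 hKK')] with y hy v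
  have h1 := (abs_le.1 (abs_bilin_le (M y - M p) v v)).2
  rw [bilin_sub_matrix, mul_assoc, ← sq] at h1
  have h2 := mul_le_mul_of_nonneg_right hy.le (sq_nonneg ‖v‖)
  have := hK v
  linarith

/-- Near a point of `X`, the Riemann distance is at most `K` times the Euclidean distance. -/
theorem IsMetric.eventually_riemDist_le (hM : IsMetric X M) {p : E n} (hp : p ∈ X) {K K' : ℝ}
    (hK : ∀ v, bilin (M p) v v ≤ K ^ 2 * ‖v‖ ^ 2) (hK0 : 0 ≤ K) (hKK' : K < K') :
    ∃ ρ > 0, ∀ y ∈ Metric.ball p ρ, ∀ z ∈ Metric.ball p ρ,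
      y ∈ X ∧ riemDist X M y z ≤ ENNReal.ofReal (K' * ‖z - y‖) := by
  have h := (hM.eventually_bilin_le hp hK (K' := K' ^ 2) (by gcongr)).and
    (hM.isOpen.eventually_mem hp)
  obtain ⟨ρ, hρ, hball⟩ := Metric.eventually_nhds_iff_ball.1 h
  refine ⟨ρ, hρ, fun y hy z hz => ⟨(hball y hy).2, ?_⟩⟩
  set c : ℝ → E n := fun s => y + s • (z - y) with hc
  have hcd : ContDiff ℝ 1 c := by fun_prop
  have hmem : ∀ s ∈ Icc (0 : ℝ) 1, c s ∈ Metric.ball p ρ := fun s hs =>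
    (convex_ball p ρ).add_smul_sub_mem hy hz hs
  have hcurve : IsCurve X y z c :=
    ⟨hcd.contDiffOn, fun s hs => (hball _ (hmem s hs)).2, by simp [hc], by simp [hc]⟩
  refine (riemDist_le_length hcurve).trans (ENNReal.ofReal_le_ofReal ?_)
  have hvel : ∀ s ∈ Icc (0 : ℝ) 1, velocity c s = z - y := fun s hs => by
    refine velocity_eq hs ?_
    simpa [hc] using (((hasDerivAt_id s).smul_const (z - y)).const_add y).hasDerivWithinAt
  have : length M c ≤ ∫ _ in (0 : ℝ)..1, K' * ‖z - y‖ := by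
    refine intervalIntegral.integral_mono_on zero_le_one
      (hM.intervalIntegrable_speed hcurve.contDiff hcurve.mem) (by simp) fun s hs => ?_
    rw [speed, hvel s hs]
    refine Real.sqrt_le_iff.2 ⟨mul_nonneg (hK0.trans hKK'.le) (norm_nonneg _), ?_⟩
    rw [mul_pow]
    exact (hball _ (hmem s hs)).1 _
  simpa using this

end Riemann

open Filter Topology

/-! ### One-step growth of the distance, and the comparison principle -/

section Step

variable {n : ℕ} {X : Set (E n)} {M : E n → Matrix (Fin n) (Fin n) ℝ}

theorem exists_bilin_le (A : Matrix (Fin n) (Fin n) ℝ) :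
    ∃ k : ℝ, 0 ≤ k ∧ ∀ v, bilin A v v ≤ k ^ 2 * ‖v‖ ^ 2 := by
  refine ⟨(∑ i, ∑ j, |A i j|) + 1, by positivity, fun v => ?_⟩
  have h1 := (abs_le.1 (abs_bilin_le A v v)).2
  have h2 : 0 ≤ ∑ i, ∑ j, |A i j| := by positivity
  rw [mul_assoc, ← sq] at h1
  exact h1.trans (mul_le_mul_of_nonneg_right (by nlinarith) (sq_nonneg _))

/-- All growth estimates concern forward steps h → 0⁺, because the executed state has only right
derivatives. -/
theorem eventually_norm_sub_le_of_hasDerivWithinAt {F : Type*} [NormedAddCommGroup F]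
    [NormedSpace ℝ F] {p : ℝ → F} {p' : F} {t : ℝ} (hp : HasDerivWithinAt p p' (Ici t) t) {δ : ℝ}
    (hδ : 0 < δ) : ∀ᶠ h in 𝓝[>] (0 : ℝ), ‖p (t + h) - (p t + h • p')‖ ≤ δ * h := by
  have htend : Tendsto (fun h : ℝ => t + h) (𝓝[>] 0) (𝓝[≥] t) := by
    refine tendsto_nhdsWithin_iff.2 ⟨?_, ?_⟩
    · have : Tendsto (fun h : ℝ => t + h) (𝓝 0) (𝓝 (t + 0)) := by
        exact tendsto_const_nhds.add tendsto_id
      rw [add_zero] at this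
      exact this.mono_left nhdsWithin_le_nhds
    · filter_upwards [self_mem_nhdsWithin] with h hh
      rw [mem_Ioi] at hh
      rw [mem_Ici]; linarith
  have h1 := htend.eventually ((hasDerivWithinAt_iff_isLittleO.1 hp).def hδ)
  filter_upwards [h1, self_mem_nhdsWithin] with h hh hpos
  rw [mem_Ioi] at hpos
  simp only [add_sub_cancel_left, Real.norm_eq_abs, abs_of_pos hpos] at hh
  rwa [← sub_sub]

theorem tendsto_add_smul {F : Type*} [NormedAddCommGroup F] [NormedSpace ℝ F] (a v : F) :
    Tendsto (fun h : ℝ => a + h • v) (𝓝[>] 0) (𝓝 a) := by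
  have h : Continuous fun h : ℝ => a + h • v := by fun_prop
  have := h.tendsto 0
  simp only [zero_smul, add_zero] at this
  exact this.mono_left nhdsWithin_le_nhds

theorem tendsto_of_hasDerivWithinAt {F : Type*} [NormedAddCommGroup F] [NormedSpace ℝ F]
    {p : ℝ → F} {p' : F} {t : ℝ} (hp : HasDerivWithinAt p p' (Ici t) t) :
    Tendsto (fun h : ℝ => p (t + h)) (𝓝[>] 0) (𝓝 (p t)) := by
  refine hp.continuousWithinAt.tendsto.comp (tendsto_nhdsWithin_iff.2 ⟨?_, ?_⟩)
  · simpa using tendsto_add_smul t (1 : ℝ)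
  · filter_upwards [self_mem_nhdsWithin] with h hh
    rw [mem_Ioi] at hh
    rw [mem_Ici]; linarith

theorem eventually_one_sub_mul_nonneg (a : ℝ) : ∀ᶠ h in 𝓝[>] (0 : ℝ), 0 ≤ 1 - a * h := by
  have h : Continuous fun h : ℝ => 1 - a * h := by fun_prop
  have := h.tendsto 0
  simp only [mul_zero, sub_zero] at this
  filter_upwards [(this.mono_left nhdsWithin_le_nhds).eventually_const_lt zero_lt_one] with h hh
  exact hh.le

/-- If moving along the right derivative `p'` of `p` and along `v` contracts the distance with rate
`l`, then the distance of `p` and `q` grows at most with rate `-l d + K ‖q' - v‖`. -/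
theorem IsMetric.eventually_riemDist_step (hM : IsMetric X M) {p q : ℝ → E n} {p' q' v : E n}
    {t K l d : ℝ} (hp : HasDerivWithinAt p p' (Ici t) t) (hq : HasDerivWithinAt q q' (Ici t) t)
    (hpX : p t ∈ X) (hqX : q t ∈ X) (hK0 : 0 ≤ K)
    (hK : ∀ w, bilin (M (q t)) w w ≤ K ^ 2 * ‖w‖ ^ 2) (hd : 0 ≤ d)
    (hc : ∀ η > 0, ∀ᶠ h in 𝓝[>] (0 : ℝ),
      riemDist X M (p t + h • p') (q t + h • v) ≤ ENNReal.ofReal ((1 - l * h) * d + η * h))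
    {η : ℝ} (hη : 0 < η) :
    ∀ᶠ h in 𝓝[>] (0 : ℝ), riemDist X M (p (t + h)) (q (t + h)) ≤
      ENNReal.ofReal ((1 - l * h) * d + h * (K * ‖q' - v‖ + η)) := by
  -- At p any local constant will do, since there the Euler error is o(h). At q the leg has length
  -- of order h, so the sharp constant K is needed up to δ.
  obtain ⟨k₁, hk₁0, hk₁b⟩ := exists_bilin_le (M (p t))
  obtain ⟨ρ₁, hρ₁, hs₁⟩ := hM.eventually_riemDist_le hpX hk₁b hk₁0 (lt_add_one k₁)
  set e : ℝ := ‖q' - v‖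
  have he : 0 ≤ e := norm_nonneg _
  -- Chosen so that (K + δ)(e + δ) ≤ K e + δ (K + e + 1) ≤ K e + η/2.
  set δ : ℝ := min 1 (η / (2 * (K + e + 1)))
  have hδ : 0 < δ := lt_min one_pos (by positivity)
  have hδ1 : δ ≤ 1 := min_le_left _ _
  have hδ2 : δ * (K + e + 1) ≤ η / 2 := by
    have := mul_le_mul_of_nonneg_right (min_le_right 1 (η / (2 * (K + e + 1))))
      (by positivity : 0 ≤ K + e + 1)
    refine this.trans (le_of_eq ?_)
    field_simp
  obtain ⟨ρ₂, hρ₂, hs₂⟩ := hM.eventually_riemDist_le hqX hK hK0 (lt_add_of_pos_right K hδ)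
  have hball : ∀ {f : ℝ → E n} {a : E n} {ρ : ℝ}, 0 < ρ → Tendsto f (𝓝[>] 0) (𝓝 a) →
      ∀ᶠ h in 𝓝[>] (0 : ℝ), f h ∈ Metric.ball a ρ := fun hρ hf =>
    hf.eventually (Metric.ball_mem_nhds _ hρ)
  filter_upwards [hc (η / 4) (by positivity), eventually_one_sub_mul_nonneg l,
    eventually_norm_sub_le_of_hasDerivWithinAt hp (δ := η / (4 * (k₁ + 1))) (by positivity),
    eventually_norm_sub_le_of_hasDerivWithinAt hq hδ,
    hball hρ₁ (tendsto_of_hasDerivWithinAt hp), hball hρ₁ (tendsto_add_smul (p t) p'),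
    hball hρ₂ (tendsto_of_hasDerivWithinAt hq), hball hρ₂ (tendsto_add_smul (q t) v),
    self_mem_nhdsWithin] with h h1 h2 h3 h4 h5 h6 h7 h8 hpos
  rw [mem_Ioi] at hpos
  have e1 := (hs₁ _ h5 _ h6).2
  have e2 := (hs₂ _ h8 _ h7).2
  have e3 : (k₁ + 1) * ‖p t + h • p' - p (t + h)‖ ≤ η / 4 * h := by
    rw [norm_sub_rev]
    refine (mul_le_mul_of_nonneg_left h3 (by positivity)).trans (le_of_eq ?_)
    field_simp
  have e4 : ‖q (t + h) - (q t + h • v)‖ ≤ h * (e + δ) := by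
    have : q (t + h) - (q t + h • v) = (q (t + h) - (q t + h • q')) + h • (q' - v) := by
      rw [smul_sub]; abel
    rw [this]
    refine (norm_add_le _ _).trans ?_
    rw [norm_smul, Real.norm_eq_abs, abs_of_pos hpos]
    linarith
  have e5 : (K + δ) * ‖q (t + h) - (q t + h • v)‖ ≤ h * (K * e + η / 2) := by
    refine (mul_le_mul_of_nonneg_left e4 (by positivity)).trans ?_
    rw [mul_left_comm]
    refine mul_le_mul_of_nonneg_left ?_ hpos.le
    nlinarith [mul_le_mul_of_nonneg_left hδ1 hδ.le]
  -- Route: from p(t + h) to its Euler point, across by the assumed contraction, then to q(t + h);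
  -- the last leg carries the discrepancy q' - v.
  calc riemDist X M (p (t + h)) (q (t + h))
      ≤ riemDist X M (p (t + h)) (p t + h • p') + riemDist X M (p t + h • p') (q t + h • v)
        + riemDist X M (q t + h • v) (q (t + h)) :=
        (hM.riemDist_triangle _ _ _).trans (add_le_add_left (hM.riemDist_triangle _ _ _) _)
    _ ≤ ENNReal.ofReal (η / 4 * h) + ENNReal.ofReal ((1 - l * h) * d + η / 4 * h)
        + ENNReal.ofReal (h * (K * e + η / 2)) :=
        add_le_add (add_le_add (e1.trans (ENNReal.ofReal_le_ofReal e3)) h1)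
          (e2.trans (ENNReal.ofReal_le_ofReal e5))
    _ = ENNReal.ofReal ((1 - l * h) * d + h * (K * e + η)) := by
        rw [← ENNReal.ofReal_add (by positivity) (by positivity),
          ← ENNReal.ofReal_add (by positivity) (by positivity)]
        congr 1; ring

/-- Comparison principle for the Riemann distance along two curves: if the distance stays below
`√lo` times the tube radius as long as it can be shown to grow at most as fast as the barrier `y`,
then it stays there. -/
theorem IsMetric.riemDist_lt_barrier (hM : IsMetric X M) {p q : ℝ → E n} {a b lo c : ℝ}
    {y y' : ℝ → ℝ} (hlo0 : 0 < lo) (hp : ContinuousOn p (Icc a b))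
    (hq : ContinuousOn q (Icc a b)) (hy : ContinuousOn y (Icc a b))
    (hy' : ∀ t ∈ Ico a b, HasDerivWithinAt y (y' t) (Ici t) t)
    (hpX : ∀ t ∈ Icc a b, Metric.ball (p t) (y t / √lo) ⊆ X)
    (hlo : ∀ t ∈ Icc a b, ∀ z ∈ Metric.ball (p t) (y t / √lo), ∀ v,
      lo * ‖v‖ ^ 2 ≤ bilin (M z) v v)
    (hstep : ∀ t ∈ Ico a b, ∀ d, 0 ≤ d → d < y t →
      riemDist X M (p t) (q t) ≤ ENNReal.ofReal d → ∀ η > 0, ∀ᶠ h in 𝓝[>] (0 : ℝ),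
        0 ≤ d + h * (y' t + c * (y t - d) + η) ∧ riemDist X M (p (t + h)) (q (t + h)) ≤
          ENNReal.ofReal (d + h * (y' t + c * (y t - d) + η)))
    (ha : riemDist X M (p a) (q a) < ENNReal.ofReal (y a)) :
    ∀ t ∈ Icc a b, riemDist X M (p t) (q t) < ENNReal.ofReal (y t) := by
  set d₀ := (riemDist X M (p a) (q a)).toReal with hd₀
  have hd₀0 : 0 ≤ d₀ := ENNReal.toReal_nonneg
  have hfin : riemDist X M (p a) (q a) ≠ ⊤ := ha.ne_top
  have hd₀y : d₀ < y a := (ENNReal.lt_ofReal_iff_toReal_lt hfin).1 ha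
  -- A strict subbarrier z = y - w is used: it starts at the initial distance, and as the gap w
  -- decays at a rate C > c, z grows faster than the distance is allowed to, by a margin (C - c) w.
  set C : ℝ := |c| + 1
  have hC : c < C := (le_abs_self c).trans_lt (lt_add_one _)
  set w : ℝ → ℝ := fun t => (y a - d₀) * Real.exp (-C * (t - a)) with hw
  have hw0 : ∀ t, 0 < w t := fun t => mul_pos (sub_pos.2 hd₀y) (Real.exp_pos _)
  have hw' : ∀ t, HasDerivAt w (-C * w t) t := fun t => by
    have h1 : HasDerivAt (fun t : ℝ => -C * (t - a)) (-C) t := by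
      simpa using ((hasDerivAt_id t).sub_const a).const_mul (-C)
    exact (h1.exp.const_mul (y a - d₀)).congr_deriv (by simp only [hw]; ring)
  have hwc : Continuous w := continuous_iff_continuousAt.2 fun t => (hw' t).continuousAt
  set z : ℝ → ℝ := fun t => y t - w t with hz
  have hzc : ContinuousOn z (Icc a b) := hy.sub hwc.continuousOn
  set s : Set ℝ := {t | 0 ≤ z t ∧ riemDist X M (p t) (q t) ≤ ENNReal.ofReal (z t)} with hs
  have hzy : ∀ t, z t < y t := fun t => sub_lt_self _ (hw0 t)
  have hlo' : 0 < √lo := Real.sqrt_pos.2 hlo0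
  suffices hsub : Icc a b ⊆ s by
    intro t ht
    obtain ⟨h1, h2⟩ := hsub ht
    exact h2.trans_lt ((ENNReal.ofReal_lt_ofReal_iff (h1.trans_lt (hzy t))).2 (hzy t))
  -- Continuous induction: the good times form a closed set that contains a and extends to the right
  -- of each of its points before b.
  refine IsClosed.Icc_subset_of_forall_exists_gt (a := a) (b := b) ?_ ?_ ?_
  · refine IsSeqClosed.isClosed fun τ t hτ hlim => ?_
    have htI : t ∈ Icc a b := isClosed_Icc.mem_of_tendsto hlim
      (Eventually.of_forall fun k => (hτ k).2)
    have hlim' : Tendsto τ atTop (𝓝[Icc a b] t) :=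
      tendsto_nhdsWithin_iff.2 ⟨hlim, Eventually.of_forall fun k => (hτ k).2⟩
    have hpl := (hp t htI).tendsto.comp hlim'
    have hql := (hq t htI).tendsto.comp hlim'
    have hzl := (hzc t htI).tendsto.comp hlim'
    have hz0 : 0 ≤ z t := ge_of_tendsto' hzl fun k => (hτ k).1.1
    -- It is not known beforehand that q(t) lies in `X`. The norm bound passes to the limit and
    -- places q(t) in the ball around p(t), which is in `X`; only then is the distance controlled
    -- near q(t).
    have hnorm : √lo * ‖q t - p t‖ ≤ z t := by
      refine le_of_tendsto_of_tendsto' ((hql.sub hpl).norm.const_mul _) hzl fun k => ?_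
      refine hM.norm_sub_le_of_riemDist (hlo _ (hτ k).2) (hτ k).1.1 ?_ (hτ k).1.2
      rw [mul_div_cancel₀ _ hlo'.ne']
      exact hzy _
    have hqball : q t ∈ Metric.ball (p t) (y t / √lo) := by
      rw [mem_ball_iff_norm, lt_div_iff₀' hlo']
      exact hnorm.trans_lt (hzy t)
    have hypos : 0 < y t / √lo := div_pos (hz0.trans_lt (hzy t)) hlo'
    have key : ∀ x ∈ X, ∃ K, ∃ ρ > 0, ∀ u ∈ Metric.ball x ρ, ∀ v ∈ Metric.ball x ρ,
        u ∈ X ∧ riemDist X M u v ≤ ENNReal.ofReal (K * ‖v - u‖) := fun x hx => by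
      obtain ⟨k, hk0, hk⟩ := exists_bilin_le (M x)
      exact ⟨_, hM.eventually_riemDist_le hx hk hk0 (lt_add_one k)⟩
    obtain ⟨K₁, ρ₁, hρ₁, hK₁⟩ := key (p t) (hpX t htI (Metric.mem_ball_self hypos))
    obtain ⟨K₂, ρ₂, hρ₂, hK₂⟩ := key (q t) (hpX t htI hqball)
    refine ⟨⟨hz0, ?_⟩, htI⟩
    have hrhs : Tendsto (fun k => ENNReal.ofReal (K₁ * ‖p (τ k) - p t‖) + ENNReal.ofReal (z (τ k))
        + ENNReal.ofReal (K₂ * ‖q t - q (τ k)‖)) atTop (𝓝 (ENNReal.ofReal (z t))) := by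
      have t1 := ENNReal.tendsto_ofReal ((hpl.sub_const (p t)).norm.const_mul K₁)
      have t2 := ENNReal.tendsto_ofReal hzl
      have t3 := ENNReal.tendsto_ofReal ((hql.const_sub (q t)).norm.const_mul K₂)
      simpa using (t1.add t2).add t3
    refine ge_of_tendsto hrhs ?_
    filter_upwards [hpl.eventually (Metric.ball_mem_nhds _ hρ₁),
      hql.eventually (Metric.ball_mem_nhds _ hρ₂)] with k h1 h2
    calc riemDist X M (p t) (q t) ≤ riemDist X M (p t) (p (τ k)) + riemDist X M (p (τ k)) (q (τ k))
          + riemDist X M (q (τ k)) (q t) :=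
          (hM.riemDist_triangle _ _ _).trans (add_le_add_left (hM.riemDist_triangle _ _ _) _)
      _ ≤ _ := add_le_add (add_le_add (hK₁ _ (Metric.mem_ball_self hρ₁) _ h1).2 (hτ k).1.2)
          (hK₂ _ h2 _ (Metric.mem_ball_self hρ₂)).2
  · refine ⟨by simp [hz, hw, hd₀0], ?_⟩
    simp [hz, hw, hd₀, ENNReal.ofReal_toReal hfin]
  · rintro t ⟨⟨hz0, hdz⟩, htI⟩ u hu
    -- One third of the margin absorbs the error of the step estimate and one third the
    -- linearization error of z.
    set η : ℝ := (C - c) * w t / 3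
    have hη : 0 < η := by have := mul_pos (sub_pos.2 hC) (hw0 t); positivity
    have hzd : HasDerivWithinAt z (y' t + C * w t) (Ici t) t :=
      ((hy' t htI).sub (hw' t).hasDerivWithinAt).congr_deriv (by ring)
    have hev := hstep t htI (z t) hz0 (hzy t) hdz η hη
    have hsmall : ∀ᶠ h in 𝓝[>] (0 : ℝ), t + h < u := by
      have := tendsto_add_smul t (1 : ℝ)
      simp only [smul_eq_mul, mul_one] at this
      exact this.eventually_lt_const hu
    obtain ⟨h, h1, h2, h3, hpos : 0 < h⟩ := (hev.and
      ((eventually_norm_sub_le_of_hasDerivWithinAt hzd hη).and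
        (hsmall.and self_mem_nhdsWithin))).exists
    have hle : z t + h * (y' t + c * (y t - z t) + η) ≤ z (t + h) := by
      have h4 := (abs_le.1 ((Real.norm_eq_abs _).symm.le.trans h2)).1
      have h5 : y t - z t = w t := by simp [hz]
      rw [h5]
      simp only [smul_eq_mul] at h4
      have h6 : h * (3 * η) = h * ((C - c) * w t) := by simp only [η]; ring
      nlinarith [mul_pos hpos hη]
    exact ⟨t + h, ⟨h1.1.trans hle, h1.2.trans (ENNReal.ofReal_le_ofReal hle)⟩, by linarith, h3.le⟩

end Step

/-! ### Contraction of curves under Euler steps of a vector field -/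

section WeakContraction

variable {n : ℕ} {X : Set (E n)} {M : E n → Matrix (Fin n) (Fin n) ℝ}

theorem IsMetric.hasDerivWithinAt_comp (hM : IsMetric X M) {c : ℝ → E n} {c' : E n} {s : Set ℝ}
    {t : ℝ} (hc : HasDerivWithinAt c c' s t) (hX : c t ∈ X) (i j : Fin n) :
    HasDerivWithinAt (fun r => M (c r) i j) (lieDeriv M c' (c t) i j) s t := by
  rw [lieDeriv_apply]
  exact (((hM.contDiffOn i j).contDiffAt (hM.isOpen.mem_nhds hX)).differentiableAt
    one_ne_zero).hasFDerivAt.comp_hasDerivWithinAt t hc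

theorem IsMetric.tendsto_lieDeriv (hM : IsMetric X M) {α : Type*} {l : Filter α} {u c : α → E n}
    {u₀ c₀ : E n} (hu : Tendsto u l (𝓝 u₀)) (hc : Tendsto c l (𝓝 c₀)) (hX : c₀ ∈ X) (i j : Fin n) :
    Tendsto (fun r => lieDeriv M (u r) (c r) i j) l (𝓝 (lieDeriv M u₀ c₀ i j)) := by
  simp only [lieDeriv_apply]
  have h1 : ContinuousAt (fderiv ℝ fun z => M z i j) c₀ :=
    ((hM.contDiffOn i j).continuousOn_fderiv_of_isOpen hM.isOpen le_rfl).continuousAt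
      (hM.isOpen.mem_nhds hX)
  exact tendsto_clm_apply (h1.tendsto.comp hc) hu

theorem IsMetric.tendsto_apply (hM : IsMetric X M) {α : Type*} {l : Filter α} {c : α → E n}
    {c₀ : E n} (hc : Tendsto c l (𝓝 c₀)) (hX : c₀ ∈ X) (i j : Fin n) :
    Tendsto (fun r => M (c r) i j) l (𝓝 (M c₀ i j)) :=
  ((hM.continuousOn i j).continuousAt (hM.isOpen.mem_nhds hX)).tendsto.comp hc

/-- If the metric contracts along the vector field `G` with a rate above `l`, then small Euler steps
contract it uniformly on compact sets. -/
theorem IsMetric.exists_euler_contraction (hM : IsMetric X M) {O K : Set (E n)} (hO : IsOpen O)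
    (hOX : O ⊆ X) (hK : IsCompact K) (hKO : K ⊆ O) {G : E n → E n} (hG : ContDiffOn ℝ 1 G O) {l : ℝ}
    (hl : ∀ y ∈ O, ∀ v ≠ 0, bilin (lieDeriv M (G y) y) v v + 2 * bilin (M y) v (fderiv ℝ G y v)
      + 2 * l * bilin (M y) v v < 0) :
    ∃ δ > 0, ∀ h, 0 < h → h < δ → ∀ y ∈ K, y + h • G y ∈ X ∧ ∀ v,
      bilin (M (y + h • G y)) (v + h • fderiv ℝ G y v) (v + h • fderiv ℝ G y v)
        ≤ (1 - 2 * l * h) * bilin (M y) v v := by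
  -- The derivative in h of the stretched quadratic form plus 2lh times the original one. At h = 0
  -- it is the expression assumed negative.
  set ψ : ℝ → E n × E n → ℝ := fun h z =>
    bilin (lieDeriv M (G z.1) (z.1 + h • G z.1)) (z.2 + h • fderiv ℝ G z.1 z.2)
        (z.2 + h • fderiv ℝ G z.1 z.2)
      + 2 * bilin (M (z.1 + h • G z.1)) (z.2 + h • fderiv ℝ G z.1 z.2) (fderiv ℝ G z.1 z.2)
      + 2 * l * bilin (M z.1) z.2 z.2 with hψ
  have hfd : ContinuousOn (fderiv ℝ G) O := hG.continuousOn_fderiv_of_isOpen hO le_rfl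
  -- By homogeneity unit vectors suffice, and compactness of K times the unit sphere makes the step
  -- size uniform.
  have key : ∀ᶠ h in 𝓝 (0 : ℝ), ∀ z ∈ K ×ˢ Metric.sphere (0 : E n) 1,
      z.1 + h • G z.1 ∈ X ∧ ψ h z < 0 := by
    refine (hK.prod (isCompact_sphere _ _)).eventually_forall_of_forall_eventually ?_
    rintro ⟨y, v⟩ ⟨hy, hv⟩
    have hyO := hKO hy
    have hh : Tendsto (fun z : ℝ × E n × E n => z.1) (𝓝 (0, y, v)) (𝓝 0) := continuousAt_fst
    have hz : Tendsto (fun z : ℝ × E n × E n => z.2.1) (𝓝 (0, y, v)) (𝓝 y) :=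
      (continuous_fst.comp continuous_snd).continuousAt
    have hw : Tendsto (fun z : ℝ × E n × E n => z.2.2) (𝓝 (0, y, v)) (𝓝 v) :=
      (continuous_snd.comp continuous_snd).continuousAt
    have hGz : Tendsto (fun z : ℝ × E n × E n => G z.2.1) (𝓝 (0, y, v)) (𝓝 (G y)) :=
      (hG.continuousOn.continuousAt (hO.mem_nhds hyO)).tendsto.comp hz
    have hDz : Tendsto (fun z : ℝ × E n × E n => fderiv ℝ G z.2.1 z.2.2) (𝓝 (0, y, v))
        (𝓝 (fderiv ℝ G y v)) :=
      tendsto_clm_apply ((hfd.continuousAt (hO.mem_nhds hyO)).tendsto.comp hz) hw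
    have hy' : Tendsto (fun z : ℝ × E n × E n => z.2.1 + z.1 • G z.2.1) (𝓝 (0, y, v)) (𝓝 y) := by
      simpa using hz.add (hh.smul hGz)
    have hv' : Tendsto (fun z : ℝ × E n × E n => z.2.2 + z.1 • fderiv ℝ G z.2.1 z.2.2)
        (𝓝 (0, y, v)) (𝓝 v) := by
      simpa using hw.add (hh.smul hDz)
    have hlim : Tendsto (fun z : ℝ × E n × E n => ψ z.1 z.2) (𝓝 (0, y, v))
        (𝓝 (bilin (lieDeriv M (G y) y) v v + 2 * bilin (M y) v (fderiv ℝ G y v)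
          + 2 * l * bilin (M y) v v)) :=
      ((tendsto_bilin (hM.tendsto_lieDeriv hGz hy' (hOX hyO)) hv' hv').add
        ((tendsto_bilin (hM.tendsto_apply hy' (hOX hyO)) hv' hDz).const_mul 2)).add
        ((tendsto_bilin (hM.tendsto_apply hz (hOX hyO)) hw hw).const_mul (2 * l))
    have hv0 : v ≠ 0 := by rintro rfl; simp at hv
    exact (hy'.eventually (hM.isOpen.mem_nhds (hOX hyO))).and
      (hlim.eventually_lt_const (hl y hyO v hv0))
  -- The unit sphere is empty for n = 0, so membership in `X` is obtained without it.
  have key2 : ∀ᶠ h in 𝓝 (0 : ℝ), ∀ y ∈ K, y + h • G y ∈ X := by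
    refine hK.eventually_forall_of_forall_eventually fun y hy => ?_
    have hyO := hKO hy
    have hh : Tendsto (fun z : ℝ × E n => z.1) (𝓝 (0, y)) (𝓝 0) := continuousAt_fst
    have hz : Tendsto (fun z : ℝ × E n => z.2) (𝓝 (0, y)) (𝓝 y) := continuousAt_snd
    have hy' : Tendsto (fun z : ℝ × E n => z.2 + z.1 • G z.2) (𝓝 (0, y)) (𝓝 y) := by
      simpa using hz.add (hh.smul
        ((hG.continuousOn.continuousAt (hO.mem_nhds hyO)).tendsto.comp hz))
    exact hy'.eventually (hM.isOpen.mem_nhds (hOX hyO))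
  obtain ⟨δ, hδ, hball⟩ := Metric.eventually_nhds_iff.1 (key.and key2)
  have hmem : ∀ {h r : ℝ}, h < δ → r ∈ Icc 0 h → dist r 0 < δ := fun hh hr => by
    rw [Real.dist_0_eq_abs, abs_of_nonneg hr.1]; exact hr.2.trans_lt hh
  refine ⟨δ, hδ, fun h hpos hh y hy =>
    ⟨(hball (hmem hh (right_mem_Icc.2 hpos.le))).2 y hy, fun v => ?_⟩⟩
  have hunit : ∀ u : E n, ‖u‖ = 1 →
      bilin (M (y + h • G y)) (u + h • fderiv ℝ G y u) (u + h • fderiv ℝ G y u)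
        ≤ (1 - 2 * l * h) * bilin (M y) u u := by
    intro u hu
    have hP := fun r (hr : r ∈ Icc 0 h) =>
      (hball (hmem hh hr)).1 (y, u) ⟨hy, by simpa using hu⟩
    have hder : ∀ r ∈ Icc 0 h, HasDerivWithinAt (fun r =>
        bilin (M (y + r • G y)) (u + r • fderiv ℝ G y u) (u + r • fderiv ℝ G y u)
          + 2 * l * r * bilin (M y) u u) (ψ r (y, u)) (Icc 0 h) r := by
      intro r hr
      have h1 : HasDerivWithinAt (fun r : ℝ => y + r • G y) (G y) (Icc 0 h) r := by
        simpa using (((hasDerivAt_id r).smul_const (G y)).const_add y).hasDerivWithinAt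
      have h2 : HasDerivWithinAt (fun r : ℝ => u + r • fderiv ℝ G y u) (fderiv ℝ G y u)
          (Icc 0 h) r := by
        simpa using (((hasDerivAt_id r).smul_const (fderiv ℝ G y u)).const_add u).hasDerivWithinAt
      have h3 : HasDerivWithinAt (fun r : ℝ => 2 * l * r * bilin (M y) u u)
          (2 * l * bilin (M y) u u) (Icc 0 h) r := by
        simpa using (((hasDerivAt_id r).const_mul (2 * l)).mul_const
          (bilin (M y) u u)).hasDerivWithinAt
      have hX := (hP r hr).1
      refine ((hasDerivWithinAt_bilin (hM.hasDerivWithinAt_comp h1 hX) h2 h2).add h3).congr_deriv ?_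
      simp only [hψ]
      rw [bilin_comm (posDef_transpose (hM.posDef _ hX)) (fderiv ℝ G y u)]
      ring
    have hanti : AntitoneOn (fun r =>
        bilin (M (y + r • G y)) (u + r • fderiv ℝ G y u) (u + r • fderiv ℝ G y u)
          + 2 * l * r * bilin (M y) u u) (Icc 0 h) :=
      antitoneOn_of_hasDerivWithinAt_nonpos (convex_Icc _ _)
        (fun r hr => (hder r hr).continuousWithinAt)
        (fun r hr => (hder r (interior_subset hr)).mono interior_subset)
        (fun r hr => (hP r (interior_subset hr)).2.le)
    have := hanti (left_mem_Icc.2 hpos.le) (right_mem_Icc.2 hpos.le) hpos.le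
    simp only [zero_smul, add_zero, mul_zero, zero_mul] at this
    linarith
  rcases eq_or_ne v 0 with rfl | hv
  · simp
  · have hn : ‖v‖ ≠ 0 := norm_ne_zero_iff.2 hv
    have h1 := hunit (‖v‖⁻¹ • v) (by rw [norm_smul, norm_inv, norm_norm, inv_mul_cancel₀ hn])
    rw [map_smul, smul_comm h, ← smul_add, bilin_smul_left, bilin_smul_right, bilin_smul_left,
      bilin_smul_right] at h1
    have h2 : 0 < ‖v‖⁻¹ * ‖v‖⁻¹ := by positivity
    refine le_of_mul_le_mul_left ?_ h2
    linarith

/-- An almost shortest curve from p to q is pushed through y ↦ y + hG(y). It stays in a compact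
ball, where tangent vectors are stretched by at most √(1 - 2lh) ≤ 1 - lh. -/
theorem IsMetric.riemDist_euler_le (hM : IsMetric X M) {p q : E n} {lo ε : ℝ}
    (hX : Metric.ball p ε ⊆ X) (hlo0 : 0 < lo)
    (hlo : ∀ y ∈ Metric.ball p ε, ∀ v, lo * ‖v‖ ^ 2 ≤ bilin (M y) v v) {G : E n → E n}
    (hG : ContDiffOn ℝ 1 G (Metric.ball p ε)) {l : ℝ}
    (hl : ∀ y ∈ Metric.ball p ε, ∀ v ≠ 0, bilin (lieDeriv M (G y) y) v v
      + 2 * bilin (M y) v (fderiv ℝ G y v) + 2 * l * bilin (M y) v v < 0)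
    {d : ℝ} (hd : 0 ≤ d) (hdε : d < √lo * ε) (h : riemDist X M p q ≤ ENNReal.ofReal d) {η : ℝ}
    (hη : 0 < η) :
    ∀ᶠ h in 𝓝[>] (0 : ℝ),
      riemDist X M (p + h • G p) (q + h • G q) ≤ ENNReal.ofReal ((1 - l * h) * d + η * h) := by
  have hlo' : 0 < √lo := Real.sqrt_pos.2 hlo0
  -- A length strictly between d and √lo ε confines the curve to a closed ball inside the open one,
  -- as the uniform step size requires.
  obtain ⟨d', hdd', hd'⟩ := exists_between hdε
  have hε' : d' / √lo < ε := by rwa [div_lt_iff₀' hlo']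
  obtain ⟨δ, hδ, hcon⟩ := hM.exists_euler_contraction Metric.isOpen_ball hX
    (isCompact_closedBall p (d' / √lo)) (Metric.closedBall_subset_ball hε') hG hl
  have hlt : ∀ᶠ h in 𝓝[>] (0 : ℝ), h < δ := mem_nhdsWithin_of_mem_nhds (Iio_mem_nhds hδ)
  filter_upwards [eventually_one_sub_mul_nonneg (2 * l), eventually_one_sub_mul_nonneg l, hlt,
    self_mem_nhdsWithin] with r h1 h2 h3 hpos
  rw [mem_Ioi] at hpos
  set k : ℝ := √(1 - 2 * l * r)
  have hk0 : 0 ≤ k := Real.sqrt_nonneg _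
  have hk : k ≤ 1 - l * r := Real.sqrt_le_iff.2 ⟨h2, by nlinarith [sq_nonneg (l * r)]⟩
  -- The excess length ηr/(k + 1) is small enough that stretching it by k leaves at most ηr.
  obtain ⟨d₂, hdd₂, hd₂⟩ := exists_between
    (lt_min hdd' (lt_add_of_pos_right d (div_pos (mul_pos hη hpos) (by positivity : 0 < k + 1))))
  obtain ⟨hd₂', hd₂''⟩ := lt_min_iff.1 hd₂
  obtain ⟨c, hc, hlen⟩ := exists_curve_of_riemDist_lt (h.trans_lt
    ((ENNReal.ofReal_lt_ofReal_iff (hd.trans_lt hdd₂)).2 hdd₂))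
  have hcmem : ∀ s ∈ Icc (0 : ℝ) 1, c s ∈ Metric.ball p (d' / √lo) := fun s hs =>
    hM.curve_mem_ball hc (fun y hy => hlo y (Metric.ball_subset_ball hε'.le hy))
      (by rw [mul_div_cancel₀ _ hlo'.ne']; exact hlen.trans hd₂') hs
  have hcmem' := fun s hs => Metric.ball_subset_closedBall (hcmem s hs)
  have hsub := Metric.ball_subset_ball (x := p) hε'.le
  refine (hM.riemDist_map_le hc (Ψ := fun y => y + r • G y) Metric.isOpen_ball
    (contDiffOn_id.add ((hG.mono hsub).const_smul r)) hcmem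
    (fun s hs => (hcon r hpos h3 _ (hcmem' s hs)).1) hk0 fun s hs v => ?_).trans
    (ENNReal.ofReal_le_ofReal ?_)
  · have hdiff : DifferentiableAt ℝ G (c s) := (hG.contDiffAt
      (Metric.isOpen_ball.mem_nhds (hsub (hcmem s hs)))).differentiableAt one_ne_zero
    have hfd : HasFDerivAt (fun y => y + r • G y)
        (ContinuousLinearMap.id ℝ (E n) + r • fderiv ℝ G (c s)) (c s) :=
      (hasFDerivAt_id (c s)).add (hdiff.hasFDerivAt.const_smul r)
    rw [hfd.fderiv, Real.sq_sqrt h1]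
    exact (hcon r hpos h3 _ (hcmem' s hs)).2 v
  · calc k * length M c ≤ k * (d + η * r / (k + 1)) := by gcongr; exact (hlen.trans hd₂'').le
      _ = k * d + η * r * (k / (k + 1)) := by ring
      _ ≤ (1 - l * r) * d + η * r * 1 := by
          gcongr
          exact (div_le_one (by positivity)).2 (by linarith)
      _ = _ := by ring

end WeakContraction

/-! ### Calculus of variations: the geodesic equation and the first variation -/

/-- The fundamental lemma of du Bois-Reymond. -/
theorem hasDerivWithinAt_of_integral_eq_zero {u r : ℝ → ℝ} (hu : ContinuousOn u (Icc 0 1))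
    (hr : ContinuousOn r (Icc 0 1))
    (h : ∀ φ : ℝ → ℝ, ContDiff ℝ 1 φ → φ 0 = 0 → φ 1 = 0 →
      ∫ s in (0 : ℝ)..1, (φ s * r s + deriv φ s * u s) = 0) {s : ℝ} (hs : s ∈ Icc (0 : ℝ) 1) :
    HasDerivWithinAt u (r s) (Icc 0 1) s := by
  -- Constant extension to ℝ, so that all primitives below are differentiable everywhere.
  set u' : ℝ → ℝ := IccExtend zero_le_one ((Icc (0 : ℝ) 1).domRestrict u)
  set r' : ℝ → ℝ := IccExtend zero_le_one ((Icc (0 : ℝ) 1).domRestrict r)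
  have hu' : Continuous u' := hu.domRestrict.Icc_extend'
  have hr' : Continuous r' := hr.domRestrict.Icc_extend'
  have hueq : ∀ s ∈ Icc (0 : ℝ) 1, u' s = u s := fun s hs => IccExtend_of_mem _ _ hs
  have hreq : ∀ s ∈ Icc (0 : ℝ) 1, r' s = r s := fun s hs => IccExtend_of_mem _ _ hs
  set R : ℝ → ℝ := fun s => ∫ t in (0 : ℝ)..s, r' t
  have hR : ∀ s, HasDerivAt R (r' s) s := fun s =>
    intervalIntegral.integral_hasDerivAt_right (hr'.intervalIntegrable _ _)
      (hr'.stronglyMeasurableAtFilter _ _) hr'.continuousAt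
  have hRc : Continuous R := continuous_iff_continuousAt.2 fun s => (hR s).continuousAt
  set w : ℝ → ℝ := fun s => u' s - R s
  have hw : Continuous w := hu'.sub hRc
  set m : ℝ := ∫ t in (0 : ℝ)..1, w t
  have hwm : Continuous fun s => w s - m := hw.sub continuous_const
  -- The test function whose derivative is w minus its mean: it vanishes at both ends, and the
  -- hypothesis becomes ∫ (w - m)² = 0, so that u differs from a primitive of r by a constant.
  set φ : ℝ → ℝ := fun s => ∫ t in (0 : ℝ)..s, (w t - m)
  have hφ : ∀ s, HasDerivAt φ (w s - m) s := fun s =>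
    intervalIntegral.integral_hasDerivAt_right (hwm.intervalIntegrable _ _)
      (hwm.stronglyMeasurableAtFilter _ _) hwm.continuousAt
  have hφd : deriv φ = fun s => w s - m := funext fun s => (hφ s).deriv
  have hφC : ContDiff ℝ 1 φ := contDiff_one_iff_deriv.2
    ⟨fun s => (hφ s).differentiableAt, by rw [hφd]; exact hwm⟩
  have hφ0 : φ 0 = 0 := intervalIntegral.integral_same
  have hφ1 : φ 1 = 0 := by
    simp only [φ]
    rw [intervalIntegral.integral_sub (hw.intervalIntegrable _ _) (by simp)]
    simp [m]
  have hφc : Continuous φ := hφC.continuous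
  have h1 : ∫ s in (0 : ℝ)..1, (φ s * r' s + (w s - m) * u' s) = 0 := by
    refine Eq.trans ?_ (h φ hφC hφ0 hφ1)
    refine intervalIntegral.integral_congr fun t ht => ?_
    rw [uIcc_of_le zero_le_one] at ht
    simp only [hφd, hueq t ht, hreq t ht]
  have h2 : ∫ s in (0 : ℝ)..1, φ s * r' s = -∫ s in (0 : ℝ)..1, (w s - m) * R s := by
    rw [intervalIntegral.integral_mul_deriv_eq_deriv_mul (fun s _ => hφ s) (fun s _ => hR s)
      (hwm.intervalIntegrable _ _) (hr'.intervalIntegrable _ _), hφ0, hφ1]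
    simp
  have h3 : ∫ s in (0 : ℝ)..1, (w s - m) ^ 2 = 0 := by
    rw [intervalIntegral.integral_add (f := fun s => φ s * r' s)
      (g := fun s => (w s - m) * u' s) ((hφc.mul hr').intervalIntegrable _ _)
      ((hwm.mul hu').intervalIntegrable _ _), h2, neg_add_eq_zero] at h1
    have h4 : ∫ s in (0 : ℝ)..1, ((w s - m) * u' s - (w s - m) * R s - m * (w s - m)) = 0 := by
      rw [intervalIntegral.integral_sub (f := fun s => (w s - m) * u' s - (w s - m) * R s)
        (g := fun s => m * (w s - m)) (((hwm.mul hu').sub (hwm.mul hRc)).intervalIntegrable _ _)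
        ((continuous_const.mul hwm).intervalIntegrable _ _),
        intervalIntegral.integral_sub (f := fun s => (w s - m) * u' s)
        (g := fun s => (w s - m) * R s) ((hwm.mul hu').intervalIntegrable _ _)
        ((hwm.mul hRc).intervalIntegrable _ _), h1, intervalIntegral.integral_const_mul]
      have : ∫ s in (0 : ℝ)..1, (w s - m) = 0 := hφ1
      rw [this]; simp
    refine Eq.trans ?_ h4
    refine intervalIntegral.integral_congr fun t _ => ?_
    simp only [w]; ring
  have h5 : ∀ t ∈ Icc (0 : ℝ) 1, w t = m := by
    intro t ht
    by_contra hne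
    have := intervalIntegral.integral_pos (f := fun s => (w s - m) ^ 2) zero_lt_one
      (hwm.pow 2).continuousOn (fun s _ => sq_nonneg _)
      ⟨t, ht, by have := sub_ne_zero.2 hne; positivity⟩
    linarith
  have h6 : HasDerivWithinAt (fun s => R s + m) (r s) (Icc 0 1) s := by
    rw [← hreq s hs]
    exact ((hR s).add_const m).hasDerivWithinAt
  have h7 : ∀ t ∈ Icc (0 : ℝ) 1, u t = R t + m := fun t ht => by
    rw [← hueq t ht, ← h5 t ht]; simp only [w]; ring
  exact h6.congr h7 (h7 s hs)

theorem hasDerivAt_add_smul {F : Type*} [NormedAddCommGroup F] [NormedSpace ℝ F] (a v : F)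
    (r : ℝ) : HasDerivAt (fun r : ℝ => a + r • v) v r := by
  have := ((hasDerivAt_id r).smul_const v).const_add a
  rw [one_smul] at this
  exact this

section Geodesic

variable {n : ℕ} {X : Set (E n)} {M : E n → Matrix (Fin n) (Fin n) ℝ}

/-- The `h`-derivative of the energy density of the variation `c + h V`. -/
noncomputable def variationDensity (M : E n → Matrix (Fin n) (Fin n) ℝ) (c V : ℝ → E n)
    (h s : ℝ) : ℝ :=
  bilin (lieDeriv M (V s) (c s + h • V s)) (velocity c s + h • velocity V s)
      (velocity c s + h • velocity V s)
    + 2 * bilin (M (c s + h • V s)) (velocity c s + h • velocity V s) (velocity V s)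

/-- The energy of the variation `c + h V`. -/
noncomputable def variationEnergy (M : E n → Matrix (Fin n) (Fin n) ℝ) (c V : ℝ → E n)
    (h : ℝ) : ℝ :=
  ∫ s in (0 : ℝ)..1, bilin (M (c s + h • V s)) (velocity c s + h • velocity V s)
    (velocity c s + h • velocity V s)

theorem IsMetric.tendsto_variationDensity (hM : IsMetric X M) {c V : ℝ → E n}
    (hc : ContDiffOn ℝ 1 c (Icc 0 1)) (hV : ContDiffOn ℝ 1 V (Icc 0 1)) {α : Type*} {l : Filter α}
    {η σ : α → ℝ} {h s : ℝ} (hs : s ∈ Icc (0 : ℝ) 1) (hη : Tendsto η l (𝓝 h))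
    (hσ : Tendsto σ l (𝓝[Icc 0 1] s)) (hX : c s + h • V s ∈ X) :
    Tendsto (fun a => c (σ a) + η a • V (σ a)) l (𝓝 (c s + h • V s)) ∧
    Tendsto (fun a => variationDensity M c V (η a) (σ a)) l (𝓝 (variationDensity M c V h s)) := by
  have h1 := (hc.continuousOn s hs).tendsto.comp hσ
  have h2 := (hV.continuousOn s hs).tendsto.comp hσ
  have h3 := (continuousOn_velocity hc s hs).tendsto.comp hσ
  have h4 := (continuousOn_velocity hV s hs).tendsto.comp hσ
  have h5 := h1.add (hη.smul h2)
  have h6 := h3.add (hη.smul h4)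
  exact ⟨h5, (tendsto_bilin (hM.tendsto_lieDeriv h2 h5 hX) h6 h6).add
    ((tendsto_bilin (hM.tendsto_apply h5 hX) h6 h4).const_mul 2)⟩

theorem IsMetric.continuousOn_variationDensity (hM : IsMetric X M) {c V : ℝ → E n}
    (hc : ContDiffOn ℝ 1 c (Icc 0 1)) (hV : ContDiffOn ℝ 1 V (Icc 0 1))
    (hX : ∀ s ∈ Icc (0 : ℝ) 1, c s ∈ X) : ContinuousOn (variationDensity M c V 0) (Icc 0 1) :=
  fun s hs => (hM.tendsto_variationDensity hc hV hs tendsto_const_nhds tendsto_id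
    (by simpa using hX s hs)).2

/-- By compactness of [0, 1], small variations remain in `X` and their densities are bounded
uniformly: the domination needed to differentiate under the integral. -/
theorem IsMetric.exists_variation_bound (hM : IsMetric X M) {c V : ℝ → E n}
    (hc : ContDiffOn ℝ 1 c (Icc 0 1)) (hV : ContDiffOn ℝ 1 V (Icc 0 1))
    (hX : ∀ s ∈ Icc (0 : ℝ) 1, c s ∈ X) :
    ∃ C, ∃ δ > 0, ∀ h ∈ Metric.ball (0 : ℝ) δ, ∀ s ∈ Icc (0 : ℝ) 1,
      c s + h • V s ∈ X ∧ |variationDensity M c V h s| ≤ C := by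
  obtain ⟨C, hC⟩ := isCompact_Icc.exists_bound_of_continuousOn
    (hM.continuousOn_variationDensity hc hV hX)
  -- The compactness principle asks for full neighbourhoods in the product, but the density is
  -- controlled only for s in [0, 1]; the repeated membership cuts those neighbourhoods down.
  have key : ∀ᶠ h in 𝓝 (0 : ℝ), ∀ s ∈ Icc (0 : ℝ) 1, s ∈ Icc (0 : ℝ) 1 →
      c s + h • V s ∈ X ∧ |variationDensity M c V h s| ≤ C + 1 := by
    refine isCompact_Icc.eventually_forall_of_forall_eventually fun s hs => ?_
    have h1 : Tendsto (fun z : ℝ × ℝ => z.1) (𝓝[{z | z.2 ∈ Icc (0 : ℝ) 1}] (0, s)) (𝓝 0) :=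
      continuousAt_fst.mono_left nhdsWithin_le_nhds
    have h2 : Tendsto (fun z : ℝ × ℝ => z.2) (𝓝[{z | z.2 ∈ Icc (0 : ℝ) 1}] (0, s))
        (𝓝[Icc 0 1] s) := tendsto_nhdsWithin_iff.2
      ⟨continuousAt_snd.mono_left nhdsWithin_le_nhds, self_mem_nhdsWithin⟩
    have hX0 : c s + (0 : ℝ) • V s ∈ X := by simpa using hX s hs
    obtain ⟨h3, h4⟩ := hM.tendsto_variationDensity hc hV hs h1 h2 hX0
    have h5 : |variationDensity M c V 0 s| < C + 1 := (hC s hs).trans_lt (lt_add_one C)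
    exact eventually_nhdsWithin_iff.1 ((h3.eventually (hM.isOpen.mem_nhds hX0)).and
      ((h4.abs.eventually_lt_const h5).mono fun _ h => h.le))
  obtain ⟨δ, hδ, hball⟩ := Metric.eventually_nhds_iff_ball.1 key
  exact ⟨C + 1, δ, hδ, fun h hh s hs => hball h hh s hs hs⟩

theorem hasDerivWithinAt_variation {c V : ℝ → E n} (hc : ContDiffOn ℝ 1 c (Icc 0 1))
    (hV : ContDiffOn ℝ 1 V (Icc 0 1)) (h : ℝ) {s : ℝ} (hs : s ∈ Icc (0 : ℝ) 1) :
    HasDerivWithinAt (fun s => c s + h • V s) (velocity c s + h • velocity V s) (Icc 0 1) s :=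
  (hasDerivWithinAt_velocity hc hs).add ((hasDerivWithinAt_velocity hV hs).const_smul h)

theorem IsMetric.continuousOn_variation (hM : IsMetric X M) {c V : ℝ → E n}
    (hc : ContDiffOn ℝ 1 c (Icc 0 1)) (hV : ContDiffOn ℝ 1 V (Icc 0 1)) {h : ℝ}
    (hX : ∀ s ∈ Icc (0 : ℝ) 1, c s + h • V s ∈ X) :
    ContinuousOn (fun s => bilin (M (c s + h • V s)) (velocity c s + h • velocity V s)
      (velocity c s + h • velocity V s)) (Icc 0 1) := by
  have h1 : ContinuousOn (fun s => c s + h • V s) (Icc 0 1) :=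
    hc.continuousOn.add (hV.continuousOn.const_smul h)
  have h2 : ContinuousOn (fun s => velocity c s + h • velocity V s) (Icc 0 1) :=
    (continuousOn_velocity hc).add ((continuousOn_velocity hV).const_smul h)
  exact continuousOn_bilin (hM.comp_continuousOn h1 hX) h2 h2

theorem IsMetric.hasDerivAt_variationEnergy (hM : IsMetric X M) {c V : ℝ → E n}
    (hc : ContDiffOn ℝ 1 c (Icc 0 1)) (hV : ContDiffOn ℝ 1 V (Icc 0 1))
    (hX : ∀ s ∈ Icc (0 : ℝ) 1, c s ∈ X) :
    HasDerivAt (variationEnergy M c V) (∫ s in (0 : ℝ)..1, variationDensity M c V 0 s) 0 := by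
  obtain ⟨C, δ, hδ, hC⟩ := hM.exists_variation_bound hc hV hX
  have hsub : uIoc (0 : ℝ) 1 ⊆ Icc 0 1 := by
    rw [uIoc_of_le zero_le_one]; exact Ioc_subset_Icc_self
  have hmeas : ∀ {f : ℝ → ℝ}, ContinuousOn f (Icc 0 1) → MeasureTheory.AEStronglyMeasurable f
      (MeasureTheory.volume.restrict (uIoc (0 : ℝ) 1)) := fun hf =>
    (hf.mono hsub).aestronglyMeasurable measurableSet_uIoc
  refine (intervalIntegral.hasDerivAt_integral_of_dominated_loc_of_deriv_le
    (F := fun h s => bilin (M (c s + h • V s)) (velocity c s + h • velocity V s)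
      (velocity c s + h • velocity V s)) (F' := variationDensity M c V) (bound := fun _ => C)
    (Metric.ball_mem_nhds 0 hδ) ?_ ?_ ?_ ?_ (by simp) ?_).2
  · filter_upwards [Metric.ball_mem_nhds 0 hδ] with h hh
    exact hmeas (hM.continuousOn_variation hc hV fun s hs => (hC h hh s hs).1)
  · refine ContinuousOn.intervalIntegrable ?_
    rw [uIcc_of_le zero_le_one]
    exact hM.continuousOn_variation hc hV
      fun s hs => (hC 0 (Metric.mem_ball_self hδ) s hs).1
  · exact hmeas (hM.continuousOn_variationDensity hc hV hX)
  · exact Eventually.of_forall fun s hs h hh => (hC h hh s (hsub hs)).2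
  · refine Eventually.of_forall fun s hs h hh => ?_
    have hXh := (hC h hh s (hsub hs)).1
    rw [← hasDerivWithinAt_univ]
    have h1 : HasDerivWithinAt (fun h : ℝ => c s + h • V s) (V s) univ h := by
      exact (hasDerivAt_add_smul _ _ h).hasDerivWithinAt
    have h2 : HasDerivWithinAt (fun h : ℝ => velocity c s + h • velocity V s) (velocity V s)
        univ h := by
      exact (hasDerivAt_add_smul _ _ h).hasDerivWithinAt
    refine (hasDerivWithinAt_bilin (hM.hasDerivWithinAt_comp h1 hXh) h2 h2).congr_deriv ?_
    rw [variationDensity, bilin_comm (posDef_transpose (hM.posDef _ hXh)) (velocity V s)]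
    ring

/-- The arithmetic-geometric mean inequality bounds the length of a variation by its energy. -/
theorem IsMetric.length_variation_le (hM : IsMetric X M) {c V : ℝ → E n}
    (hc : ContDiffOn ℝ 1 c (Icc 0 1)) (hV : ContDiffOn ℝ 1 V (Icc 0 1)) {h : ℝ}
    (hX : ∀ s ∈ Icc (0 : ℝ) 1, c s + h • V s ∈ X) {d : ℝ} (hd : 0 < d) :
    IsCurve X (c 0 + h • V 0) (c 1 + h • V 1) (fun s => c s + h • V s) ∧
    length M (fun s => c s + h • V s) ≤ (variationEnergy M c V h + d ^ 2) / (2 * d) := by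
  have hcurve : IsCurve X (c 0 + h • V 0) (c 1 + h • V 1) (fun s => c s + h • V s) :=
    ⟨hc.add (hV.const_smul h), hX, rfl, rfl⟩
  refine ⟨hcurve, ?_⟩
  have hcont := hM.continuousOn_variation hc hV hX
  have hint : IntervalIntegrable (fun s => bilin (M (c s + h • V s))
      (velocity c s + h • velocity V s) (velocity c s + h • velocity V s))
      MeasureTheory.volume 0 1 :=
    ContinuousOn.intervalIntegrable (by rwa [uIcc_of_le zero_le_one])
  have h1 : (variationEnergy M c V h + d ^ 2) / (2 * d) = ∫ s in (0 : ℝ)..1,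
      (bilin (M (c s + h • V s)) (velocity c s + h • velocity V s)
        (velocity c s + h • velocity V s) + d ^ 2) / (2 * d) := by
    rw [intervalIntegral.integral_div, intervalIntegral.integral_add hint (by simp)]
    simp [variationEnergy]
  rw [h1, length]
  refine intervalIntegral.integral_mono_on zero_le_one
    (hM.intervalIntegrable_speed hcurve.contDiff hX)
    ((hint.add (by simp)).div_const _) fun s hs => ?_
  have h2 := speed_sq (c := fun s => c s + h • V s) hM (hX s hs)
  rw [velocity_eq hs (hasDerivWithinAt_variation hc hV h hs)] at h2
  rw [← h2, le_div_iff₀ (by positivity)]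
  nlinarith [sq_nonneg (speed M (fun s => c s + h • V s) s - d)]

/-- Constant speed is the equality case of the arithmetic-geometric mean bound of length by energy.
-/
theorem variationEnergy_zero (hM : IsMetric X M) {p q : E n} {γ : ℝ → E n}
    (hγ : IsMinGeodesic X M p q γ) (V : ℝ → E n) :
    variationEnergy M γ V 0 = length M γ ^ 2 := by
  have : ∀ s ∈ uIcc (0 : ℝ) 1, bilin (M (γ s + (0 : ℝ) • V s))
      (velocity γ s + (0 : ℝ) • velocity V s) (velocity γ s + (0 : ℝ) • velocity V s)
      = length M γ ^ 2 := fun s hs => by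
    rw [uIcc_of_le zero_le_one] at hs
    rw [← hγ.constSpeed s hs, speed_sq hM (hγ.curve.mem s hs)]
    simp
  rw [variationEnergy, intervalIntegral.integral_congr this]
  simp

/-- The first variation of a minimizing geodesic vanishes for fixed endpoints. -/
theorem IsMinGeodesic.integral_variationDensity_eq_zero (hM : IsMetric X M) {p q : E n}
    {γ : ℝ → E n} (hγ : IsMinGeodesic X M p q γ) (hd : 0 < length M γ) {V : ℝ → E n}
    (hV : ContDiffOn ℝ 1 V (Icc 0 1)) (hV0 : V 0 = 0) (hV1 : V 1 = 0) :
    ∫ s in (0 : ℝ)..1, variationDensity M γ V 0 s = 0 := by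
  refine IsLocalMin.hasDerivAt_eq_zero ?_
    (hM.hasDerivAt_variationEnergy hγ.curve.contDiff hV hγ.curve.mem)
  obtain ⟨C, δ, hδ, hC⟩ := hM.exists_variation_bound hγ.curve.contDiff hV hγ.curve.mem
  filter_upwards [Metric.ball_mem_nhds 0 hδ] with h hh
  obtain ⟨h1, h2⟩ := hM.length_variation_le hγ.curve.contDiff hV (fun s hs => (hC h hh s hs).1) hd
  rw [hV0, hV1, smul_zero, add_zero, add_zero, hγ.curve.source, hγ.curve.target] at h1
  -- Length is at most (energy + d²)/(2d), with equality at h = 0, so minimality of the length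
  -- passes to the energy.
  have h3 := hγ.minimal.le.trans (riemDist_le_length h1)
  rw [ENNReal.ofReal_le_ofReal_iff (length_nonneg _)] at h3
  rw [variationEnergy_zero hM hγ]
  have h4 := h3.trans h2
  rw [le_div_iff₀ (by positivity)] at h4
  linarith

theorem bilin_lieDeriv_eq_sum (M : E n → Matrix (Fin n) (Fin n) ℝ) (y x v : E n) :
    bilin (lieDeriv M y x) v v =
      ∑ i, y i * bilin (lieDeriv M (EuclideanSpace.single i 1) x) v v := by
  have : lieDeriv M y x = ∑ i, y i • lieDeriv M (EuclideanSpace.single i 1) x := by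
    ext a b
    simp only [Matrix.sum_apply, Matrix.smul_apply, lieDeriv_apply, smul_eq_mul]
    conv_lhs => rw [← euclidean_sum_single y]
    simp
  rw [this]
  simp only [bilin, Matrix.sum_mulVec, dotProduct_sum, Matrix.smul_mulVec, dotProduct_smul,
    smul_eq_mul]

theorem bilin_eq_sum_single (A : Matrix (Fin n) (Fin n) ℝ) (v w : E n) :
    bilin A v w = ∑ i, w i * bilin A v (EuclideanSpace.single i 1) := by
  conv_lhs => rw [← euclidean_sum_single w]
  simp only [bilin, WithLp.ofLp_sum, WithLp.ofLp_smul, Matrix.mulVec_sum, dotProduct_sum,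
    Matrix.mulVec_smul, dotProduct_smul, smul_eq_mul]

theorem velocity_smul_const {φ : ℝ → ℝ} (hφ : ContDiff ℝ 1 φ) (e : E n) {s : ℝ}
    (hs : s ∈ Icc (0 : ℝ) 1) : velocity (fun s => φ s • e) s = deriv φ s • e :=
  velocity_eq hs (((hφ.differentiable one_ne_zero s).hasDerivAt.smul_const e).hasDerivWithinAt)

/-- The geodesic equation: the derivative of the pairing of the momentum of a minimizing geodesic
with a vector field along it. -/
theorem IsMinGeodesic.hasDerivWithinAt_momentum (hM : IsMetric X M) {p q : E n}
    {γ : ℝ → E n} (hγ : IsMinGeodesic X M p q γ) (hd : 0 < length M γ) {V : ℝ → E n} {V' : E n}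
    {s : ℝ} (hs : s ∈ Icc (0 : ℝ) 1) (hV : HasDerivWithinAt V V' (Icc 0 1) s) :
    HasDerivWithinAt (fun s => bilin (M (γ s)) (velocity γ s) (V s))
      (bilin (lieDeriv M (V s) (γ s)) (velocity γ s) (velocity γ s) / 2
        + bilin (M (γ s)) (velocity γ s) V') (Icc 0 1) s := by
  have hvc := continuousOn_velocity hγ.curve.contDiff
  have hbasic : ∀ e : E n, HasDerivWithinAt (fun s => bilin (M (γ s)) (velocity γ s) e)
      (bilin (lieDeriv M e (γ s)) (velocity γ s) (velocity γ s) / 2) (Icc 0 1) s := by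
    intro e
    -- Test fields φ e with constant e give a weak form of the geodesic equation; du Bois-Reymond
    -- then yields differentiability of the momentum, although γ is only assumed C¹.
    have hdbr : HasDerivWithinAt (fun s => 2 * bilin (M (γ s)) (velocity γ s) e)
        (bilin (lieDeriv M e (γ s)) (velocity γ s) (velocity γ s)) (Icc 0 1) s := by
      refine hasDerivWithinAt_of_integral_eq_zero
        (u := fun s => 2 * bilin (M (γ s)) (velocity γ s) e)
        (r := fun s => bilin (lieDeriv M e (γ s)) (velocity γ s) (velocity γ s)) ?_ ?_ ?_ hs
      · exact continuousOn_const.mul (continuousOn_bilin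
          (hM.comp_continuousOn hγ.curve.contDiff.continuousOn hγ.curve.mem) hvc continuousOn_const)
      · exact continuousOn_bilin (fun i j t ht => hM.tendsto_lieDeriv tendsto_const_nhds
          (hγ.curve.contDiff.continuousOn t ht) (hγ.curve.mem t ht) i j) hvc hvc
      · intro φ hφ h0 h1
        have hVC : ContDiff ℝ 1 fun s => φ s • e := hφ.smul (contDiff_const (c := e))
        refine Eq.trans ?_ (hγ.integral_variationDensity_eq_zero hM hd (V := fun s => φ s • e)
          hVC.contDiffOn (by simp [h0]) (by simp [h1]))
        refine intervalIntegral.integral_congr fun t ht => ?_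
        rw [uIcc_of_le zero_le_one] at ht
        have h2 : lieDeriv M (φ t • e) (γ t) = φ t • lieDeriv M e (γ t) := by
          ext i j
          simp [lieDeriv_apply]
        simp only [variationDensity, zero_smul, add_zero, velocity_smul_const hφ e ht, h2,
          bilin_smul_matrix, bilin_smul_right]
        ring
    exact ((hdbr.div_const 2).congr_of_mem (fun t _ => by ring) hs)
  have hV' : ∀ i, HasDerivWithinAt (fun r => V r i) (V' i) (Icc 0 1) s := fun i =>
    (EuclideanSpace.proj (𝕜 := ℝ) i).hasFDerivAt.comp_hasDerivWithinAt s hV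
  have heq : (fun s => bilin (M (γ s)) (velocity γ s) (V s)) = fun s =>
      ∑ i, V s i * bilin (M (γ s)) (velocity γ s) (EuclideanSpace.single i 1) :=
    funext fun s => bilin_eq_sum_single _ _ _
  rw [heq, bilin_eq_sum_single (M (γ s)) _ V', bilin_lieDeriv_eq_sum]
  refine (HasDerivWithinAt.fun_sum fun i _ => (hV' i).mul
    (hbasic (EuclideanSpace.single i 1))).congr_deriv ?_
  rw [Finset.sum_div, ← Finset.sum_add_distrib]
  refine Finset.sum_congr rfl fun i _ => ?_
  ring

/-- First variation: moving the endpoints of a minimizing geodesic. -/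
theorem IsMinGeodesic.eventually_riemDist_le (hM : IsMetric X M) {p q : E n}
    {γ : ℝ → E n} (hγ : IsMinGeodesic X M p q γ) (hd : 0 < length M γ) (a b : E n) {η : ℝ}
    (hη : 0 < η) : ∀ᶠ h in 𝓝[>] (0 : ℝ), riemDist X M (p + h • a) (q + h • b) ≤
      ENNReal.ofReal (length M γ + h * ((bilin (M q) (velocity γ 1) b
        - bilin (M p) (velocity γ 0) a) / length M γ + η)) := by
  set d := length M γ with hdd
  -- The affine field with the prescribed endpoint velocities a and b. By the geodesic equation its
  -- variation density is the derivative of twice the pairing of V with the momentum, so only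
  -- boundary terms remain.
  set V : ℝ → E n := fun s => a + s • (b - a) with hVdef
  have hV : ContDiff ℝ 1 V := by fun_prop
  have hVder : ∀ s, HasDerivAt V (b - a) s := hasDerivAt_add_smul a (b - a)
  have hder := hM.hasDerivAt_variationEnergy hγ.curve.contDiff hV.contDiffOn hγ.curve.mem
  have hval : ∫ s in (0 : ℝ)..1, variationDensity M γ V 0 s =
      2 * (bilin (M q) (velocity γ 1) b - bilin (M p) (velocity γ 0) a) := by
    have hmom := fun s (hs : s ∈ Icc (0 : ℝ) 1) => (hγ.hasDerivWithinAt_momentum hM hd hs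
      (hVder s).hasDerivWithinAt).const_mul 2
    have hcont := hM.continuousOn_variationDensity hγ.curve.contDiff hV.contDiffOn hγ.curve.mem
    rw [intervalIntegral.integral_eq_sub_of_hasDerivAt_of_le zero_le_one
      (fun s hs => (hmom s hs).continuousWithinAt) (fun s hs => ?_)
      (ContinuousOn.intervalIntegrable (by rwa [uIcc_of_le zero_le_one]))]
    · simp only [hγ.curve.source, hγ.curve.target, hVdef]
      simp only [zero_smul, one_smul, add_zero, add_sub_cancel]
      ring
    · have hs' := Ioo_subset_Icc_self hs
      refine ((hmom s hs').hasDerivAt (Icc_mem_nhds hs.1 hs.2)).congr_deriv ?_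
      have : velocity V s = b - a := velocity_eq hs' (hVder s).hasDerivWithinAt
      simp only [variationDensity, zero_smul, add_zero, this]
      ring
  rw [hval] at hder
  obtain ⟨C, δ, hδ, hC⟩ := hM.exists_variation_bound hγ.curve.contDiff hV.contDiffOn hγ.curve.mem
  -- The tolerance 2dη becomes η after division by 2d in the bound of length by energy.
  have hlin := eventually_norm_sub_le_of_hasDerivWithinAt (hder.hasDerivWithinAt (s := Ici 0))
    (δ := 2 * d * η) (by positivity)
  filter_upwards [hlin, mem_nhdsWithin_of_mem_nhds (Metric.ball_mem_nhds 0 hδ)] with h h1 h2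
  obtain ⟨h3, h4⟩ := hM.length_variation_le hγ.curve.contDiff hV.contDiffOn
    (fun s hs => (hC h h2 s hs).1) hd
  have hV0 : V 0 = a := by simp [hVdef]
  have hV1 : V 1 = b := by simp [hVdef]
  rw [hV0, hV1, hγ.curve.source, hγ.curve.target] at h3
  refine (riemDist_le_length h3).trans (ENNReal.ofReal_le_ofReal (h4.trans ?_))
  rw [zero_add, variationEnergy_zero hM hγ, ← hdd] at h1
  have h5 := (abs_le.1 ((Real.norm_eq_abs _).symm.le.trans h1)).2
  rw [div_le_iff₀ (by positivity)]
  simp only [smul_eq_mul] at h5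
  field_simp
  linarith

end Geodesic

/-! ### Differentiating the inverse of a matrix -/

section Inverse

variable {n : ℕ} {X : Set (E n)}

theorem contDiffOn_det {A : E n → Matrix (Fin n) (Fin n) ℝ}
    (hA : ∀ i j, ContDiffOn ℝ 1 (fun x => A x i j) X) : ContDiffOn ℝ 1 (fun x => (A x).det) X := by
  simp only [Matrix.det_apply']
  exact ContDiffOn.sum fun σ _ => contDiffOn_const.mul (contDiffOn_prod fun i _ => hA _ _)

/-- By Cramer's rule the entries of the inverse are quotients of determinants. -/
theorem contDiffOn_inv {A : E n → Matrix (Fin n) (Fin n) ℝ}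
    (hA : ∀ i j, ContDiffOn ℝ 1 (fun x => A x i j) X) (hdet : ∀ x ∈ X, (A x).det ≠ 0)
    (i j : Fin n) : ContDiffOn ℝ 1 (fun x => (A x)⁻¹ i j) X := by
  have h : ∀ x, (A x)⁻¹ i j = ((A x).det)⁻¹ * ((A x).updateRow j (Pi.single i 1)).det := fun x => by
    rw [Matrix.inv_def, Ring.inverse_eq_inv', Matrix.smul_apply, Matrix.adjugate_apply, smul_eq_mul]
  simp only [h]
  refine ((contDiffOn_det hA).inv hdet).mul (contDiffOn_det fun k l => ?_)
  by_cases hk : k = j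
  · subst hk
    simp only [Matrix.updateRow_self]
    exact contDiffOn_const
  · simp only [Matrix.updateRow_ne hk]
    exact hA k l

theorem hasDerivAt_comp_line {Q : E n → Matrix (Fin n) (Fin n) ℝ} {x : E n} (y : E n) {i j : Fin n}
    (hQ : DifferentiableAt ℝ (fun z => Q z i j) x) :
    HasDerivAt (fun r : ℝ => Q (x + r • y) i j) (lieDeriv Q y x i j) 0 := by
  have h : HasFDerivAt (fun z => Q z i j) (fderiv ℝ (fun z => Q z i j) x) (x + (0 : ℝ) • y) := by
    simpa using hQ.hasFDerivAt
  rw [lieDeriv_apply]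
  exact h.comp_hasDerivAt 0 (hasDerivAt_add_smul x y 0)

/-- Differentiate A⁻¹A = 1 along the line x + r y. -/
theorem lieDeriv_inv {A : E n → Matrix (Fin n) (Fin n) ℝ} (hX : IsOpen X)
    (hA : ∀ i j, ContDiffOn ℝ 1 (fun x => A x i j) X) (hdet : ∀ x ∈ X, (A x).det ≠ 0)
    {x : E n} (hx : x ∈ X) (y : E n) :
    lieDeriv (fun x => (A x)⁻¹) y x = -((A x)⁻¹ * lieDeriv A y x * (A x)⁻¹) := by
  have hd : ∀ {f : E n → ℝ}, ContDiffOn ℝ 1 f X → DifferentiableAt ℝ f x := fun hf =>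
    (hf.contDiffAt (hX.mem_nhds hx)).differentiableAt one_ne_zero
  have key : lieDeriv (fun x => (A x)⁻¹) y x * A x + (A x)⁻¹ * lieDeriv A y x = 0 := by
    ext i j
    have h1 : HasDerivAt (fun r : ℝ => ((A (x + r • y))⁻¹ * A (x + r • y)) i j)
        ((lieDeriv (fun x => (A x)⁻¹) y x * A x + (A x)⁻¹ * lieDeriv A y x) i j) 0 := by
      simp only [Matrix.mul_apply, Matrix.add_apply]
      refine (HasDerivAt.fun_sum fun k _ =>
        (hasDerivAt_comp_line (Q := fun x => (A x)⁻¹) y (hd (contDiffOn_inv hA hdet i k))).mul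
        (hasDerivAt_comp_line y (hd (hA k j)))).congr_deriv ?_
      simp [Finset.sum_add_distrib]
    have h2 : (fun r : ℝ => ((A (x + r • y))⁻¹ * A (x + r • y)) i j) =ᶠ[𝓝 0]
        fun _ => (1 : Matrix (Fin n) (Fin n) ℝ) i j := by
      have hc : Continuous fun r : ℝ => x + r • y := by fun_prop
      filter_upwards [hc.continuousAt.eventually (hX.mem_nhds (by simpa using hx))] with r hr
      rw [Matrix.nonsing_inv_mul _ (Ne.isUnit (hdet _ hr))]
    exact h1.unique ((hasDerivAt_const _ _).congr_of_eventuallyEq h2)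
  have h3 : lieDeriv (fun x => (A x)⁻¹) y x * (A x * (A x)⁻¹) =
      -((A x)⁻¹ * lieDeriv A y x * (A x)⁻¹) := by
    rw [← Matrix.mul_assoc, eq_neg_of_add_eq_zero_left key, Matrix.neg_mul]
  rwa [Matrix.mul_nonsing_inv _ (Ne.isUnit (hdet x hx)), Matrix.mul_one] at h3

theorem continuousAt_lieDeriv {Q : E n → Matrix (Fin n) (Fin n) ℝ} (hX : IsOpen X)
    {i j : Fin n} (hQ : ContDiffOn ℝ 1 (fun z => Q z i j) X) {u : E n → E n} {x : E n} (hx : x ∈ X)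
    (hu : ContinuousAt u x) :
    ContinuousAt (fun z => lieDeriv Q (u z) z i j) x := by
  simp only [lieDeriv_apply]
  exact tendsto_clm_apply
    ((hQ.continuousOn_fderiv_of_isOpen hX le_rfl).continuousAt (hX.mem_nhds hx)) hu

end Inverse

/-! ### Quadratic forms that vanish on a kernel of locally constant dimension -/

section KernelBound

theorem norm_mulVec_le_sum {a b : ℕ} (A : Matrix (Fin a) (Fin b) ℝ) (v : Fin b → ℝ) :
    ‖A *ᵥ v‖ ≤ (∑ i, ∑ j, |A i j|) * ‖v‖ := by
  refine (pi_norm_le_iff_of_nonneg (by positivity)).2 fun i => ?_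
  have h1 : ‖(A *ᵥ v) i‖ ≤ (∑ j, |A i j|) * ‖v‖ := by
    rw [Matrix.mulVec, dotProduct, Finset.sum_mul]
    refine (norm_sum_le _ _).trans (Finset.sum_le_sum fun j _ => ?_)
    rw [norm_mul, Real.norm_eq_abs]
    exact mul_le_mul_of_nonneg_left (norm_le_pi_norm v j) (abs_nonneg _)
  refine h1.trans (mul_le_mul_of_nonneg_right ?_ (norm_nonneg _))
  exact Finset.single_le_sum (f := fun i => ∑ j, |A i j|)
    (fun i _ => Finset.sum_nonneg fun _ _ => abs_nonneg _) (Finset.mem_univ i)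

theorem abs_dotProduct_mulVec_le {a : ℕ} (A : Matrix (Fin a) (Fin a) ℝ) (v w : Fin a → ℝ) :
    |v ⬝ᵥ (A *ᵥ w)| ≤ (∑ i, ∑ j, |A i j|) * ‖v‖ * ‖w‖ := by
  simp only [dotProduct, Matrix.mulVec, Finset.mul_sum, Finset.sum_mul]
  refine (Finset.abs_sum_le_sum_abs _ _).trans (Finset.sum_le_sum fun i _ => ?_)
  refine (Finset.abs_sum_le_sum_abs _ _).trans (Finset.sum_le_sum fun j _ => ?_)
  rw [abs_mul, abs_mul]
  have h1 : |v i| ≤ ‖v‖ := norm_le_pi_norm v i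
  have h2 : |w j| ≤ ‖w‖ := norm_le_pi_norm w j
  calc |v i| * (|A i j| * |w j|) ≤ ‖v‖ * (|A i j| * ‖w‖) := by gcongr
    _ = _ := by ring

variable {n m k : ℕ}

theorem IsAnnihilatorBasis.exists_mulVec_eq {B : Matrix (Fin n) (Fin m) ℝ}
    {P : Matrix (Fin n) (Fin k) ℝ} (h : IsAnnihilatorBasis B P) {v : Fin n → ℝ}
    (hv : Bᵀ *ᵥ v = 0) : ∃ a, P *ᵥ a = v := by
  have : v ∈ LinearMap.ker Bᵀ.mulVecLin := LinearMap.mem_ker.2 hv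
  rw [← h.2, ← Matrix.range_mulVecLin] at this
  simpa using this

theorem IsAnnihilatorBasis.finrank_ker {B : Matrix (Fin n) (Fin m) ℝ}
    {P : Matrix (Fin n) (Fin k) ℝ} (h : IsAnnihilatorBasis B P) :
    Module.finrank ℝ (LinearMap.ker Bᵀ.mulVecLin) = k := by
  rw [← h.2, finrank_span_eq_card h.1, Fintype.card_fin]

theorem dotProduct_mulVec_conj (P : Matrix (Fin n) (Fin k) ℝ) (A : Matrix (Fin n) (Fin n) ℝ)
    (a : Fin k → ℝ) : (P *ᵥ a) ⬝ᵥ (A *ᵥ (P *ᵥ a)) = a ⬝ᵥ ((Pᵀ * A * P) *ᵥ a) := by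
  rw [← Matrix.mulVec_mulVec, ← Matrix.mulVec_mulVec, Matrix.dotProduct_mulVec a,
    Matrix.vecMul_transpose]

theorem tendsto_sum_abs {α : Type*} {l : Filter α} {a b : ℕ} {A : α → Matrix (Fin a) (Fin b) ℝ}
    {A₀ : Matrix (Fin a) (Fin b) ℝ} (h : ∀ i j, Tendsto (fun x => A x i j) l (𝓝 (A₀ i j))) :
    Tendsto (fun x => ∑ i, ∑ j, |A x i j|) l (𝓝 (∑ i, ∑ j, |A₀ i j|)) :=
  tendsto_finsetSum _ fun i _ => tendsto_finsetSum _ fun j _ => (h i j).abs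

/-- A symmetric form that vanishes on `ker Bᵀ` is bounded by `‖Bᵀ p‖ ‖p‖`, locally uniformly if
`ker Bᵀ` has constant dimension. -/
theorem exists_abs_form_le {Z : Set (E n)} {B : E n → Matrix (Fin n) (Fin m) ℝ}
    {P : E n → Matrix (Fin n) (Fin k) ℝ} {A : E n → Matrix (Fin n) (Fin n) ℝ} {x₀ : E n}
    (hx₀ : x₀ ∈ Z) (hB : ∀ i j, ContinuousAt (fun x => B x i j) x₀)
    (hA : ∀ i j, ContinuousAt (fun x => A x i j) x₀) (hsymm : ∀ x ∈ Z, (A x)ᵀ = A x)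
    (hP : ∀ x ∈ Z, IsAnnihilatorBasis (B x) (P x)) (h0 : ∀ x ∈ Z, (P x)ᵀ * A x * P x = 0) :
    ∃ C, 0 ≤ C ∧ ∀ᶠ x in 𝓝[Z] x₀, ∀ p : Fin n → ℝ,
      |p ⬝ᵥ (A x *ᵥ p)| ≤ C * ‖p‖ * ‖(B x)ᵀ *ᵥ p‖ := by
  -- A complement of the kernel at x₀. On it Bᵀ is bounded below, and this persists nearby with
  -- twice the constant.
  obtain ⟨R, hR⟩ := Submodule.exists_isCompl (LinearMap.ker (B x₀)ᵀ.mulVecLin)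
  have hdim : Module.finrank ℝ R + k = n := by
    have := Submodule.finrank_add_eq_of_isCompl hR
    rw [(hP x₀ hx₀).finrank_ker, Module.finrank_fin_fun] at this
    omega
  have hinj : LinearMap.ker ((B x₀)ᵀ.mulVecLin.domRestrict R) = ⊥ := by
    refine LinearMap.ker_eq_bot'.2 fun a ha => ?_
    have := hR.disjoint.le_bot ⟨(show (a : Fin n → ℝ) ∈ LinearMap.ker (B x₀)ᵀ.mulVecLin from ha),
      a.2⟩
    simpa using this
  obtain ⟨κ, hκ, hanti⟩ := LinearMap.exists_antilipschitzWith _ hinj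
  have hκ' : (0 : ℝ) < κ := hκ
  have hlow : ∀ a ∈ R, ‖a‖ ≤ κ * ‖(B x₀)ᵀ *ᵥ a‖ := fun a ha => by
    have := hanti.le_mul_norm_sub ⟨a, ha⟩ 0
    rw [map_zero, add_zero, add_zero, norm_neg, norm_neg] at this
    exact this
  set σ : ℝ := (∑ i, ∑ j, |A x₀ i j|) + 1
  set β : ℝ := (∑ i, ∑ j, |(B x₀)ᵀ i j|) + 1
  have hσ : 0 ≤ σ := by positivity
  have hβ : 0 ≤ β := by positivity
  refine ⟨σ * (2 * (2 * κ) + (2 * κ) ^ 2 * β), by positivity, ?_⟩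
  have t1 : ∀ᶠ x in 𝓝 x₀, ∑ i, ∑ j, |A x i j| < σ :=
    (tendsto_sum_abs hA).eventually_lt_const (lt_add_one _)
  have t2 : ∀ᶠ x in 𝓝 x₀, ∑ i, ∑ j, |(B x)ᵀ i j| < β :=
    (tendsto_sum_abs fun i j => hB j i).eventually_lt_const (lt_add_one _)
  have t3 : ∀ᶠ x in 𝓝 x₀, ∑ i, ∑ j, |((B x₀)ᵀ - (B x)ᵀ) i j| < 1 / (2 * κ) := by
    have := tendsto_sum_abs (A := fun x => (B x₀)ᵀ - (B x)ᵀ) (A₀ := 0) (l := 𝓝 x₀) fun i j => by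
      have h := (hB j i).tendsto.const_sub (B x₀ j i)
      rw [sub_self] at h
      exact h
    simp only [Matrix.zero_apply, abs_zero, Finset.sum_const_zero] at this
    exact this.eventually_lt_const (by positivity)
  filter_upwards [nhdsWithin_le_nhds t1, nhdsWithin_le_nhds t2, nhdsWithin_le_nhds t3,
    self_mem_nhdsWithin] with x h1 h2 h3 hx p
  have hlow' : ∀ a ∈ R, ‖a‖ ≤ 2 * κ * ‖(B x)ᵀ *ᵥ a‖ := fun a ha => by
    have e1 := hlow a ha
    have e2 : ‖(B x₀)ᵀ *ᵥ a‖ ≤ ‖(B x)ᵀ *ᵥ a‖ + 1 / (2 * κ) * ‖a‖ := by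
      have : (B x₀)ᵀ *ᵥ a = (B x)ᵀ *ᵥ a + ((B x₀)ᵀ - (B x)ᵀ) *ᵥ a := by
        rw [Matrix.sub_mulVec]; abel
      rw [this]
      refine (norm_add_le _ _).trans (add_le_add le_rfl ((norm_mulVec_le_sum _ _).trans ?_))
      exact mul_le_mul_of_nonneg_right h3.le (norm_nonneg _)
    have e3 := e1.trans (mul_le_mul_of_nonneg_left e2 hκ'.le)
    have e4 : (κ : ℝ) * (1 / (2 * κ) * ‖a‖) = ‖a‖ / 2 := by field_simp
    linarith
  -- The lower bound makes R transversal to the kernel at x, and the constant kernel dimension k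
  -- makes the dimensions add up, so R is still a complement. The bases P(x) need not vary
  -- continuously.
  have htop : R ⊔ LinearMap.ker (B x)ᵀ.mulVecLin = ⊤ := by
    refine Submodule.eq_top_of_disjoint _ _ ?_ ?_
    · rw [(hP x hx).finrank_ker, hdim, Module.finrank_fin_fun]
    · rw [Submodule.disjoint_def]
      intro a ha hk
      have hk' : (B x)ᵀ *ᵥ a = 0 := LinearMap.mem_ker.1 hk
      have := hlow' a ha
      rw [hk'] at this
      simpa using this
  obtain ⟨a, ha, ν, hν, rfl⟩ := Submodule.mem_sup.1 (htop ▸ Submodule.mem_top : p ∈ _)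
  have hν' : (B x)ᵀ *ᵥ ν = 0 := LinearMap.mem_ker.1 hν
  have hBp : (B x)ᵀ *ᵥ (a + ν) = (B x)ᵀ *ᵥ a := by rw [Matrix.mulVec_add, hν', add_zero]
  have hνν : ν ⬝ᵥ (A x *ᵥ ν) = 0 := by
    obtain ⟨c, rfl⟩ := (hP x hx).exists_mulVec_eq hν'
    rw [dotProduct_mulVec_conj, h0 x hx]
    simp
  have hcomm : a ⬝ᵥ (A x *ᵥ ν) = ν ⬝ᵥ (A x *ᵥ a) := by
    rw [Matrix.dotProduct_mulVec, ← Matrix.mulVec_transpose, hsymm x hx, dotProduct_comm]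
  -- Since the form vanishes at ν, every remaining term contains a, and ‖a‖ is bounded by a multiple
  -- of ‖Bᵀp‖.
  have hform : (a + ν) ⬝ᵥ (A x *ᵥ (a + ν)) = 2 * ((a + ν) ⬝ᵥ (A x *ᵥ a)) - a ⬝ᵥ (A x *ᵥ a) := by
    simp only [Matrix.mulVec_add, add_dotProduct, dotProduct_add, hνν, hcomm]
    ring
  rw [hform]
  set p := a + ν
  have e1 := abs_dotProduct_mulVec_le (A x) p a
  have e2 := abs_dotProduct_mulVec_le (A x) a a
  have e3 := hlow' a ha
  rw [← hBp] at e3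
  set b := ‖(B x)ᵀ *ᵥ p‖
  have hb : 0 ≤ b := norm_nonneg _
  have e4 : b ≤ β * ‖p‖ := (norm_mulVec_le_sum _ _).trans
    (mul_le_mul_of_nonneg_right h2.le (norm_nonneg _))
  have e1' : |p ⬝ᵥ (A x *ᵥ a)| ≤ σ * ‖p‖ * (2 * κ * b) := e1.trans (by gcongr)
  have e2' : |a ⬝ᵥ (A x *ᵥ a)| ≤ σ * (2 * κ * b) * (2 * κ * b) := e2.trans (by gcongr)
  have e5 : b * b ≤ β * ‖p‖ * b := mul_le_mul_of_nonneg_right e4 hb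
  calc |2 * (p ⬝ᵥ (A x *ᵥ a)) - a ⬝ᵥ (A x *ᵥ a)|
      ≤ |2 * (p ⬝ᵥ (A x *ᵥ a))| + |a ⬝ᵥ (A x *ᵥ a)| := abs_sub _ _
    _ ≤ 2 * (σ * ‖p‖ * (2 * κ * b)) + σ * (2 * κ * b) * (2 * κ * b) := by
        rw [abs_mul, abs_two]; gcongr
    _ = 2 * (σ * ‖p‖ * (2 * κ * b)) + σ * (2 * κ) ^ 2 * (b * b) := by ring
    _ ≤ 2 * (σ * ‖p‖ * (2 * κ * b)) + σ * (2 * κ) ^ 2 * (β * ‖p‖ * b) := by gcongr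
    _ = _ := by ring

end KernelBound

/-! ### The contraction conditions, carried from W at covectors to M at tangent vectors -/

namespace Setup

variable {n m N : ℕ} {S : Setup n m N}

theorem Regular.isMetric (hS : S.Regular) : IsMetric S.X S.M :=
  ⟨hS.isOpen, fun i j => (hS.smooth_M i j).of_le (by exact_mod_cast le_top), hS.posDef_M⟩

theorem Regular.projD_subset (hS : S.Regular) : S.projD ⊆ S.X := by
  rintro _ ⟨z, hz, rfl⟩
  exact (hS.domain z hz).1

theorem Regular.contDiffOn_col (hS : S.Regular) (j : Fin m) :
    ContDiffOn ℝ 1 (fun y => col (S.B y) j) S.X :=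
  contDiffOn_euclidean.2 fun i => hS.smooth_B i j

theorem Regular.det_ne_zero (hS : S.Regular) : ∀ x ∈ S.X, (S.M x).det ≠ 0 := fun x hx =>
  (hS.posDef_M x hx).det_pos.ne'

theorem Regular.W_transpose (hS : S.Regular) {x : E n} (hx : x ∈ S.X) : (S.W x)ᵀ = S.W x := by
  rw [W, Matrix.transpose_nonsing_inv, posDef_transpose (hS.posDef_M x hx)]

theorem Regular.W_mulVec (hS : S.Regular) {x : E n} (hx : x ∈ S.X) (v : Fin n → ℝ) :
    S.W x *ᵥ (S.M x *ᵥ v) = v := by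
  rw [Matrix.mulVec_mulVec, W, Matrix.nonsing_inv_mul _ (Ne.isUnit (hS.det_ne_zero x hx)),
    Matrix.one_mulVec]

/-- The covector `M(x) v`. -/
noncomputable def momentum (S : Setup n m N) (x v : E n) : E n := WithLp.toLp 2 (S.M x *ᵥ v.ofLp)

/-- For the covector p = M v one has W p = v; this and the two lemmas after it translate each term
of the dual conditions into one involving M. -/
theorem Regular.bilin_W (hS : S.Regular) {x : E n} (hx : x ∈ S.X) (v : E n) :
    bilin (S.W x) (S.momentum x v) (S.momentum x v) = bilin (S.M x) v v := by
  simp only [bilin, momentum]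
  rw [hS.W_mulVec hx, dotProduct_comm]

theorem Regular.bilin_symmetrize_W (hS : S.Regular) {x : E n} (hx : x ∈ S.X)
    (J : Matrix (Fin n) (Fin n) ℝ) (v : E n) :
    bilin (symmetrize (J * S.W x)) (S.momentum x v) (S.momentum x v) =
      2 * bilin (S.M x) v (WithLp.toLp 2 (J *ᵥ v.ofLp)) := by
  rw [bilin_symmetrize, bilin_mul,
    bilin_comm (posDef_transpose (hS.posDef_M x hx)) v]
  simp only [bilin, momentum]
  rw [hS.W_mulVec hx, dotProduct_comm]

theorem Regular.bilin_lieDeriv_W (hS : S.Regular) {x : E n} (hx : x ∈ S.X) (y v : E n) :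
    bilin (lieDeriv S.W y x) (S.momentum x v) (S.momentum x v) =
      -bilin (lieDeriv S.M y x) v v := by
  have h : lieDeriv S.W y x = -(S.W x * lieDeriv S.M y x * S.W x) :=
    lieDeriv_inv hS.isOpen hS.isMetric.contDiffOn hS.det_ne_zero hx y
  rw [h, bilin_neg_matrix, bilin_mul, bilin_mul, bilin_comm (hS.W_transpose hx)]
  simp only [bilin, momentum]
  rw [hS.W_mulVec hx, dotProduct_comm]

theorem Regular.mulVec_momentum (hS : S.Regular) {x : E n} (hx : x ∈ S.X) (v : E n) (j : Fin m) :
    ((S.B x)ᵀ *ᵥ (S.momentum x v).ofLp) j = bilin (S.M x) v (col (S.B x) j) := by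
  rw [bilin_comm (posDef_transpose (hS.posDef_M x hx))]
  rfl

theorem bilin_g (A : Matrix (Fin n) (Fin n) ℝ) (w x : E n) (u : E m) :
    bilin A w (S.g (pair x u)) = bilin A w (S.f x) + ∑ j, u j * bilin A w (col (S.B x) j) := by
  have : S.g (pair x u) = S.f x + ∑ j, u j • col (S.B x) j := by
    simp only [g]
    congr 1
    ext i
    simp [col, Matrix.mulVec, dotProduct, mul_comm]
  rw [this, bilin_add_right]
  congr 1
  simp only [bilin, WithLp.ofLp_sum, WithLp.ofLp_smul, Matrix.mulVec_sum, dotProduct_sum,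
    Matrix.mulVec_smul, dotProduct_smul, smul_eq_mul]

/-- The form of the orthogonality condition. -/
noncomputable def orthForm (S : Setup n m N) (j : Fin m) (x : E n) : Matrix (Fin n) (Fin n) ℝ :=
  lieDeriv S.W (col (S.B x) j) x - symmetrize (jac (fun y => col (S.B y) j) x * S.W x)

theorem Regular.eventually_W_transpose (hS : S.Regular) {x : E n} (hx : x ∈ S.X) :
    ∀ᶠ z in 𝓝 x, (S.W z)ᵀ = S.W z :=
  (hS.isOpen.eventually_mem hx).mono fun _ hz => hS.W_transpose hz

theorem Regular.orthForm_transpose (hS : S.Regular) (j : Fin m) {x : E n} (hx : x ∈ S.X) :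
    (S.orthForm j x)ᵀ = S.orthForm j x := by
  rw [orthForm, Matrix.transpose_sub, symmetrize_transpose,
    lieDeriv_transpose (hS.eventually_W_transpose hx)]

/-- Up to the factor -2, the right-hand side is the derivative of the pairing of the momentum with
the column B^j along a geodesic with velocity v. The orthogonality condition thus governs how Bᵀ M
γ_s evolves. -/
theorem Regular.bilin_orthForm (hS : S.Regular) (j : Fin m) {x : E n} (hx : x ∈ S.X) (v : E n) :
    bilin (S.orthForm j x) (S.momentum x v) (S.momentum x v) =
      -2 * (bilin (lieDeriv S.M (col (S.B x) j) x) v v / 2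
        + bilin (S.M x) v (fderiv ℝ (fun y => col (S.B y) j) x v)) := by
  rw [orthForm, bilin_sub_matrix, hS.bilin_lieDeriv_W hx, hS.bilin_symmetrize_W hx, jac_mulVec]
  ring

theorem Regular.continuousAt_orthForm (hS : S.Regular) (j : Fin m) {x : E n} (hx : x ∈ S.X)
    (a b : Fin n) : ContinuousAt (fun z => S.orthForm j z a b) x := by
  have hnh := hS.isOpen.mem_nhds hx
  have hW : ∀ i k, ContDiffOn ℝ 1 (fun z => S.W z i k) S.X :=
    contDiffOn_inv hS.isMetric.contDiffOn hS.det_ne_zero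
  have hWc : ∀ i k, ContinuousAt (fun z => S.W z i k) x := fun i k =>
    (hW i k).continuousOn.continuousAt hnh
  have hcol := hS.contDiffOn_col j
  have hjac : ∀ i k, ContinuousAt (fun z => jac (fun y => col (S.B y) j) z i k) x := fun i k =>
    ((EuclideanSpace.proj (𝕜 := ℝ) i).continuous.tendsto _).comp
      (tendsto_clm_apply ((hcol.continuousOn_fderiv_of_isOpen hS.isOpen le_rfl).continuousAt hnh)
        (tendsto_const_nhds (x := EuclideanSpace.single k (1 : ℝ))))
  have hmul : ∀ i k, ContinuousAt (fun z => (jac (fun y => col (S.B y) j) z * S.W z) i k) x :=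
    fun i k => by
      simp only [Matrix.mul_apply]
      exact tendsto_finsetSum _ fun l _ => (hjac i l).mul (hWc l k)
  exact (continuousAt_lieDeriv hS.isOpen (hW a b) hx
    (hcol.continuousOn.continuousAt hnh)).sub ((hmul a b).add (hmul b a))

theorem Regular.bilin_F (hS : S.Regular) {x : E n} (hx : x ∈ S.X) (v : E n) :
    bilin (S.F x) (S.momentum x v) (S.momentum x v) =
      bilin (lieDeriv S.M (S.f x) x) v v + 2 * bilin (S.M x) v (fderiv ℝ S.f x v)
        + 2 * S.rate * bilin (S.M x) v v := by
  rw [F, bilin_add_matrix, bilin_add_matrix, bilin_neg_matrix, hS.bilin_lieDeriv_W hx,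
    hS.bilin_symmetrize_W hx, jac_mulVec, bilin_smul_matrix, hS.bilin_W hx]
  ring

theorem Regular.F_transpose (hS : S.Regular) {x : E n} (hx : x ∈ S.X) : (S.F x)ᵀ = S.F x := by
  rw [F, Matrix.transpose_add, Matrix.transpose_add, Matrix.transpose_neg, symmetrize_transpose,
    lieDeriv_transpose (hS.eventually_W_transpose hx), Matrix.transpose_smul, hS.W_transpose hx]

/-! ### Feasibility of the optimization-based controller -/

section Strong

variable {k : ℕ} {Bperp : E n → Matrix (Fin n) (Fin k) ℝ} {lamCCM : ℝ}

/-- The hypothesis on v says that M v is in the null space of Bᵀ, hence M v = B_⊥ a, and the form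
becomes aᵀ C^s a. -/
theorem Regular.bilin_F_nonpos (hS : S.Regular)
    (hP : ∀ x ∈ S.projD, IsAnnihilatorBasis (S.B x) (Bperp x))
    (hC : supEig S.projD (S.Cs Bperp) ≤ (lamCCM : EReal)) (hlam : lamCCM < 0) {x : E n}
    (hx : x ∈ S.projD) {v : E n} (hv : ∀ j, bilin (S.M x) v (col (S.B x) j) = 0) :
    bilin (S.F x) (S.momentum x v) (S.momentum x v) ≤ 0 := by
  have hX := hS.projD_subset hx
  obtain ⟨a, ha⟩ := (hP x hx).exists_mulVec_eq (v := (S.momentum x v).ofLp)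
    (funext fun j => (hS.mulVec_momentum hX v j).trans (hv j))
  have hsymm : (S.Cs Bperp x)ᵀ = S.Cs Bperp x := by
    simp only [Cs, Matrix.transpose_mul, hS.F_transpose hX, Matrix.transpose_transpose,
      Matrix.mul_assoc]
  have h1 := dotProduct_mulVec_le_of_supEig hC hx hsymm a
  rw [bilin, ← ha, dotProduct_mulVec_conj]
  refine h1.trans (mul_nonpos_of_nonpos_of_nonneg hlam.le ?_)
  simpa using dotProduct_star_self_nonneg a

theorem Regular.exists_orthForm_bound (hS : S.Regular)
    (hP : ∀ x ∈ S.projD, IsAnnihilatorBasis (S.B x) (Bperp x))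
    (hO : ∀ x ∈ S.projD, S.StrongOrth Bperp x) {γ : ℝ → E n} (hγ : ContinuousOn γ (Icc 0 1))
    (hD : ∀ s ∈ Icc (0 : ℝ) 1, γ s ∈ S.projD) :
    ∃ C, 0 ≤ C ∧ ∀ s ∈ Icc (0 : ℝ) 1, ∀ j, ∀ p : Fin n → ℝ,
      |p ⬝ᵥ (S.orthForm j (γ s) *ᵥ p)| ≤ C * ‖p‖ * ‖(S.B (γ s))ᵀ *ᵥ p‖ := by
  -- The local constants are merged by compactness of [0, 1]; finitely many columns are handled by
  -- summing their constants.
  refine isCompact_Icc.induction_on (p := fun t => ∃ C, 0 ≤ C ∧ ∀ s ∈ t, ∀ j, ∀ p : Fin n → ℝ,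
      |p ⬝ᵥ (S.orthForm j (γ s) *ᵥ p)| ≤ C * ‖p‖ * ‖(S.B (γ s))ᵀ *ᵥ p‖) ?_ ?_ ?_ ?_
  · exact ⟨0, le_rfl, fun s hs => absurd hs (notMem_empty s)⟩
  · rintro t t' htt' ⟨C, hC, h⟩
    exact ⟨C, hC, fun s hs => h s (htt' hs)⟩
  · rintro t t' ⟨C, hC, h⟩ ⟨C', hC', h'⟩
    refine ⟨max C C', hC.trans (le_max_left _ _), ?_⟩
    rintro s (hs | hs) j p
    · refine (h s hs j p).trans ?_
      gcongr; exact le_max_left _ _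
    · refine (h' s hs j p).trans ?_
      gcongr; exact le_max_right _ _
  · intro s hs
    have hX := hS.projD_subset (hD s hs)
    have hnh := hS.isOpen.mem_nhds hX
    have key := fun j => exists_abs_form_le (A := S.orthForm j) (hD s hs)
      (fun a b => (hS.smooth_B a b).continuousOn.continuousAt hnh) (hS.continuousAt_orthForm j hX)
      (fun x hx => hS.orthForm_transpose j (hS.projD_subset hx)) hP (fun x hx => hO x hx j)
    choose C hC0 hC using key
    have hev : ∀ᶠ r in 𝓝[Icc 0 1] s, ∀ j, ∀ p : Fin n → ℝ,
        |p ⬝ᵥ (S.orthForm j (γ r) *ᵥ p)| ≤ C j * ‖p‖ * ‖(S.B (γ r))ᵀ *ᵥ p‖ :=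
      eventually_all.2 fun j => (tendsto_nhdsWithin_iff.2 ⟨hγ s hs,
        eventually_mem_nhdsWithin.mono hD⟩).eventually (hC j)
    refine ⟨_, hev, ∑ j, C j, Finset.sum_nonneg fun j _ => hC0 j, fun r hr j p => (hr j p).trans ?_⟩
    gcongr
    exact Finset.single_le_sum (fun j _ => hC0 j) (Finset.mem_univ j)

/-- Along a geodesic, the momentum stays in the kernel of `Bᵀ` if it ends there. -/
theorem Regular.momentum_ker (hS : S.Regular)
    (hP : ∀ x ∈ S.projD, IsAnnihilatorBasis (S.B x) (Bperp x))
    (hO : ∀ x ∈ S.projD, S.StrongOrth Bperp x) {p q : E n} {γ : ℝ → E n}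
    (hγ : IsMinGeodesic S.X S.M p q γ) (hd : 0 < length S.M γ)
    (hD : ∀ s ∈ Icc (0 : ℝ) 1, γ s ∈ S.projD)
    (h1 : ∀ j, bilin (S.M q) (velocity γ 1) (col (S.B q) j) = 0) :
    ∀ s ∈ Icc (0 : ℝ) 1, ∀ j, bilin (S.M (γ s)) (velocity γ s) (col (S.B (γ s)) j) = 0 := by
  have hγc := hγ.curve.contDiff.continuousOn
  have hX := hγ.curve.mem
  obtain ⟨C, hC0, hC⟩ := hS.exists_orthForm_bound hP hO hγc hD
  set π : ℝ → Fin n → ℝ := fun s => (S.momentum (γ s) (velocity γ s)).ofLp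
  have hπ : ContinuousOn π (Icc 0 1) := continuousOn_pi.2 fun i => by
    have hv := continuousOn_velocity hγ.curve.contDiff
    have : ∀ s, π s i = ∑ l, S.M (γ s) i l * velocity γ s l := fun s => rfl
    simp only [this]
    exact continuousOn_finsetSum _ fun l _ => (hS.isMetric.comp_continuousOn hγc hX i l).mul
      ((EuclideanSpace.proj (𝕜 := ℝ) l).continuous.comp_continuousOn hv)
  obtain ⟨K, hK⟩ := isCompact_Icc.exists_bound_of_continuousOn hπ
  set y : ℝ → Fin m → ℝ := fun s => (S.B (γ s))ᵀ *ᵥ π s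
  have hyj : ∀ s ∈ Icc (0 : ℝ) 1, ∀ j,
      y s j = bilin (S.M (γ s)) (velocity γ s) (col (S.B (γ s)) j) := fun s hs j =>
    hS.mulVec_momentum (hX s hs) _ j
  have hy' : ∀ s ∈ Icc (0 : ℝ) 1, HasDerivWithinAt y
      (fun j => -(π s ⬝ᵥ (S.orthForm j (γ s) *ᵥ π s)) / 2) (Icc 0 1) s := by
    intro s hs
    refine hasDerivWithinAt_pi.2 fun j => ?_
    have hcol := ((hS.contDiffOn_col j).contDiffAt (hS.isOpen.mem_nhds (hX s hs))).differentiableAt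
      one_ne_zero |>.hasFDerivAt.comp_hasDerivWithinAt s
        (hasDerivWithinAt_velocity hγ.curve.contDiff hs)
    refine ((hγ.hasDerivWithinAt_momentum hS.isMetric hd hs hcol).congr_of_mem
      (fun r hr => hyj r hr j) hs).congr_deriv ?_
    have := hS.bilin_orthForm j (hX s hs) (velocity γ s)
    rw [bilin] at this
    rw [this]
    simp only [Function.comp_apply]
    ring
  -- The orthogonality forms vanish on the kernel of Bᵀ, so the derivative of y = Bᵀπ is linearly
  -- bounded by y itself.
  have hbound : ∀ s ∈ Icc (0 : ℝ) 1,
      ‖fun j => -(π s ⬝ᵥ (S.orthForm j (γ s) *ᵥ π s)) / 2‖ ≤ C * K * ‖y s‖ := by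
    intro s hs
    have hK0 : 0 ≤ K := (norm_nonneg _).trans (hK s hs)
    refine (pi_norm_le_iff_of_nonneg (by positivity)).2 fun j => ?_
    rw [norm_div, norm_neg, Real.norm_eq_abs, Real.norm_two]
    have h2 := hC s hs j (π s)
    have h3 : C * ‖π s‖ * ‖y s‖ ≤ C * K * ‖y s‖ := by gcongr; exact hK s hs
    have h4 : 0 ≤ C * K * ‖y s‖ := by positivity
    have h5 := h2.trans h3
    linarith
  have hrefl : ∀ s ∈ Icc (0 : ℝ) 1, 1 - s ∈ Icc (0 : ℝ) 1 := fun s hs =>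
    ⟨by linarith [hs.2], by linarith [hs.1]⟩
  -- Time is reversed for Gronwall, because y is known to vanish at s = 1.
  have hz : ∀ s ∈ Icc (0 : ℝ) 1, HasDerivWithinAt (fun s => y (1 - s))
      (-fun j => -(π (1 - s) ⬝ᵥ (S.orthForm j (γ (1 - s)) *ᵥ π (1 - s))) / 2) (Icc 0 1) s := by
    intro s hs
    have := (hy' (1 - s) (hrefl s hs)).scomp s
      (((hasDerivAt_id s).const_sub 1).hasDerivWithinAt (s := Icc 0 1)) hrefl
    exact this.congr_deriv (by simp)
  have hzero := norm_le_gronwallBound_of_norm_deriv_right_le (δ := 0) (K := C * K) (ε := 0)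
    (f := fun s => y (1 - s))
    (fun s hs => (hz s hs).continuousWithinAt)
    (fun s hs => (hz s (Ico_subset_Icc_self hs)).mono_of_mem_nhdsWithin
      (Icc_mem_nhdsGE_of_mem hs))
    (by
      have : y 1 = 0 := funext fun j => by
        rw [hyj 1 (right_mem_Icc.2 zero_le_one), hγ.curve.target]; exact h1 j
      simp [this])
    (fun s hs => by
      rw [norm_neg, add_zero]
      exact hbound _ (hrefl s (Ico_subset_Icc_self hs)))
  intro s hs j
  have h2 := hzero (1 - s) (hrefl s hs)
  rw [gronwallBound_ε0_δ0] at h2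
  simp only [sub_sub_cancel, norm_le_zero_iff] at h2
  rw [← hyj s hs j, h2]
  rfl

/-- The optimization problem of the controller is feasible. -/
theorem Regular.exists_contracts (hS : S.Regular)
    (hP : ∀ x ∈ S.projD, IsAnnihilatorBasis (S.B x) (Bperp x))
    (hC : supEig S.projD (S.Cs Bperp) ≤ (lamCCM : EReal)) (hlam : lamCCM < 0)
    (hO : ∀ x ∈ S.projD, S.StrongOrth Bperp x) {p q : E n} {γ : ℝ → E n}
    (hγ : IsMinGeodesic S.X S.M p q γ) (hd : 0 < length S.M γ)
    (hD : ∀ s ∈ Icc (0 : ℝ) 1, γ s ∈ S.projD) (us : E m) :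
    ∃ v, S.Contracts p us q γ v := by
  simp only [Contracts]
  by_cases h1 : ∀ j, bilin (S.M q) (velocity γ 1) (col (S.B q) j) = 0
  · refine ⟨0, ?_⟩
    have hker := hS.momentum_ker hP hO hγ hd hD h1
    have h0 := hker 0 (left_mem_Icc.2 zero_le_one)
    rw [hγ.curve.source] at h0
    have hX := hγ.curve.mem
    -- All control terms drop out at both endpoints, so integrating the pairing of the momentum with
    -- f, plus a linear compensation λd²s, gives the inequality for v = 0.
    have hder : ∀ s ∈ Icc (0 : ℝ) 1, HasDerivWithinAt
        (fun s => bilin (S.M (γ s)) (velocity γ s) (S.f (γ s)) + S.rate * length S.M γ ^ 2 * s)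
        (bilin (lieDeriv S.M (S.f (γ s)) (γ s)) (velocity γ s) (velocity γ s) / 2
          + bilin (S.M (γ s)) (velocity γ s) (fderiv ℝ S.f (γ s) (velocity γ s))
          + S.rate * length S.M γ ^ 2) (Icc 0 1) s := by
      intro s hs
      have hf := (hS.smooth_f.contDiffAt (hS.isOpen.mem_nhds (hX s hs))).differentiableAt
        one_ne_zero |>.hasFDerivAt.comp_hasDerivWithinAt s
          (hasDerivWithinAt_velocity hγ.curve.contDiff hs)
      have hlin : HasDerivWithinAt (fun s => S.rate * length S.M γ ^ 2 * s)
          (S.rate * length S.M γ ^ 2) (Icc 0 1) s := by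
        simpa using ((hasDerivAt_id s).const_mul (S.rate * length S.M γ ^ 2)).hasDerivWithinAt
      exact (hγ.hasDerivWithinAt_momentum hS.isMetric hd hs hf).add hlin
    have hneg : ∀ s ∈ Icc (0 : ℝ) 1,
        bilin (lieDeriv S.M (S.f (γ s)) (γ s)) (velocity γ s) (velocity γ s) / 2
          + bilin (S.M (γ s)) (velocity γ s) (fderiv ℝ S.f (γ s) (velocity γ s))
          + S.rate * length S.M γ ^ 2 ≤ 0 := by
      intro s hs
      have h2 := hS.bilin_F_nonpos hP hC hlam (hD s hs) (hker s hs)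
      rw [hS.bilin_F (hX s hs)] at h2
      rw [← hγ.constSpeed s hs, speed_sq hS.isMetric (hX s hs)]
      linarith
    have hanti := antitoneOn_of_hasDerivWithinAt_nonpos (convex_Icc (0 : ℝ) 1)
      (fun s hs => (hder s hs).continuousWithinAt)
      (fun s hs => (hder s (interior_subset hs)).mono interior_subset)
      (fun s hs => hneg s (interior_subset hs))
    have h3 := hanti (left_mem_Icc.2 zero_le_one) (right_mem_Icc.2 zero_le_one) zero_le_one
    simp only [hγ.curve.source, hγ.curve.target, mul_one, mul_zero, add_zero] at h3
    rw [bilin_g, bilin_g]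
    simp only [h0, h1, mul_zero, Finset.sum_const_zero, add_zero]
    linarith
  · push Not at h1
    obtain ⟨j, hj⟩ := h1
    set b := bilin (S.M q) (velocity γ 1) (col (S.B q) j)
    set a := 2 * bilin (S.M p) (velocity γ 0) (S.g (pair p us)) - 2 * S.rate * length S.M γ ^ 2
      - 2 * bilin (S.M q) (velocity γ 1) (S.f q)
    -- The left-hand side is affine in the j-th control with slope 2b ≠ 0; this value attains
    -- equality.
    refine ⟨EuclideanSpace.single j (a / (2 * b)), ?_⟩
    rw [bilin_g]
    have : ∑ l, (EuclideanSpace.single j (a / (2 * b)) : E m) l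
        * bilin (S.M q) (velocity γ 1) (col (S.B q) l) = a / 2 := by
      rw [Finset.sum_eq_single j]
      · simp only [PiLp.single_apply, if_true]
        rw [show bilin (S.M q) (velocity γ 1) (col (S.B q) j) = b from rfl]
        field_simp
      · intro l _ hl
        simp [hl]
      · simp
    rw [this]
    simp only [a]
    linarith

end Strong

end Setup

theorem toLp_mulVec_eq_sum {n m : ℕ} (B : Matrix (Fin n) (Fin m) ℝ) (u : E m) :
    (WithLp.toLp 2 (B *ᵥ u.ofLp) : E n) = ∑ j, u j • col B j := by
  ext i
  simp [col, Matrix.mulVec, dotProduct, mul_comm]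

/-! ### Consequences of the estimates: metric bounds and model error -/

section Estimates

variable {n m N : ℕ} {S : Setup n m N} {est : Estimates}

theorem ValidEstimates.lo_le (hest : ValidEstimates S est) (hS : S.Regular) {x : E n}
    (hx : x ∈ S.projD) (v : E n) : est.lamLo * ‖v‖ ^ 2 ≤ bilin (S.M x) v v :=
  le_bilin_of_infEig hest.lamLo hx (posDef_transpose (hS.posDef_M x (hS.projD_subset hx))) v

theorem ValidEstimates.le_up (hest : ValidEstimates S est) (hS : S.Regular) {x : E n}
    (hx : x ∈ S.projD) (v : E n) : bilin (S.M x) v v ≤ √est.lamUp ^ 2 * ‖v‖ ^ 2 := by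
  refine (bilin_le_of_supEig hest.lamUp hx
    (posDef_transpose (hS.posDef_M x (hS.projD_subset hx))) v).trans ?_
  refine mul_le_mul_of_nonneg_right ?_ (sq_nonneg _)
  -- The sign of the upper estimate is not assumed; if it is negative, its square root is 0 by
  -- convention.
  rcases le_total 0 est.lamUp with h | h
  · rw [Real.sq_sqrt h]
  · exact h.trans (sq_nonneg _)

theorem ValidEstimates.L_nonneg (hest : ValidEstimates S est) : 0 ≤ est.L := by
  have h : (0 : EReal) ≤ lipConst S.modelError S.D :=
    le_iInf₂ fun K _ => by exact_mod_cast K.2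
  exact_mod_cast h.trans hest.lip

/-- `lipConst` is an infimum, so a Lipschitz constant within κ of it is used, with κ ‖z - z'‖ ≤ δ.
-/
theorem ValidEstimates.norm_modelError_sub_le (hest : ValidEstimates S est) {z z' : SC n m}
    (hz : z ∈ S.D) (hz' : z' ∈ S.D) :
    ‖S.modelError z - S.modelError z'‖ ≤ est.L * ‖z - z'‖ := by
  refine le_of_forall_pos_le_add fun δ hδ => ?_
  set κ : ℝ := δ / (‖z - z'‖ + 1)
  have hκ : 0 < κ := by positivity
  have h : lipConst S.modelError S.D < ((est.L + κ : ℝ) : EReal) :=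
    hest.lip.trans_lt (EReal.coe_lt_coe_iff.2 (lt_add_of_pos_right _ hκ))
  simp only [lipConst, iInf_lt_iff] at h
  obtain ⟨K, hK, hKL⟩ := h
  have h1 := hK.norm_sub_le hz hz'
  have h2 : (K : ℝ) ≤ est.L + κ := (EReal.coe_lt_coe_iff.1 hKL).le
  have h3 : κ * ‖z - z'‖ ≤ δ := by
    have h4 : κ * (‖z - z'‖ + 1) = δ := div_mul_cancel₀ _ (by positivity)
    linarith
  have h5 := mul_le_mul_of_nonneg_right h2 (norm_nonneg (z - z'))
  linarith

theorem norm_pair_sub_le (x x' : E n) (u u' : E m) :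
    ‖(pair x u : SC n m) - pair x' u'‖ ≤ ‖x - x'‖ + ‖u - u'‖ := by
  have h : (pair x u : SC n m) - pair x' u' = pair (x - x') (u - u') := rfl
  rw [h, WithLp.prod_norm_eq_of_L2]
  refine Real.sqrt_le_iff.2 ⟨by positivity, ?_⟩
  have h1 := norm_nonneg (x - x')
  have h2 := norm_nonneg (u - u')
  change ‖x - x'‖ ^ 2 + ‖u - u'‖ ^ 2 ≤ _
  nlinarith [mul_nonneg h1 h2]

/-- Compare (x, u) with (x*, u*), then with each data point. The membership hypotheses supply a data
index and r > 0, so the infimum is over a nonempty set and the data lie in `S.D`. -/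
theorem ValidEstimates.norm_modelError_le (hest : ValidEstimates S est) {x xs : E n} {u us : E m}
    (hz : (pair x u : SC n m) ∈ S.D) (hz' : (pair xs us : SC n m) ∈ S.D) :
    ‖S.modelError (pair x u)‖ ≤ est.L * (‖x - xs‖ + ‖u - us‖)
      + ⨅ i, (est.L * ‖pair xs us - S.data i‖ + S.e i) := by
  obtain ⟨i₀, hi₀⟩ := mem_iUnion.1 hz
  have : Nonempty (Fin N) := ⟨i₀⟩
  have hr : 0 < S.r := Metric.pos_of_mem_ball hi₀
  rw [← sub_le_iff_le_add']
  refine le_ciInf fun i => ?_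
  have hi : S.data i ∈ S.D := mem_iUnion.2 ⟨i, Metric.mem_ball_self hr⟩
  have h1 := hest.norm_modelError_sub_le hz hz'
  have h2 := hest.norm_modelError_sub_le hz' hi
  have h3 := mul_le_mul_of_nonneg_left (norm_pair_sub_le x xs u us) hest.L_nonneg
  have h4 : ‖S.modelError (pair x u)‖ ≤ ‖S.modelError (pair x u) - S.modelError (pair xs us)‖
      + ‖S.modelError (pair xs us) - S.modelError (S.data i)‖ + ‖S.modelError (S.data i)‖ := by
    calc ‖S.modelError (pair x u)‖ = ‖(S.modelError (pair x u) - S.modelError (pair xs us))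
          + (S.modelError (pair xs us) - S.modelError (S.data i)) + S.modelError (S.data i)‖ := by
          congr 1; abel
      _ ≤ _ := norm_add₃_le
  simp only [Setup.e]
  linarith

theorem iInf_error_nonneg (hest : ValidEstimates S est) (z : SC n m) :
    0 ≤ ⨅ i, (est.L * ‖z - S.data i‖ + S.e i) :=
  Real.iInf_nonneg fun _ => add_nonneg (mul_nonneg hest.L_nonneg (norm_nonneg _)) (norm_nonneg _)

end Estimates

/-! ### First-order contraction of the two learned closed loops -/

section StepContracts

variable {n m N : ℕ} (S : Setup n m N) (est : Estimates) (mode : Mode)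

/-- While the tracking error is in a tube inside the trusted domain, the learned closed loop
contracts infinitesimally with the contraction rate. -/
def StepContracts (xs : E n) (us : E m) (x : E n) (u : E m) : Prop :=
  ∀ ε d : ℝ, Metric.ball xs ε ⊆ S.projD → pair xs us ∈ S.D → mode.Check ε → 0 ≤ d →
    d < √est.lamLo * ε → riemDist S.X S.M xs x ≤ ENNReal.ofReal d →
    ∀ η > 0, ∀ᶠ h in 𝓝[>] (0 : ℝ),
      riemDist S.X S.M (xs + h • S.g (pair xs us)) (x + h • S.g (pair x u))
        ≤ ENNReal.ofReal ((1 - S.rate * h) * d + η * h)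

variable {S est}

theorem velocity_eq_zero_of_length_eq_zero (hS : S.Regular) {p q : E n} {γ : ℝ → E n}
    (hγ : IsMinGeodesic S.X S.M p q γ) (h : length S.M γ = 0) {s : ℝ} (hs : s ∈ Icc (0 : ℝ) 1) :
    velocity γ s = 0 := by
  by_contra hne
  have h1 := bilin_pos_of_posDef (hS.posDef_M _ (hγ.curve.mem s hs)) hne
  rw [← speed_sq hS.isMetric (hγ.curve.mem s hs), hγ.constSpeed s hs, h] at h1
  simp at h1

/-- The geodesic is too short to leave the tube, so it runs in the projected domain and the
controller's problem is feasible; its constraint is the endpoint term of the first variation. -/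
theorem stepContracts_strong (hS : S.Regular) (hest : ValidEstimates S est) {k : ℕ}
    {Bperp : E n → Matrix (Fin n) (Fin k) ℝ} {lamCCM : ℝ} (δu : ℝ)
    (hP : ∀ x ∈ S.projD, IsAnnihilatorBasis (S.B x) (Bperp x))
    (hC : supEig S.projD (S.Cs Bperp) ≤ (lamCCM : EReal)) (hlam : lamCCM < 0)
    (hO : ∀ x ∈ S.projD, S.StrongOrth Bperp x) {xs x : E n} {us u : E m}
    (hu : S.IsStrongControl xs us x u) : StepContracts S est (.strong δu) xs us x u := by
  intro ε d hball _ _ hd hdε hdist η hη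
  obtain ⟨γ, hγ, hmin⟩ := hu
  have hlo := fun y (hy : y ∈ Metric.ball xs ε) v => hest.lo_le hS (hball hy) v
  have hlen : length S.M γ ≤ d := by
    have := hγ.minimal.le.trans hdist
    rwa [ENNReal.ofReal_le_ofReal_iff hd] at this
  have hD : ∀ s ∈ Icc (0 : ℝ) 1, γ s ∈ S.projD := fun s hs =>
    hball (hS.isMetric.curve_mem_ball hγ.curve hlo (hlen.trans_lt hdε) hs)
  -- For length zero the first variation formula is unavailable. Then x = x*, every control is
  -- contracting, least effort forces u = u*, and both points move together.
  rcases (length_nonneg γ).eq_or_lt' with h0 | hpos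
  · have hε : 0 < √est.lamLo * ε := hd.trans_lt hdε
    have hx : x = xs := by
      have h1 := hS.isMetric.norm_sub_le_of_riemDist hlo le_rfl hε
        (by rw [← hγ.minimal, h0] : riemDist S.X S.M xs x ≤ ENNReal.ofReal 0)
      have h2 : 0 < √est.lamLo := Real.sqrt_pos.2 hest.lamLo_pos
      have h3 : ‖x - xs‖ ≤ 0 := by
        by_contra hcon
        push Not at hcon
        linarith [mul_pos h2 hcon]
      exact sub_eq_zero.1 (norm_le_zero_iff.1 h3)
    have hall : ∀ v, S.Contracts xs us x γ v := fun v => by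
      rw [Setup.Contracts, velocity_eq_zero_of_length_eq_zero hS hγ h0 (left_mem_Icc.2 zero_le_one),
        velocity_eq_zero_of_length_eq_zero hS hγ h0 (right_mem_Icc.2 zero_le_one), h0]
      simp
    have hu' : u = us := by
      have := (hmin ⟨us, hall us⟩).2 us (hall us)
      rw [sub_self, norm_zero] at this
      exact sub_eq_zero.1 (norm_le_zero_iff.1 this)
    subst hx hu'
    have hX : x ∈ S.X := by
      have := hγ.curve.mem 0 (left_mem_Icc.2 zero_le_one)
      rwa [hγ.curve.source] at this
    filter_upwards [(tendsto_add_smul x (S.g (pair x u))).eventually (hS.isOpen.mem_nhds hX)]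
      with h hh
    rw [riemDist_self hh]
    exact zero_le
  · have hcon := (hmin (hS.exists_contracts hP hC hlam hO hγ hpos hD us)).1
    rw [Setup.Contracts] at hcon
    filter_upwards [hγ.eventually_riemDist_le hS.isMetric hpos (S.g (pair xs us))
      (S.g (pair x u)) hη,
      eventually_one_sub_mul_nonneg S.rate, self_mem_nhdsWithin] with h h1 h2 h3
    rw [mem_Ioi] at h3
    refine h1.trans (ENNReal.ofReal_le_ofReal ?_)
    have h4 : (bilin (S.M x) (velocity γ 1) (S.g (pair x u))
        - bilin (S.M xs) (velocity γ 0) (S.g (pair xs us))) / length S.M γ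
        ≤ -S.rate * length S.M γ := by
      rw [div_le_iff₀ hpos]; linarith
    have h5 := mul_le_mul_of_nonneg_left h4 h3.le
    have h6 := mul_le_mul_of_nonneg_left hlen h2
    linarith

/-- With (x*, u*) frozen, G(y) = g(y, κ(y - x*, x*, u*)) is a C¹ field on the tube that takes the
required values at both x* and x. Its Jacobian is A + BK, so the weak condition is infinitesimal
contraction along G. -/
theorem stepContracts_weak (hS : S.Regular) (hest : ValidEstimates S est)
    {κ : E n → E n → E m → E m} {lamCCM εmax : ℝ} (ufb : ℝ → ℝ)
    (hκ : ∀ z ∈ S.D, ContDiffOn ℝ 1 (fun y => κ y z.fst z.snd)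
      {y | y ∈ Metric.ball 0 εmax ∧ z.fst + y ∈ S.X})
    (hκ0 : ∀ z ∈ S.D, κ 0 z.fst z.snd = z.snd)
    (hC : supEig (S.weakDomain εmax) (S.Cw κ) ≤ (lamCCM : EReal)) (hlam : lamCCM < 0)
    {xs x : E n} {us u : E m} (hu : u = κ (x - xs) xs us) :
    StepContracts S est (.weak ufb εmax) xs us x u := by
  intro ε d hball hz hε hd hdε hdist η hη
  have hε' : ε ≤ εmax := hε
  have hX : Metric.ball xs ε ⊆ S.X := hball.trans hS.projD_subset
  set O : Set (E n) := {y | y ∈ Metric.ball 0 εmax ∧ xs + y ∈ S.X}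
  have hO : IsOpen O := Metric.isOpen_ball.inter (hS.isOpen.preimage (by fun_prop))
  have hmem : ∀ y ∈ Metric.ball xs ε, y - xs ∈ O := fun y hy => by
    refine ⟨?_, by simpa using hX hy⟩
    rw [mem_ball_zero_iff]
    rw [mem_ball_iff_norm] at hy
    exact hy.trans_le hε'
  set G : E n → E n := fun y => S.g (pair y (κ (y - xs) xs us)) with hG
  have hGeq : ∀ y, G y = S.f y + ∑ j, κ (y - xs) xs us j • col (S.B y) j := fun y => by
    rw [← toLp_mulVec_eq_sum]; rfl
  have hκC : ContDiffOn ℝ 1 (fun y => κ (y - xs) xs us) (Metric.ball xs ε) :=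
    (hκ _ hz).comp (f := fun y => y - xs) (by fun_prop) hmem
  have hGC : ContDiffOn ℝ 1 G (Metric.ball xs ε) := by
    simp only [funext hGeq]
    exact (hS.smooth_f.mono hX).add (ContDiffOn.sum fun j _ =>
      (contDiffOn_euclidean.1 hκC j).smul ((hS.contDiffOn_col j).mono hX))
  have hfd : ∀ y ∈ Metric.ball xs ε, ∀ v, fderiv ℝ G y v = WithLp.toLp 2
      ((S.A y (κ (y - xs) xs us) + S.B y * jac (fun y => κ y xs us) (y - xs)) *ᵥ v.ofLp) := by
    intro y hy v
    have hf : HasFDerivAt S.f (fderiv ℝ S.f y) y := ((hS.smooth_f.contDiffAt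
      (hS.isOpen.mem_nhds (hX hy))).differentiableAt one_ne_zero).hasFDerivAt
    have hb : ∀ j, HasFDerivAt (fun y => col (S.B y) j) (fderiv ℝ (fun y => col (S.B y) j) y) y :=
      fun j => (((hS.contDiffOn_col j).contDiffAt
        (hS.isOpen.mem_nhds (hX hy))).differentiableAt one_ne_zero).hasFDerivAt
    have hk : HasFDerivAt (fun y => κ (y - xs) xs us)
        (fderiv ℝ (fun y => κ y xs us) (y - xs)) y := by
      have := (((hκ _ hz).contDiffAt (hO.mem_nhds (hmem y hy))).differentiableAt
        one_ne_zero).hasFDerivAt.comp (f := fun y => y - xs) y ((hasFDerivAt_id y).sub_const xs)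
      exact this.congr_fderiv (ContinuousLinearMap.comp_id _)
    have hkj : ∀ j, HasFDerivAt (fun y => κ (y - xs) xs us j)
        ((EuclideanSpace.proj j : E m →L[ℝ] ℝ).comp (fderiv ℝ (fun y => κ y xs us) (y - xs))) y :=
      fun j => (EuclideanSpace.proj (𝕜 := ℝ) j).hasFDerivAt.comp y hk
    have hGd : HasFDerivAt G (fderiv ℝ S.f y + ∑ j,
        (κ (y - xs) xs us j • fderiv ℝ (fun y => col (S.B y) j) y
          + ((EuclideanSpace.proj j : E m →L[ℝ] ℝ).comp
            (fderiv ℝ (fun y => κ y xs us) (y - xs))).smulRight (col (S.B y) j))) y := by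
      rw [funext hGeq]
      exact hf.add (HasFDerivAt.fun_sum (u := Finset.univ) fun j _ => (hkj j).smul (hb j))
    rw [hGd.fderiv, Matrix.add_mulVec, ← Matrix.mulVec_mulVec, WithLp.toLp_add,
      show jac (fun y => κ y xs us) (y - xs) *ᵥ v.ofLp =
        (fderiv ℝ (fun y => κ y xs us) (y - xs) v).ofLp from
        congrArg WithLp.ofLp (jac_mulVec (fun y => κ y xs us) (y - xs) v),
      toLp_mulVec_eq_sum (S.B y), Setup.A, Matrix.add_mulVec, Matrix.sum_mulVec, WithLp.toLp_add,
      jac_mulVec, WithLp.toLp_sum]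
    simp only [Matrix.smul_mulVec, WithLp.toLp_smul, jac_mulVec]
    simp [Finset.sum_add_distrib, add_assoc]
  have hcon : ∀ y ∈ Metric.ball xs ε, ∀ v ≠ 0, bilin (lieDeriv S.M (G y) y) v v
      + 2 * bilin (S.M y) v (fderiv ℝ G y v) + 2 * S.rate * bilin (S.M y) v v < 0 := by
    intro y hy v hv
    have hyX := hX hy
    have hq : (y - xs, (pair xs us : SC n m)) ∈ S.weakDomain εmax :=
      ⟨(hmem y hy).1, hz, by simpa using hyX⟩
    have hyx : xs + (y - xs) = y := by abel
    have hCw : S.Cw κ (y - xs, (pair xs us : SC n m)) = lieDeriv S.M (G y) y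
        + symmetrize (S.M y * (S.A y (κ (y - xs) xs us)
          + S.B y * jac (fun y => κ y xs us) (y - xs))) + (2 * S.rate) • S.M y := by
      have key : ∀ x', x' = y → lieDeriv S.M (S.g (pair x' (κ (y - xs) xs us))) x'
          + symmetrize (S.M x' * (S.A x' (κ (y - xs) xs us)
            + S.B x' * jac (fun y => κ y xs us) (y - xs))) + (2 * S.rate) • S.M x'
          = lieDeriv S.M (G y) y + symmetrize (S.M y * (S.A y (κ (y - xs) xs us)
            + S.B y * jac (fun y => κ y xs us) (y - xs))) + (2 * S.rate) • S.M y :=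
        fun x' h => by rw [h]
      exact key _ hyx
    have hsymm : ((S.Cw κ) (y - xs, (pair xs us : SC n m)))ᵀ =
        (S.Cw κ) (y - xs, (pair xs us : SC n m)) := by
      rw [hCw, Matrix.transpose_add, Matrix.transpose_add, symmetrize_transpose,
        Matrix.transpose_smul, posDef_transpose (hS.posDef_M y hyX), lieDeriv_transpose]
      exact (hS.isOpen.eventually_mem hyX).mono fun z hz => posDef_transpose (hS.posDef_M z hz)
    have h1 := bilin_le_of_supEig hC hq hsymm v
    rw [hCw, bilin_add_matrix, bilin_add_matrix, bilin_symmetrize, bilin_mul, ← hfd y hy v,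
      bilin_smul_matrix] at h1
    have h2 : lamCCM * ‖v‖ ^ 2 < 0 := mul_neg_of_neg_of_pos hlam (by positivity)
    linarith
  have hlo := fun y (hy : y ∈ Metric.ball xs ε) v => hest.lo_le hS (hball hy) v
  have hmain := hS.isMetric.riemDist_euler_le hX hest.lamLo_pos hlo hGC hcon hd hdε hdist hη
  have hGs : G xs = S.g (pair xs us) := by
    simp only [hG, sub_self]
    rw [show κ 0 xs us = us from hκ0 _ hz]
  have hGx : G x = S.g (pair x u) := by rw [hu]
  rwa [hGs, hGx] at hmain

end StepContracts

/-! ### Invariance of the tube along one edge -/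

/-- What the tube argument needs of the estimated feedback bound and of the check of the radius. -/
structure Mode.Regular (mode : Mode) : Prop where
  ubar_nonneg : ∀ t ε, 0 ≤ t → 0 ≤ ε → 0 ≤ mode.ubar t ε
  ubar_continuousOn : ∀ (ε : ℝ → ℝ) (a b : ℝ), 0 ≤ a → ContinuousOn ε (Icc a b) →
    ContinuousOn (fun t => mode.ubar t (ε t)) (Icc a b)
  isClosed_check : IsClosed {ε | mode.Check ε}

theorem Mode.regular_strong {δu : ℝ} (h : 0 ≤ δu) : (Mode.strong δu).Regular where
  ubar_nonneg _ _ _ hε := mul_nonneg hε h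
  ubar_continuousOn _ _ _ _ hε := hε.mul continuousOn_const
  isClosed_check := isClosed_univ

theorem Mode.regular_weak {ufb : ℝ → ℝ} (εmax : ℝ) (hc : ContinuousOn ufb (Ici 0))
    (h : ∀ t, 0 ≤ t → 0 ≤ ufb t) : (Mode.weak ufb εmax).Regular where
  ubar_nonneg t _ ht _ := h t ht
  ubar_continuousOn _ _ _ ha _ := hc.mono fun _ ht => ha.trans ht.1
  isClosed_check := isClosed_Iic

section Edge

variable {n m N : ℕ} {S : Setup n m N} {est : Estimates} {mode : Mode} {Q : Query n}

/-- A function that decays at most exponentially stays positive. -/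
theorem pos_of_hasDerivWithinAt_ge {f f' : ℝ → ℝ} {a b c : ℝ}
    (hf : ∀ t ∈ Icc a b, HasDerivWithinAt f (f' t) (Icc a b) t)
    (hf' : ∀ t ∈ Icc a b, -c * f t ≤ f' t) (ha : 0 < f a) {t : ℝ} (ht : t ∈ Icc a b) :
    0 < f t := by
  have hexp : ∀ t, HasDerivAt (fun t => Real.exp (c * t)) (c * Real.exp (c * t)) t := fun t => by
    have := ((hasDerivAt_id t).const_mul c).exp
    simpa [mul_comm] using this
  have hd : ∀ t ∈ Icc a b, HasDerivWithinAt (fun t => f t * Real.exp (c * t))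
      (f' t * Real.exp (c * t) + f t * (c * Real.exp (c * t))) (Icc a b) t := fun t ht =>
    (hf t ht).mul (hexp t).hasDerivWithinAt
  have hmono : MonotoneOn (fun t => f t * Real.exp (c * t)) (Icc a b) := by
    refine monotoneOn_of_hasDerivWithinAt_nonneg (convex_Icc _ _)
      (fun r hr => (hd r hr).continuousWithinAt)
      (fun r hr => (hd r (interior_subset hr)).mono interior_subset) fun r hr => ?_
    have h1 := hf' r (interior_subset hr)
    have h2 := Real.exp_pos (c * r)
    nlinarith [mul_le_mul_of_nonneg_right h1 h2.le]
  have h1 := hmono (left_mem_Icc.2 (ht.1.trans ht.2)) ht ht.1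
  have h2 : 0 < f a * Real.exp (c * a) := mul_pos ha (Real.exp_pos _)
  exact pos_of_mul_pos_left (h2.trans_le h1) (Real.exp_pos _).le

/-- The root `y = √Ē` of the solution of the energy equation. -/
theorem IsTube.exists_root (hest : ValidEstimates S est) (hmode : mode.Regular) {v : Vertex n m}
    {uc : E m} {tc : ℝ} {xc : ℝ → E n} {εc : ℝ → ℝ} (h : IsTube S est mode v uc tc xc εc)
    (hv : 0 ≤ v.time) (hpos : 0 < v.err) :
    ∃ y : ℝ → ℝ, y v.time = √est.lamLo * v.err ∧ ∀ t ∈ Icc v.time (v.time + tc),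
      0 < y t ∧ εc t = y t / √est.lamLo ∧ HasDerivWithinAt y
        (-(S.rate - est.L * (√est.lamUp / √est.lamLo)) * y t + √est.lamUp *
          ((⨅ i, (est.L * ‖pair (xc t) uc - S.data i‖ + S.e i)) + est.L * mode.ubar t (εc t)))
        (Icc v.time (v.time + tc)) t := by
  obtain ⟨en, h0, hen⟩ := h
  have hlo := hest.lamLo_pos
  -- The forcing term of the energy equation is nonnegative, so Ē decays at most exponentially and
  -- its square root is differentiable.
  have henpos : ∀ t ∈ Icc v.time (v.time + tc), 0 < en t := by
    intro t ht
    refine pos_of_hasDerivWithinAt_ge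
      (c := 2 * (S.rate - est.L * √(est.lamUp / est.lamLo))) (fun t ht => (hen t ht).1)
      (fun t ht => ?_) (by rw [h0]; positivity) ht
    rw [energyRHS]
    have h1 : 0 ≤ 2 * √(en t * est.lamUp) * ((⨅ i, (est.L * ‖pair (xc t) uc - S.data i‖ + S.e i))
        + est.L * mode.ubar t √(en t / est.lamLo)) :=
      mul_nonneg (by positivity) (add_nonneg (iInf_error_nonneg hest _) (mul_nonneg hest.L_nonneg
        (hmode.ubar_nonneg _ _ (hv.trans ht.1) (Real.sqrt_nonneg _))))
    linarith
  refine ⟨fun t => √(en t), ?_, fun t ht => ?_⟩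
  · simp only [h0]
    rw [Real.sqrt_mul hlo.le, Real.sqrt_sq hpos.le]
  · have hp := henpos t ht
    have hsp : 0 < √(en t) := Real.sqrt_pos.2 hp
    refine ⟨hsp, ?_, ?_⟩
    · rw [(hen t ht).2, Real.sqrt_div' _ hlo.le]
    · refine ((hen t ht).1.sqrt hp.ne').congr_deriv ?_
      rw [energyRHS, (hen t ht).2, Real.sqrt_mul hp.le, Real.sqrt_div' est.lamUp hlo.le]
      have h2 : en t = √(en t) * √(en t) := (Real.mul_self_sqrt hp.le).symm
      rw [div_eq_iff (by positivity)]
      linear_combination (-2 * (S.rate - est.L * (√est.lamUp / √est.lamLo))) * h2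

/-- The state of the true system is in the tube of the plan at time `t`, which is in the trusted
domain. -/
structure InTube (S : Setup n m N) (est : Estimates) (mode : Mode) (xs : E n) (us : E m) (ε t : ℝ)
    (x : E n) : Prop where
  pos : 0 < ε
  subset : Metric.ball (pair xs us) (ε + mode.ubar t ε) ⊆ S.D
  check : mode.Check ε
  riemDist_lt : riemDist S.X S.M xs x < ENNReal.ofReal (√est.lamLo * ε)

theorem ball_subset_projD {xs : E n} {us : E m} {ε ub : ℝ} (hub : 0 ≤ ub)
    (h : Metric.ball (pair xs us : SC n m) (ε + ub) ⊆ S.D) : Metric.ball xs ε ⊆ S.projD := by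
  intro y hy
  refine ⟨pair y us, h ?_, rfl⟩
  rw [mem_ball_iff_norm] at hy ⊢
  refine (norm_pair_sub_le y xs us us).trans_lt ?_
  rw [sub_self, norm_zero]
  linarith

theorem pair_mem_of_norm_lt {xs x : E n} {us u : E m} {ε ub : ℝ}
    (h : Metric.ball (pair xs us : SC n m) (ε + ub) ⊆ S.D) (hx : ‖x - xs‖ < ε)
    (hu : ‖u - us‖ ≤ ub) : (pair x u : SC n m) ∈ S.D := by
  refine h ?_
  rw [mem_ball_iff_norm]
  exact (norm_pair_sub_le x xs u us).trans_lt (by linarith)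

theorem norm_sub_lt_of_riemDist_lt (hS : S.Regular) (hest : ValidEstimates S est) {xs x : E n}
    {ε : ℝ} (hball : Metric.ball xs ε ⊆ S.projD) {d : ℝ} (hd : 0 ≤ d) (hdε : d < √est.lamLo * ε)
    (h : riemDist S.X S.M xs x ≤ ENNReal.ofReal d) :
    √est.lamLo * ‖x - xs‖ ≤ d ∧ ‖x - xs‖ < ε := by
  have h1 := hS.isMetric.norm_sub_le_of_riemDist
    (fun y hy v => hest.lo_le hS (hball hy) v) hd hdε h
  exact ⟨h1, lt_of_mul_lt_mul_left (h1.trans_lt hdε) (Real.sqrt_nonneg _)⟩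

theorem InTube.norm_sub_lt (hS : S.Regular) (hest : ValidEstimates S est) (hmode : mode.Regular)
    {xs x : E n} {us : E m} {ε t : ℝ} (ht : 0 ≤ t) (h : InTube S est mode xs us ε t x) :
    ‖x - xs‖ < ε := by
  have hball := ball_subset_projD (hmode.ubar_nonneg t ε ht h.pos.le) h.subset
  have hfin := h.riemDist_lt.ne_top
  exact (norm_sub_lt_of_riemDist_lt hS hest hball ENNReal.toReal_nonneg
    ((ENNReal.lt_ofReal_iff_toReal_lt hfin).1 h.riemDist_lt) (by rw [ENNReal.ofReal_toReal hfin])).2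

/-- The checks of an accepted extension hold at its final time, too. -/
theorem Accepted.checks (hmode : mode.Regular) {v : Vertex n m} {uc : E m} {tc : ℝ}
    {xc : ℝ → E n} {εc : ℝ → ℝ} (h : Accepted S est mode Q v uc tc xc εc) (hv : 0 ≤ v.time)
    (hε : ContinuousOn εc (Icc v.time (v.time + tc))) {t : ℝ}
    (ht : t ∈ Icc v.time (v.time + tc)) :
    Metric.ball (pair (xc t) uc) (εc t + mode.ubar t (εc t)) ⊆ S.D ∧ mode.Check (εc t) := by
  have hlt : v.time < v.time + tc := lt_add_of_pos_right _ h.edge.dwell_pos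
  -- The acceptance tests cover the half-open interval only; the final time is reached as a limit. A
  -- point of the open ball at the limit lies in the balls at nearby earlier times, so no closedness
  -- of the domain is needed.
  have hcl : t ∈ closure (Ico v.time (v.time + tc)) := by rwa [closure_Ico hlt.ne]
  have hne := mem_closure_iff_nhdsWithin_neBot.1 hcl
  have hmono : 𝓝[Ico v.time (v.time + tc)] t ≤ 𝓝[Icc v.time (v.time + tc)] t :=
    nhdsWithin_mono _ Ico_subset_Icc_self
  have hεt := (hε t ht).tendsto.mono_left hmono
  have hut := (hmode.ubar_continuousOn εc _ _ hv hε t ht).tendsto.mono_left hmono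
  have hxt := (h.edge.ode t ht).continuousWithinAt.tendsto.mono_left hmono
  have hpt : Tendsto (fun s => (pair (xc s) uc : SC n m)) (𝓝[Ico v.time (v.time + tc)] t)
      (𝓝 (pair (xc t) uc)) :=
    ((WithLp.prod_continuous_toLp 2 (E n) (E m)).tendsto _).comp
      (hxt.prodMk_nhds tendsto_const_nhds)
  refine ⟨fun z hz => ?_, hmode.isClosed_check.mem_of_tendsto hεt
    (eventually_mem_nhdsWithin.mono h.check₂)⟩
  have hev := (tendsto_const_nhds.dist hpt).eventually_lt (hεt.add hut) (Metric.mem_ball.1 hz)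
  obtain ⟨s, hs, hsI⟩ := (hev.and eventually_mem_nhdsWithin).exists
  exact h.check₁ s hsI hs

/-- Invariance of the tube along one edge of the plan. -/
theorem Accepted.inTube (hS : S.Regular) (hest : ValidEstimates S est) (hmode : mode.Regular)
    {v : Vertex n m} {uc : E m} {tc : ℝ} {xc : ℝ → E n} {εc : ℝ → ℝ}
    (h : Accepted S est mode Q v uc tc xc εc) (hv : 0 ≤ v.time) (hpos : 0 < v.err) {b : ℝ}
    (hb : b ≤ v.time + tc) {x : ℝ → E n} {u : ℝ → E m} (hx : ContinuousOn x (Icc v.time b))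
    (hode : ∀ t ∈ Ico v.time b, HasDerivWithinAt x (S.h (pair (x t) (u t))) (Ici t) t)
    (hstep : ∀ t ∈ Ico v.time b, StepContracts S est mode (xc t) uc (x t) (u t))
    (hfb : ∀ t ∈ Ico v.time b, ‖x t - xc t‖ ≤ εc t → ‖u t - uc‖ ≤ mode.ubar t (εc t))
    (h0 : riemDist S.X S.M v.state (x v.time) < ENNReal.ofReal (√est.lamLo * v.err)) :
    ∀ t ∈ Icc v.time b, InTube S est mode (xc t) uc (εc t) t (x t) := by
  obtain ⟨y, hy0, hy⟩ := h.isTube.exists_root hest hmode hv hpos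
  have hlo' : 0 < √est.lamLo := Real.sqrt_pos.2 hest.lamLo_pos
  have hsub : Icc v.time b ⊆ Icc v.time (v.time + tc) := Icc_subset_Icc_right hb
  have hyc : ContinuousOn y (Icc v.time (v.time + tc)) := fun t ht =>
    (hy t ht).2.2.continuousWithinAt
  have hεc : ContinuousOn εc (Icc v.time (v.time + tc)) :=
    (hyc.div_const _).congr fun t ht => (hy t ht).2.1
  have hεpos : ∀ t ∈ Icc v.time (v.time + tc), 0 < εc t := fun t ht => by
    rw [(hy t ht).2.1]; exact div_pos (hy t ht).1 hlo'
  have hεy : ∀ t ∈ Icc v.time (v.time + tc), √est.lamLo * εc t = y t := fun t ht => by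
    rw [(hy t ht).2.1, mul_div_cancel₀ _ hlo'.ne']
  have hchecks := fun t (ht : t ∈ Icc v.time (v.time + tc)) => h.checks hmode hv hεc ht
  have hunn : ∀ t ∈ Icc v.time (v.time + tc), 0 ≤ mode.ubar t (εc t) := fun t ht =>
    hmode.ubar_nonneg _ _ (hv.trans ht.1) (hεpos t ht).le
  have hball : ∀ t ∈ Icc v.time (v.time + tc), Metric.ball (xc t) (εc t) ⊆ S.projD := fun t ht =>
    ball_subset_projD (hunn t ht) (hchecks t ht).1
  have hright : ∀ {F : Type} [NormedAddCommGroup F] [NormedSpace ℝ F] {f : ℝ → F} {f' : F} {t : ℝ},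
      t ∈ Ico v.time b → HasDerivWithinAt f f' (Icc v.time (v.time + tc)) t →
      HasDerivWithinAt f f' (Ici t) t := fun ht hf =>
    hf.mono_of_mem_nhdsWithin (Icc_mem_nhdsGE_of_mem ⟨ht.1, ht.2.trans_le hb⟩)
  -- c is the linear decay rate in the equation for y, so y' + c (y - d) is the right-hand side of
  -- that equation with d in place of y.
  have main := hS.isMetric.riemDist_lt_barrier (p := xc) (q := x) (a := v.time) (b := b) (y := y)
    (c := S.rate - est.L * (√est.lamUp / √est.lamLo))
    hest.lamLo_pos (fun t ht => (h.edge.ode t (hsub ht)).continuousWithinAt.mono hsub) hx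
    (hyc.mono hsub) (fun t ht => hright ht (hy t (hsub (Ico_subset_Icc_self ht))).2.2)
    (fun t ht => by
      rw [← (hy t (hsub ht)).2.1]; exact (hball t (hsub ht)).trans hS.projD_subset)
    (fun t ht z hz w => by
      rw [← (hy t (hsub ht)).2.1] at hz
      exact hest.lo_le hS (hball t (hsub ht) hz) w) ?_
    (by rw [h.edge.start, hy0]; exact h0)
  · intro t ht
    refine ⟨hεpos t (hsub ht), (hchecks t (hsub ht)).1, (hchecks t (hsub ht)).2, ?_⟩
    rw [hεy t (hsub ht)]
    exact main t ht
  · intro t ht d hd hdy hdist η hη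
    have htI := hsub (Ico_subset_Icc_self ht)
    have hdε : d < √est.lamLo * εc t := by rwa [hεy t htI]
    obtain ⟨hn1, hn2⟩ := norm_sub_lt_of_riemDist_lt hS hest (hball t htI) hd hdε hdist
    have hu := hfb t ht hn2.le
    have hD := pair_mem_of_norm_lt (hchecks t htI).1 hn2 hu
    have hDs : (pair (xc t) uc : SC n m) ∈ S.D := (hchecks t htI).1
      (Metric.mem_ball_self (add_pos_of_pos_of_nonneg (hεpos t htI) (hunn t htI)))
    have hxD : x t ∈ S.projD := hball t htI (mem_ball_iff_norm.2 hn2)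
    have hsD : xc t ∈ S.projD := hball t htI (Metric.mem_ball_self (hεpos t htI))
    have herr := hest.norm_modelError_le hD hDs
    have hcontr := hstep t ht (εc t) d (hball t htI) hDs (hchecks t htI).2 hd hdε hdist
    filter_upwards [hS.isMetric.eventually_riemDist_step (hright ht (h.edge.ode t htI)) (hode t ht)
      (hS.projD_subset hsD) (hS.projD_subset hxD) (Real.sqrt_nonneg est.lamUp)
      (hest.le_up hS hxD) hd hcontr hη, eventually_one_sub_mul_nonneg S.rate,
      self_mem_nhdsWithin] with r h1 h2 h3
    rw [mem_Ioi] at h3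
    set μ : ℝ := ⨅ i, (est.L * ‖pair (xc t) uc - S.data i‖ + S.e i)
    have hx1 : ‖x t - xc t‖ ≤ d / √est.lamLo := by rwa [le_div_iff₀' hlo']
    have herr' : ‖S.modelError (pair (x t) (u t))‖ ≤
        est.L * (d / √est.lamLo + mode.ubar t (εc t)) + μ :=
      herr.trans (add_le_add (mul_le_mul_of_nonneg_left (add_le_add hx1 hu) hest.L_nonneg) le_rfl)
    have hK := mul_le_mul_of_nonneg_left herr' (Real.sqrt_nonneg est.lamUp)
    -- The part L d/√Λ̲ of the model error, weighted by √Λ̄, is what reduces the rate λ to λ -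
    -- L√(Λ̄/Λ̲).
    have hle : (1 - S.rate * r) * d
        + r * (√est.lamUp * ‖S.h (pair (x t) (u t)) - S.g (pair (x t) (u t))‖ + η)
        ≤ d + r * (-(S.rate - est.L * (√est.lamUp / √est.lamLo)) * y t
          + √est.lamUp * (μ + est.L * mode.ubar t (εc t))
          + (S.rate - est.L * (√est.lamUp / √est.lamLo)) * (y t - d) + η) := by
      have h4 := mul_le_mul_of_nonneg_left hK h3.le
      have h5 : r * (√est.lamUp * (est.L * (d / √est.lamLo + mode.ubar t (εc t)) + μ)) =
        r * (est.L * (√est.lamUp / √est.lamLo) * d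
          + √est.lamUp * (μ + est.L * mode.ubar t (εc t))) := by ring
      rw [h5] at h4
      change (1 - S.rate * r) * d
        + r * (√est.lamUp * ‖S.modelError (pair (x t) (u t))‖ + η) ≤ _
      linarith
    refine ⟨le_trans ?_ hle, h1.trans (ENNReal.ofReal_le_ofReal hle)⟩
    positivity

end Edge

/-! ### From edges to returned paths -/

section Path

variable {n m N : ℕ} {S : Setup n m N} {est : Estimates} {mode : Mode} {Q : Query n}

/-- A vertex all of whose edges back to the root are accepted extensions. -/
inductive IsPath (S : Setup n m N) (est : Estimates) (mode : Mode) (Q : Query n) :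
    Vertex n m → Prop
  | root : IsPath S est mode Q (Vertex.root Q.xI √(Q.E0 / est.lamLo))
  | child {v : Vertex n m} {uc : E m} {tc : ℝ} {xc : ℝ → E n} {εc : ℝ → ℝ} :
      IsPath S est mode Q v → Accepted S est mode Q v uc tc xc εc →
      IsPath S est mode Q (Vertex.child v uc tc xc εc)

theorem IsTree.isPath {T : Set (Vertex n m)} (hT : IsTree S est mode Q T) :
    ∀ v ∈ T, IsPath S est mode Q v := by
  induction hT with
  | start =>
    rintro v rfl
    exact .root
  | grow _ hv hacc _ ih =>
    rintro w (rfl | hw)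
    · exact .child (ih _ hv) hacc
    · exact ih w hw

theorem Returns.exists_child {w : Vertex n m} (h : Returns S est mode Q w) :
    ∃ v uc tc xc εc, w = Vertex.child v uc tc xc εc ∧ IsPath S est mode Q v ∧
      Accepted S est mode Q v uc tc xc εc := by
  obtain ⟨hT, hv, hacc, _⟩ := h
  exact ⟨_, _, _, _, _, rfl, hT.isPath _ hv, hacc⟩

theorem IsPath.time_nonneg {v : Vertex n m} (h : IsPath S est mode Q v) : 0 ≤ v.time := by
  induction h with
  | root => exact le_rfl
  | child _ hacc ih => exact add_nonneg ih hacc.edge.dwell_pos.le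

/-- The controller contracts and respects the feedback bound at time `t` along the path to `v`. -/
def GoodControl (S : Setup n m N) (est : Estimates) (mode : Mode) (v : Vertex n m) (x : ℝ → E n)
    (u : ℝ → E m) (t : ℝ) : Prop :=
  StepContracts S est mode (v.xs t) (v.us t) (x t) (u t) ∧
    (‖x t - v.xs t‖ ≤ v.tube t → ‖u t - v.us t‖ ≤ mode.ubar t (v.tube t))

/-- The execution is in the tube of the path to `v` at time `t`. -/
def InPathTube (S : Setup n m N) (est : Estimates) (mode : Mode) (v : Vertex n m) (x : ℝ → E n)
    (t : ℝ) : Prop :=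
  InTube S est mode (v.xs t) (v.us t) (v.tube t) t (x t)

theorem IsExecution.E0_pos {τ : ℝ} {x : ℝ → E n} {u : ℝ → E m} (h : IsExecution S Q τ x u) :
    0 < Q.E0 := ENNReal.ofReal_pos.1 (pos_of_gt h.initial)

theorem IsExecution.riemDist_lt {τ : ℝ} {x : ℝ → E n} {u : ℝ → E m}
    (h : IsExecution S Q τ x u) : riemDist S.X S.M Q.xI (x 0) < ENNReal.ofReal √Q.E0 := by
  have h1 := h.initial
  have h2 : ENNReal.ofReal Q.E0 = ENNReal.ofReal √Q.E0 ^ 2 := by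
    rw [← ENNReal.ofReal_pow (Real.sqrt_nonneg _), Real.sq_sqrt h.E0_pos.le]
  rw [energy, h2] at h1
  by_contra hc
  exact absurd h1 (not_lt.2 (pow_le_pow_left' (not_lt.1 hc) 2))

/-- Extending tube invariance from a vertex along an accepted edge. -/
theorem Accepted.inPathTube (hS : S.Regular) (hest : ValidEstimates S est) (hmode : mode.Regular)
    {v : Vertex n m} {uc : E m} {tc : ℝ} {xc : ℝ → E n} {εc : ℝ → ℝ}
    (h : Accepted S est mode Q v uc tc xc εc) (hv : 0 ≤ v.time) (hpos : 0 < v.err) {τ : ℝ}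
    {x : ℝ → E n} {u : ℝ → E m} (hex : IsExecution S Q τ x u)
    (hgood : ∀ t ∈ Icc 0 τ, t < v.time + tc →
      GoodControl S est mode (Vertex.child v uc tc xc εc) x u t)
    (hbefore : ∀ t ∈ Icc 0 τ, t < v.time → InPathTube S est mode v x t)
    (hend : v.time ≤ τ →
      riemDist S.X S.M v.state (x v.time) < ENNReal.ofReal (√est.lamLo * v.err)) :
    ∀ t ∈ Icc 0 τ, t ≤ v.time + tc →
      InPathTube S est mode (Vertex.child v uc tc xc εc) x t := by
  intro t ht htw
  -- The junction time belongs to the new edge, as in the definitions of `Vertex.xs`, `Vertex.us`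
  -- and `Vertex.tube`.
  rcases lt_or_ge t v.time with hlt | hge
  · have := hbefore t ht hlt
    simpa only [InPathTube, Vertex.xs, Vertex.us, Vertex.tube, if_pos hlt] using this
  · have hvτ : v.time ≤ τ := hge.trans ht.2
    have hsub : ∀ s ∈ Icc v.time (min τ (v.time + tc)), s ∈ Icc 0 τ := fun s hs =>
      ⟨hv.trans hs.1, hs.2.trans (min_le_left _ _)⟩
    have hg : ∀ s ∈ Ico v.time (min τ (v.time + tc)),
        StepContracts S est mode (xc s) uc (x s) (u s) ∧
          (‖x s - xc s‖ ≤ εc s → ‖u s - uc‖ ≤ mode.ubar s (εc s)) := fun s hs => by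
      have := hgood s (hsub s (Ico_subset_Icc_self hs)) (hs.2.trans_le (min_le_right _ _))
      simpa only [GoodControl, Vertex.xs, Vertex.us, Vertex.tube, if_neg (not_lt.2 hs.1)] using this
    have := h.inTube hS hest hmode hv hpos (min_le_right τ (v.time + tc))
      (hex.cont.mono hsub) (fun s hs => hex.ode s ⟨hv.trans hs.1, hs.2.trans_le (min_le_left _ _)⟩)
      (fun s hs => (hg s hs).1) (fun s hs => (hg s hs).2) (hend hvτ) t ⟨hge, le_min ht.2 htw⟩
    simpa only [InPathTube, Vertex.xs, Vertex.us, Vertex.tube, if_neg (not_lt.2 hge)] using this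

theorem Accepted.err_pos (hest : ValidEstimates S est) (hmode : mode.Regular)
    {v : Vertex n m} {uc : E m} {tc : ℝ} {xc : ℝ → E n} {εc : ℝ → ℝ}
    (h : Accepted S est mode Q v uc tc xc εc) (hv : 0 ≤ v.time) (hpos : 0 < v.err) :
    0 < (Vertex.child v uc tc xc εc).err := by
  obtain ⟨y, _, hy⟩ := h.isTube.exists_root hest hmode hv hpos
  obtain ⟨h1, h2, _⟩ := hy (v.time + tc) (right_mem_Icc.2
    (le_add_of_nonneg_right h.edge.dwell_pos.le))
  rw [Vertex.err, h2]
  exact div_pos h1 (Real.sqrt_pos.2 hest.lamLo_pos)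

/-- Induction along the path. The control jumps at a node, so tube membership is claimed strictly
before it; what crosses the node is the distance bound, together with positivity of the radius. -/
theorem IsPath.inPathTube (hS : S.Regular) (hest : ValidEstimates S est) (hmode : mode.Regular)
    {τ : ℝ} {x : ℝ → E n} {u : ℝ → E m} (hex : IsExecution S Q τ x u) {v : Vertex n m}
    (h : IsPath S est mode Q v) :
    0 < v.err ∧ ((∀ t ∈ Icc 0 τ, t < v.time → GoodControl S est mode v x u t) →
      (∀ t ∈ Icc 0 τ, t < v.time → InPathTube S est mode v x t) ∧
      (v.time ≤ τ → riemDist S.X S.M v.state (x v.time) <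
        ENNReal.ofReal (√est.lamLo * v.err))) := by
  induction h with
  | root =>
    have hlo := hest.lamLo_pos
    refine ⟨Real.sqrt_pos.2 (div_pos hex.E0_pos hlo), fun _ =>
      ⟨fun t ht ht' => absurd ht.1 (not_le.2 ht'), fun _ => ?_⟩⟩
    simp only [Vertex.state, Vertex.time, Vertex.err]
    rw [Real.sqrt_div' _ hlo.le, mul_div_cancel₀ _ (Real.sqrt_pos.2 hlo).ne']
    exact hex.riemDist_lt
  | @child v uc tc xc εc hv hacc ih =>
    have hv0 := hv.time_nonneg
    refine ⟨hacc.err_pos hest hmode hv0 ih.1, fun hgood => ?_⟩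
    have htc := hacc.edge.dwell_pos
    obtain ⟨h1, h2⟩ := ih.2 fun t ht htv => by
      have := hgood t ht (lt_add_of_lt_of_pos htv htc)
      simpa only [GoodControl, Vertex.xs, Vertex.us, Vertex.tube, if_pos htv] using this
    have hin := hacc.inPathTube hS hest hmode hv0 ih.1 hex hgood h1 h2
    refine ⟨fun t ht htw => hin t ht htw.le, fun hτ => ?_⟩
    have hτ' : v.time + tc ≤ τ := hτ
    have := (hin (v.time + tc) ⟨by linarith, hτ'⟩ le_rfl).riemDist_lt
    have hnlt : ¬ v.time + tc < v.time := by linarith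
    simp only [Vertex.xs, Vertex.tube, if_neg hnlt] at this
    exact this

/-- Along a returned path, the execution stays in the tube and in the trusted domain. -/
theorem Returns.mem_domain (hS : S.Regular) (hest : ValidEstimates S est) (hmode : mode.Regular)
    {w : Vertex n m} (hw : Returns S est mode Q w) {τ : ℝ} {x : ℝ → E n} {u : ℝ → E m}
    (hτ : τ ≤ w.time) (hex : IsExecution S Q τ x u)
    (hstep : ∀ t ∈ Icc 0 τ, StepContracts S est mode (w.xs t) (w.us t) (x t) (u t))
    (hfb : ValidFeedbackBound mode w τ x u) :
    ∀ t ∈ Icc 0 τ, ‖x t - w.xs t‖ < w.tube t ∧ mode.Check (w.tube t) ∧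
      pair (w.xs t) (w.us t) ∈ S.D ∧ pair (x t) (u t) ∈ S.D := by
  -- The last edge is split off because the endpoint t = T is included, which the induction over the
  -- path leaves out.
  obtain ⟨v, uc, tc, xc, εc, rfl, hv, hacc⟩ := hw.exists_child
  obtain ⟨hpos, hih⟩ := hv.inPathTube hS hest hmode hex
  have hgood : ∀ t ∈ Icc 0 τ, GoodControl S est mode (Vertex.child v uc tc xc εc) x u t :=
    fun t ht => ⟨hstep t ht, hfb t ht⟩
  obtain ⟨h1, h2⟩ := hih fun t ht htv => by
    have := hgood t ht
    simpa only [GoodControl, Vertex.xs, Vertex.us, Vertex.tube, if_pos htv] using this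
  intro t ht
  have hin := hacc.inPathTube hS hest hmode hv.time_nonneg hpos hex (fun t ht _ => hgood t ht) h1 h2
    t ht (ht.2.trans hτ)
  have hlt := hin.norm_sub_lt hS hest hmode ht.1
  exact ⟨hlt, hin.check,
    hin.subset (Metric.mem_ball_self
      (add_pos_of_pos_of_nonneg hin.pos (hmode.ubar_nonneg _ _ ht.1 hin.pos.le))),
    pair_mem_of_norm_lt hin.subset hlt (hfb t ht hlt.le)⟩

end Path

end LMTCD

theorem mainTheorem3 {n m N : ℕ} (S : LMTCD.Setup n m N) (hS : S.Regular)
    (est : LMTCD.Estimates) (hest : LMTCD.ValidEstimates S est) (Q : LMTCD.Query n) :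
    -- optimization-based controller, strong conditions
    (∀ (k : ℕ) (Bperp : LMTCD.E n → Matrix (Fin n) (Fin k) ℝ) (lamCCM δu : ℝ),
      (∀ x ∈ S.projD, LMTCD.IsAnnihilatorBasis (S.B x) (Bperp x)) →
      LMTCD.supEig S.projD (S.Cs Bperp) ≤ (lamCCM : EReal) → lamCCM < 0 →
      (∀ x ∈ S.projD, S.StrongOrth Bperp x) →
      0 ≤ δu →
      ∀ w : LMTCD.Vertex n m, LMTCD.Returns S est (.strong δu) Q w →
      ∀ (τ : ℝ) (x : ℝ → LMTCD.E n) (u : ℝ → LMTCD.E m), 0 ≤ τ → τ ≤ w.time →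
      LMTCD.IsExecution S Q τ x u →
      (∀ t ∈ Set.Icc 0 τ, S.IsStrongControl (w.xs t) (w.us t) (x t) (u t)) →
      LMTCD.ValidFeedbackBound (.strong δu) w τ x u →
      ∀ t ∈ Set.Icc 0 τ,
        LMTCD.pair (w.xs t) (w.us t) ∈ S.D ∧ LMTCD.pair (x t) (u t) ∈ S.D) ∧
    -- learned controller, weak condition
    (∀ (κ : LMTCD.E n → LMTCD.E n → LMTCD.E m → LMTCD.E m) (lamCCM εmax : ℝ) (ufb : ℝ → ℝ),
      (∀ z ∈ S.D, ContDiffOn ℝ 1 (fun y => κ y z.fst z.snd)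
        {y | y ∈ Metric.ball 0 εmax ∧ z.fst + y ∈ S.X}) →
      (∀ z ∈ S.D, κ 0 z.fst z.snd = z.snd) →
      LMTCD.supEig (S.weakDomain εmax) (S.Cw κ) ≤ (lamCCM : EReal) → lamCCM < 0 →
      ContinuousOn ufb (Set.Ici 0) → (∀ t, 0 ≤ t → 0 ≤ ufb t) →
      ∀ w : LMTCD.Vertex n m, LMTCD.Returns S est (.weak ufb εmax) Q w →
      ∀ (τ : ℝ) (x : ℝ → LMTCD.E n) (u : ℝ → LMTCD.E m), 0 ≤ τ → τ ≤ w.time →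
      LMTCD.IsExecution S Q τ x u →
      (∀ t ∈ Set.Icc 0 τ, u t = κ (x t - w.xs t) (w.xs t) (w.us t)) →
      LMTCD.ValidFeedbackBound (.weak ufb εmax) w τ x u →
      ∀ t ∈ Set.Icc 0 τ,
        x t - w.xs t ∈ Metric.ball (0 : LMTCD.E n) εmax ∧
        LMTCD.pair (w.xs t) (w.us t) ∈ S.D ∧
        LMTCD.pair (x t) (u t) ∈ S.D) := by
  refine ⟨?_, ?_⟩
  · intro k Bperp lamCCM δu hP hC hlam hO hδu w hw τ x u _ hτ hex hu hfb t ht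
    exact (hw.mem_domain hS hest (LMTCD.Mode.regular_strong hδu) hτ hex
      (fun t ht => LMTCD.stepContracts_strong hS hest δu hP hC hlam hO (hu t ht)) hfb t ht).2.2
  · intro κ lamCCM εmax ufb hκ hκ0 hC hlam hcont hnn w hw τ x u _ hτ hex hu hfb t ht
    obtain ⟨h1, h2, h3⟩ := hw.mem_domain hS hest (LMTCD.Mode.regular_weak εmax hcont hnn) hτ hex
      (fun t ht => LMTCD.stepContracts_weak hS hest ufb hκ hκ0 hC hlam (hu t ht)) hfb t ht
    exact ⟨mem_ball_zero_iff.2 (h1.trans_le h2), h3⟩
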